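/- **Setting.** Let $H$ be a hexagon with sides $a,C,b,A,c,B$ in cyclic order; homotopies fix each side setwise. An *arc triple* $\partial=\{\partial_1,\partial_2,\partial_3\}$ consists of three disjoint, pairwise non-homotopic arcs, each joining two non-adjacent sides of $H$ (there are 14 of them up to homotopy). For each side, the same letter also denotes the arc parallel to it, joining its two neighbours. *Measured foliations.* A measured foliation $F$ of $H$ is given, up to homotopy, by a finite non-empty family of disjoint bands of leaves, each leaf joining two non-adjacent sides, with an invariant transverse measure (the complementary regions being collapsed). For an arc $\delta$, $i(F,\delta)$ is the infimum of the transverse measures of the arcs homotopic to $\delta$. Write $i_*(F)=(i(F,a),i(F,b),i(F,c),i(F,A),i(F,B),i(F,C))\in\mathbb R^6_{\ge0}$. $F$ is *in good position* with respect to $\partial$ if $\sum_j i(F,\partial_j)>0$ and no leaf of $F$ is parallel to one of the $\partial_j$. *Right hexagons.* A right hexagon $h$ is a hyperbolic metric on $H$ with geodesic sides and all angles right. $l_h(\delta)$ is the length of the shortest arc homotopic to $\delta$, and $l_*(h)=(l_h(a),l_h(b),l_h(c),l_h(A),l_h(B),l_h(C))\in\mathbb R^6_{>0}$. *Compactification.*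 Let $\pi:\mathbb R^6\setminus\{0\}\to \mathrm P\mathbb R^6$ be the projection, identify the Teichmüller space $\mathcal T$ of right hexagons with its image under $\pi\circ l_*$ and $\mathcal{PMF}$ with the image of measured foliations under $\pi\circ i_*$, and let $\overline{\mathcal T}=\mathcal T\cup\mathcal{PMF}\subset \mathrm P\mathbb R^6$ with the subspace topology. Let $\mathcal{PMF}_\partial\subset\mathcal{PMF}$ be the set of classes of foliations in good position with respect to $\partial$, $\mathrm{int}(\mathcal{PMF}_\partial)$ its interior in $\mathcal{PMF}$, and, for $\varepsilon\ge0$, let $\mathcal T^\varepsilon_\partial=\{h\in\mathcal T: l_h(\partial_j)>\varepsilon,\ j=1,2,3\}$ (so $\mathcal T^0_\partial=\mathcal T$). **Proposition (boundary charts of $\overline{\mathcal T}$).** Let $\partial$ be an arc triple and $\varepsilon\ge 0$. 1. For every $h\in\mathcal T^\varepsilon_\partial$ there is a measured foliation $q_\partial(h)$ in good position with respect to $\partial$ such that $i(q_\partial(h),\partial_j)=l_h(\partial_j)$ for $j=1,2,3$, and all such foliations have the same intersection number with every arc joining two non-adjacent sides. 2. The map $$\phi_\partial:\ \mathcal T^\varepsilon_\partial\cup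 \mathrm{int}(\mathcal{PMF}_\partial)\to \mathrm{int}(\mathcal{PMF}_\partial)\times[0,1),$$ $$\phi_\partial(x)=(x,0)\ \text{ for } x\in\mathrm{int}(\mathcal{PMF}_\partial),\qquad \phi_\partial(h)=\bigl(\pi\circ i_*(q_\partial(h)),\,e^{-(l_h(\partial_1)+l_h(\partial_2)+l_h(\partial_3))}\bigr)\ \text{ for } h\in\mathcal T^\varepsilon_\partial,$$ is well defined and is a homeomorphism onto an open subset of $\mathrm{int}(\mathcal{PMF}_\partial)\times[0,1)$, namely onto the set of the pairs $(z,t)$ such that $t=0$, or $t>0$ and the representative $F$ of $z$ in good position with respect to $\partial$ for which $\sum_j i(F,\partial_j)=-\log t$ satisfies $i(F,\partial_j)>\varepsilon$ for $j=1,2,3$. If $\varepsilon=0$, then $\phi_\partial$ is a homeomorphism of $\mathcal T\cup\mathrm{int}(\mathcal{PMF}_\partial)$ onto $\mathrm{int}(\mathcal{PMF}_\partial)\times[0,1)$. 3. The domain $\mathcal T^\varepsilon_\partial\cup \mathrm{int}(\mathcal{PMF}_\partial)$ is open in $\overline{\mathcal T}$, so that $\phi_\partial$ is a boundary chart of $\overline{\mathcal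 T}$. -/

import Mathlib

open scoped LinearAlgebra.Projectivization ENNReal Topology

noncomputable section

namespace Hexagon

/-! The six sides are numbered cyclically by `Fin 6`: in the notation `a, C, b, A, c, B` for the
sides in cyclic order, `0 = a`, `1 = C`, `2 = b`, `3 = A`, `4 = c`, `5 = B`. -/

/-- A homotopy class (each side being fixed setwise) of arcs of the hexagon joining two
non-adjacent sides. The hexagon is simply connected, so the class is given by the two sides. -/
structure ArcClass where
  s : Fin 6
  t : Fin 6
  ne : s ≠ t
  not_next : s + 1 ≠ t
  not_prev : t + 1 ≠ s

/-- The two classes are the same, that is, their arcs are parallel (arcs are not oriented). -/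
def ArcClass.Same (e f : ArcClass) : Prop :=
  (e.s = f.s ∧ e.t = f.t) ∨ (e.s = f.t ∧ e.t = f.s)

/-- The side `u` lies strictly between the sides `e.s` and `e.t`. -/
def ArcClass.Between (e : ArcClass) (u : Fin 6) : Prop :=
  min e.s e.t < u ∧ u < max e.s e.t

/-- The end sides of the two arcs are four distinct sides and they alternate on the boundary.
Two classes have disjoint representatives if and only if they do not cross. -/
def ArcClass.Crosses (e f : ArcClass) : Prop :=
  e.s ≠ f.s ∧ e.s ≠ f.t ∧ e.t ≠ f.s ∧ e.t ≠ f.t ∧ ¬ (e.Between f.s ↔ e.Between f.t)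

/-- The arc parallel to the side `k`: it joins the two neighbours of `k`. -/
def ArcClass.side (k : Fin 6) : ArcClass where
  s := k - 1
  t := k + 1
  ne := by revert k; decide
  not_next := by revert k; decide
  not_prev := by revert k; decide

/-- Three disjoint, pairwise non-homotopic arcs, each joining two non-adjacent sides. -/
structure ArcTriple where
  arc : Fin 3 → ArcClass
  not_same : ∀ j k, j ≠ k → ¬ (arc j).Same (arc k)
  disjoint : ∀ j k, j ≠ k → ¬ (arc j).Crosses (arc k)

/-! ### Measured foliations -/

/-- The vertices of an (affinely regular) convex hexagon in the plane, in counterclockwise order. -/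
def vertex : Fin 6 → ℝ × ℝ :=
  ![(1, 0), (1, 1), (0, 1), (-1, 0), (-1, -1), (0, -1)]

/-- The hexagon, as a closed disc with six marked sides. -/
def body : Set (ℝ × ℝ) := convexHull ℝ (Set.range vertex)

/-- The (relatively open) side number `k` of the hexagon. -/
def edge (k : Fin 6) : Set (ℝ × ℝ) := openSegment ℝ (vertex k) (vertex (k + 1))

/-- `γ`, restricted to `[0,1]`, is an arc of the hexagon in the class `e`. -/
def IsArc (e : ArcClass) (γ : ℝ → ℝ × ℝ) : Prop :=
  ContinuousOn γ (Set.Icc 0 1) ∧ Set.InjOn γ (Set.Icc 0 1) ∧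
    γ 0 ∈ edge e.s ∧ γ 1 ∈ edge e.t ∧ ∀ r ∈ Set.Ioo (0 : ℝ) 1, γ r ∈ interior body

/-- A band foliated by parallel leaves: the leaves are disjoint arcs of one class, taken straight
(which is no restriction up to homotopy), depending continuously on a parameter `u ∈ [0, width]`
which is the transverse measure. -/
structure Band extends ArcClass where
  width : ℝ
  width_pos : 0 < width
  p : ℝ → ℝ × ℝ
  q : ℝ → ℝ × ℝ
  continuousOn_p : ContinuousOn p (Set.Icc 0 width)
  continuousOn_q : ContinuousOn q (Set.Icc 0 width)
  p_mem : ∀ u ∈ Set.Icc 0 width, p u ∈ edge s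
  q_mem : ∀ u ∈ Set.Icc 0 width, q u ∈ edge t
  disjoint_leaves : ∀ u ∈ Set.Icc 0 width, ∀ u' ∈ Set.Icc 0 width, u ≠ u' →
    Disjoint (segment ℝ (p u) (q u)) (segment ℝ (p u') (q u'))

/-- The leaf with parameter `u`. -/
def Band.leaf (b : Band) (u : ℝ) : Set (ℝ × ℝ) := segment ℝ (b.p u) (b.q u)

/-- The support of the band. -/
def Band.support (b : Band) : Set (ℝ × ℝ) := ⋃ u ∈ Set.Icc 0 b.width, b.leaf u

/-- A measured foliation of the hexagon, presented as a partial foliation: finitely many (at least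
one) disjoint bands of leaves, the complementary regions being collapsed. -/
structure MeasuredFoliation where
  n : ℕ
  n_pos : 0 < n
  band : Fin n → Band
  disjoint_bands : ∀ k l, k ≠ l → Disjoint (band k).support (band l).support

/-- The transverse measure of a curve `γ : [0,1] → body`: the number of its intersection points
with a leaf, integrated over the leaves. -/
def MeasuredFoliation.measure (F : MeasuredFoliation) (γ : ℝ → ℝ × ℝ) : ℝ≥0∞ :=
  ∑ k, ∫⁻ u in Set.Icc 0 (F.band k).width,
    (({r ∈ Set.Icc (0 : ℝ) 1 | γ r ∈ (F.band k).leaf u}.encard : ℕ∞) : ℝ≥0∞)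

/-- The geometric intersection number `i(F, e)`: the infimum of the transverse measure over all
arcs in the class `e`. -/
def MeasuredFoliation.inter (F : MeasuredFoliation) (e : ArcClass) : ℝ :=
  (⨅ (γ : ℝ → ℝ × ℝ) (_ : IsArc e γ), F.measure γ).toReal

/-- `F` is in good position with respect to `d`: some arc of `d` has positive measure, and no leaf
of `F` is parallel to an arc of `d`. -/
def MeasuredFoliation.GoodPosition (F : MeasuredFoliation) (d : ArcTriple) : Prop :=
  0 < ∑ j, F.inter (d.arc j) ∧ ∀ k j, ¬ (F.band k).toArcClass.Same (d.arc j)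

/-- The intersection functional `i_*` on the six arcs parallel to the sides. -/
def MeasuredFoliation.interVec (F : MeasuredFoliation) : Fin 6 → ℝ :=
  fun k => F.inter (ArcClass.side k)

/-! ### Right hexagons -/

/-- The image of `w` in the disc under the orientation preserving conformal isometry of the
hyperbolic plane onto the unit disc that sends `z` to `0`. It maps the geodesics from `z` to
Euclidean rays, so it shows the direction in which `w` is seen from `z`. -/
def dir (z w : UpperHalfPlane) : ℂ :=
  ((w : ℂ) - (z : ℂ)) / ((w : ℂ) - (starRingEnd ℂ) (z : ℂ))

/-- A right hexagon: a convex geodesic hexagon in the hyperbolic plane, with vertices in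
counterclockwise order, all of whose angles are right. -/
structure RightHexagon where
  v : Fin 6 → UpperHalfPlane
  /-- All other vertices lie strictly to the left of the line directed from `v i` to `v (i+1)`. -/
  convex : ∀ i j, j ≠ i → j ≠ i + 1 →
    0 < ((starRingEnd ℂ) (dir (v i) (v (i + 1))) * dir (v i) (v j)).im
  right_angle : ∀ i,
    InnerProductGeometry.angle (dir (v i) (v (i - 1))) (dir (v i) (v (i + 1))) = Real.pi / 2

/-- The side number `k`: the geodesic segment from `v k` to `v (k+1)`. -/
def RightHexagon.side (h : RightHexagon) (k : Fin 6) : Set UpperHalfPlane :=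
  {x | dist (h.v k) x + dist x (h.v (k + 1)) = dist (h.v k) (h.v (k + 1))}

/-- The length `l_h(e)`: the infimum of the lengths of the arcs in the class `e`. As the hexagon is
convex, this is the distance between the two sides joined by `e`. -/
def RightHexagon.length (h : RightHexagon) (e : ArcClass) : ℝ :=
  sInf {r | ∃ x ∈ h.side e.s, ∃ y ∈ h.side e.t, r = dist x y}

/-- The length functional `l_*` on the six arcs parallel to the sides; the `k`-th coordinate is
the length of the side number `k`, the common perpendicular of its two neighbours. -/
def RightHexagon.lengthVec (h : RightHexagon) : Fin 6 → ℝ :=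
  fun k => h.length (ArcClass.side k)

/-! ### The compactification and its charts -/

/-- The projective space of `ℝ⁶`. -/
abbrev PSpace : Type := ℙ ℝ (Fin 6 → ℝ)

/-- The quotient topology. -/
instance : TopologicalSpace PSpace :=
  TopologicalSpace.coinduced (Projectivization.mk' ℝ) inferInstance

/-- `v ≠ 0` and `x = π(v)`. -/
def IsProj (x : PSpace) (v : Fin 6 → ℝ) : Prop :=
  ∃ hv : v ≠ 0, x = Projectivization.mk ℝ v hv

/-- The Teichmüller space of the right hexagon, inside the projective space. -/
def teich : Set PSpace := {x | ∃ h : RightHexagon, IsProj x h.lengthVec}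

/-- The space of projective measured foliations, inside the projective space. -/
def PMF : Set PSpace := {x | ∃ F : MeasuredFoliation, IsProj x F.interVec}

/-- The compactification of the Teichmüller space. -/
def teichBar : Set PSpace := teich ∪ PMF

/-- `h` is in `T^ε_d`: the three lengths exceed `ε`. -/
def RightHexagon.InPatch (h : RightHexagon) (d : ArcTriple) (ε : ℝ) : Prop :=
  ∀ j, ε < h.length (d.arc j)

/-- `T^ε_d`, inside the projective space. -/
def teichPatch (d : ArcTriple) (ε : ℝ) : Set PSpace :=
  {x | ∃ h : RightHexagon, h.InPatch d ε ∧ IsProj x h.lengthVec}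

/-- The projective classes of the measured foliations in good position with respect to `d`. -/
def PMFpatch (d : ArcTriple) : Set PSpace :=
  {x | ∃ F : MeasuredFoliation, F.GoodPosition d ∧ IsProj x F.interVec}

/-- The interior of `PMFpatch d` in the space `PMF`. -/
def PMFint (d : ArcTriple) : Set PSpace :=
  Subtype.val '' interior ((Subtype.val : PMF → PSpace) ⁻¹' PMFpatch d)

/-- The domain of the chart. -/
def chartDomain (d : ArcTriple) (ε : ℝ) : Set PSpace := teichPatch d ε ∪ PMFint d

/-- `F` represents `q_d(h)`: it is in good position with respect to `d` and the transverse measure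
of each arc of `d` is its length in `h`. -/
def IsFoliationOf (d : ArcTriple) (h : RightHexagon) (F : MeasuredFoliation) : Prop :=
  F.GoodPosition d ∧ ∀ j, F.inter (d.arc j) = h.length (d.arc j)

/-- `φ` is the map `φ_d`. -/
def IsChartMap (d : ArcTriple) (ε : ℝ)
    (φ : chartDomain d ε → PMFint d × Set.Ico (0 : ℝ) 1) : Prop :=
  (∀ x : chartDomain d ε, (x : PSpace) ∈ PMFint d →
    ((φ x).1 : PSpace) = x ∧ ((φ x).2 : ℝ) = 0) ∧
  (∀ x : chartDomain d ε, ∀ h : RightHexagon, h.InPatch d ε → IsProj x h.lengthVec →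
    ((φ x).2 : ℝ) = Real.exp (-∑ j, h.length (d.arc j)) ∧
    ∀ F : MeasuredFoliation, IsFoliationOf d h F → IsProj (φ x).1 F.interVec)

/-- The pairs `(z, t)` such that `t = 0`, or `t > 0` and the representative `F` of `z` for which the
sum of the three measures is `-log t` has its three measures greater than `ε`. -/
def chartImage (d : ArcTriple) (ε : ℝ) : Set (PMFint d × Set.Ico (0 : ℝ) 1) :=
  {y | (y.2 : ℝ) = 0 ∨ (0 < (y.2 : ℝ) ∧ ∃ F : MeasuredFoliation, F.GoodPosition d ∧
    IsProj y.1 F.interVec ∧ ∑ j, F.inter (d.arc j) = -Real.log (y.2 : ℝ) ∧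
    ∀ j, ε < F.inter (d.arc j))}

end Hexagon

end

/-! Both halves of the compactification reduce to finite data. A foliation amounts to nonnegative
weights on the nine classes of arcs, crossing classes never being positive together. A chord
threaded through the gaps between the bands meets only the leaves that every arc of its class must
meet, so intersection numbers are sums of weights (`inter_eq`, `inter_eq_cross`); conversely all
nonzero weights are realized (`exists_foliation`). A right hexagon amounts to six side lengths
satisfying the law of cosines: `IsFrame.isHex` and `IsHex.exists_rightHexagon` pass between the two
in the hyperboloid model, and `length_eq_hexLen` expresses every arc length through the sides.

The bridge is tropical. If hexagons degenerate and lengths are divided by `s → ∞`, then the limit of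
`log (sinh x) / s` has positive part the limit of `x / s`, while a negative limit means that `x`
shrinks to zero. Taking logarithms in the hexagon formulas turns them into piecewise linear
identities, which say that the limits of the lengths are the intersection numbers of the weights
formed by the negative parts (`exists_weight_of_tendsto`). Leaves thus appear parallel to arcs that
shrink. If the lengths on a triple stay away from zero, the limit has no leaf parallel to the
triple.

A triple consists either of arcs parallel to alternate sides, or of an arc joining opposite sides
with one short arc on each side of it. In both cases the three lengths of a hexagon are arbitrary
and determine it (`exists_isHex_hexLen`, `eq_of_hexLen_eq`), and three intersection numbers
determine a foliation without leaves parallel to the triple (`Weight.eq_of_cross_eq`). Foliations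
with prescribed positive numbers are obtained as limits of hexagons with proportional lengths on the
triple (`exists_weight_cross`). The interior of the set of foliations in good position consists of
those meeting all three arcs (`mem_PMFint_iff`).

The topology is tested on ultrafilters. Every foliation misses some side (`exists_deg_eq_zero`) and
proportional hexagons are equal (`eq_one_of_smul`), so hexagons and foliations are disjoint in the
projective space and normalization loses nothing. Along an ultrafilter the perimeters are bounded,
and the limit is a hexagon, or infinite, and the limit is a foliation. Hence convergence is
equivalent to convergence of the proportions of the three numbers and of the exponential of minus
their sum, with value zero for foliations (`tendsto_iff_coord`). These coordinates make the chart an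
embedding, and its image is then described and seen to be open. -/

namespace Hexagon

/-! ### Chords of the hexagon -/

/-- Twice the signed area of the triangle `P Q R`. -/
def orient (P Q R : ℝ × ℝ) : ℝ :=
  (Q.1 - P.1) * (R.2 - P.2) - (Q.2 - P.2) * (R.1 - P.1)

lemma orient_rotate (P Q R : ℝ × ℝ) : orient P Q R = orient Q R P := by
  unfold orient; ring

lemma orient_swap (P Q R : ℝ × ℝ) : orient P Q R = -orient Q P R := by
  unfold orient; ring

/-- The point of the side `s` with parameter `τ`. -/
def bp (s : Fin 6) (τ : ℝ) : ℝ × ℝ :=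
  ((1 - τ) * (vertex s).1 + τ * (vertex (s + 1)).1,
    (1 - τ) * (vertex s).2 + τ * (vertex (s + 1)).2)

lemma mem_edge_iff {s : Fin 6} {x : ℝ × ℝ} :
    x ∈ edge s ↔ ∃ τ, 0 < τ ∧ τ < 1 ∧ x = bp s τ := by
  unfold edge openSegment bp
  constructor
  · rintro ⟨a, b, ha, hb, hab, rfl⟩
    refine ⟨b, hb, by linarith, ?_⟩
    obtain rfl : a = 1 - b := by linarith
    ext <;> simp
  · rintro ⟨τ, h0, h1, rfl⟩
    refine ⟨1 - τ, τ, by linarith, h0, by ring, ?_⟩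
    ext <;> simp

/-- The coordinates of the vertices are integers. -/
def intVertex : Fin 6 → ℤ × ℤ :=
  ![(1, 0), (1, 1), (0, 1), (-1, 0), (-1, -1), (0, -1)]

lemma vertex_eq (s : Fin 6) :
    vertex s = (((intVertex s).1 : ℝ), ((intVertex s).2 : ℝ)) := by
  fin_cases s <;> simp [vertex, intVertex]

def intOrient (i j k : Fin 6) : ℤ :=
  ((intVertex j).1 - (intVertex i).1) * ((intVertex k).2 - (intVertex i).2) -
    ((intVertex j).2 - (intVertex i).2) * ((intVertex k).1 - (intVertex i).1)

lemma orient_vertex (i j k : Fin 6) :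
    orient (vertex i) (vertex j) (vertex k) = intOrient i j k := by
  simp only [orient, vertex_eq, intOrient]; push_cast; ring

/-- Trilinearity reduces the sign of the orientation of three boundary points to a finite table of
integers. -/
lemma orient_bp (s t u : Fin 6) (τ σ ρ : ℝ) :
    orient (bp s τ) (bp t σ) (bp u ρ) =
      (1 - τ) * (1 - σ) * (1 - ρ) * intOrient s t u +
      (1 - τ) * (1 - σ) * ρ * intOrient s t (u + 1) +
      (1 - τ) * σ * (1 - ρ) * intOrient s (t + 1) u +
      (1 - τ) * σ * ρ * intOrient s (t + 1) (u + 1) +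
      τ * (1 - σ) * (1 - ρ) * intOrient (s + 1) t u +
      τ * (1 - σ) * ρ * intOrient (s + 1) t (u + 1) +
      τ * σ * (1 - ρ) * intOrient (s + 1) (t + 1) u +
      τ * σ * ρ * intOrient (s + 1) (t + 1) (u + 1) := by
  simp only [← orient_vertex, orient, bp]; ring

/-- Coefficients vanish only where shifted vertices coincide. One strict coefficient suffices, since
all its weights are positive for interior points of sides. -/
lemma intOrient_nonneg : ∀ s t u : Fin 6, s < t → t < u →
    0 < intOrient s t u ∧ 0 ≤ intOrient s t (u + 1) ∧ 0 ≤ intOrient s (t + 1) u ∧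
    0 ≤ intOrient s (t + 1) (u + 1) ∧ 0 ≤ intOrient (s + 1) t u ∧
    0 ≤ intOrient (s + 1) t (u + 1) ∧ 0 ≤ intOrient (s + 1) (t + 1) u ∧
    0 ≤ intOrient (s + 1) (t + 1) (u + 1) := by decide

lemma intOrient_side : ∀ s u : Fin 6, 0 ≤ intOrient s (s + 1) u ∧
    (u ≠ s → u ≠ s + 1 → 0 < intOrient s (s + 1) u) := by decide

/-- The linear function that vanishes on the side `s` and is positive inside. -/
def ell (s : Fin 6) (x : ℝ × ℝ) : ℝ := orient (vertex s) (vertex (s + 1)) x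

lemma ell_bp (s u : Fin 6) (ρ : ℝ) :
    ell s (bp u ρ) = (1 - ρ) * intOrient s (s + 1) u + ρ * intOrient s (s + 1) (u + 1) := by
  simp only [← orient_vertex, ell, orient, bp]; ring

lemma ell_bp_self (s : Fin 6) (ρ : ℝ) : ell s (bp s ρ) = 0 := by
  simp only [ell, orient, bp]; ring

lemma ell_bp_pos {s u : Fin 6} {ρ : ℝ} (h : u ≠ s) (h0 : 0 < ρ) (h1 : ρ < 1) :
    0 < ell s (bp u ρ) := by
  rw [ell_bp]
  have a0 : (0 : ℝ) ≤ intOrient s (s + 1) u := by exact_mod_cast (intOrient_side s u).1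
  have b0 : (0 : ℝ) ≤ intOrient s (s + 1) (u + 1) := by
    exact_mod_cast (intOrient_side s (u + 1)).1
  by_cases hu : u = s + 1
  · have h2 : u + 1 ≠ s ∧ u + 1 ≠ s + 1 :=
      hu ▸ (by decide : ∀ s : Fin 6, s + 1 + 1 ≠ s ∧ s + 1 + 1 ≠ s + 1) s
    have b1 : (0 : ℝ) < intOrient s (s + 1) (u + 1) := by
      exact_mod_cast (intOrient_side s (u + 1)).2 h2.1 h2.2
    have := mul_pos h0 b1
    have := mul_nonneg (sub_nonneg.2 h1.le) a0
    linarith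
  · have a1 : (0 : ℝ) < intOrient s (s + 1) u := by
      exact_mod_cast (intOrient_side s u).2 h hu
    have := mul_pos (sub_pos.2 h1) a1
    have := mul_nonneg h0.le b0
    linarith

lemma orient_pos_of_lt {s t u : Fin 6} {τ σ ρ : ℝ} (hs : s < t) (ht : t < u)
    (τ0 : 0 < τ) (τ1 : τ < 1) (σ0 : 0 < σ) (σ1 : σ < 1) (ρ0 : 0 < ρ) (ρ1 : ρ < 1) :
    0 < orient (bp s τ) (bp t σ) (bp u ρ) := by
  rw [orient_bp]
  obtain ⟨h1, h2, h3, h4, h5, h6, h7, h8⟩ := intOrient_nonneg s t u hs ht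
  have τ1' := sub_pos.2 τ1
  have σ1' := sub_pos.2 σ1
  have ρ1' := sub_pos.2 ρ1
  have h1 : (0 : ℝ) < intOrient s t u := by exact_mod_cast h1
  have h2 : (0 : ℝ) ≤ intOrient s t (u + 1) := by exact_mod_cast h2
  have h3 : (0 : ℝ) ≤ intOrient s (t + 1) u := by exact_mod_cast h3
  have h4 : (0 : ℝ) ≤ intOrient s (t + 1) (u + 1) := by exact_mod_cast h4
  have h5 : (0 : ℝ) ≤ intOrient (s + 1) t u := by exact_mod_cast h5
  have h6 : (0 : ℝ) ≤ intOrient (s + 1) t (u + 1) := by exact_mod_cast h6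
  have h7 : (0 : ℝ) ≤ intOrient (s + 1) (t + 1) u := by exact_mod_cast h7
  have h8 : (0 : ℝ) ≤ intOrient (s + 1) (t + 1) (u + 1) := by exact_mod_cast h8
  positivity

lemma orient_bp_self (s : Fin 6) (τ σ : ℝ) (x : ℝ × ℝ) :
    orient (bp s τ) (bp s σ) x = (σ - τ) * ell s x := by
  simp only [ell, orient, bp]; ring

/-- The position on the boundary of the point of the side `s` with parameter `τ`. -/
def pos (s : Fin 6) (τ : ℝ) : ℝ := (s : ℕ) + τ

lemma pos_lt_of_lt {s t : Fin 6} {τ σ : ℝ} (h : s < t) (τ1 : τ < 1) (σ0 : 0 < σ) :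
    pos s τ < pos t σ := by
  have : ((s : ℕ) : ℝ) + 1 ≤ (t : ℕ) := by exact_mod_cast h
  unfold pos; linarith

lemma pos_lt_iff {s t : Fin 6} {τ σ : ℝ} (τ0 : 0 < τ) (τ1 : τ < 1) (σ0 : 0 < σ) (σ1 : σ < 1) :
    pos s τ < pos t σ ↔ s < t ∨ (s = t ∧ τ < σ) := by
  constructor
  · intro h
    rcases lt_trichotomy s t with h' | h' | h'
    · exact Or.inl h'
    · subst h'; right; refine ⟨rfl, ?_⟩; unfold pos at h; linarith
    · exact absurd h (pos_lt_of_lt h' σ1 τ0).le.not_gt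
  · rintro (h | ⟨rfl, h⟩)
    · exact pos_lt_of_lt h τ1 σ0
    · unfold pos; linarith

lemma orient_pos {s t u : Fin 6} {τ σ ρ : ℝ} (h1 : pos s τ < pos t σ) (h2 : pos t σ < pos u ρ)
    (hne : s ≠ u)
    (τ0 : 0 < τ) (τ1 : τ < 1) (σ0 : 0 < σ) (σ1 : σ < 1) (ρ0 : 0 < ρ) (ρ1 : ρ < 1) :
    0 < orient (bp s τ) (bp t σ) (bp u ρ) := by
  rw [pos_lt_iff τ0 τ1 σ0 σ1] at h1
  rw [pos_lt_iff σ0 σ1 ρ0 ρ1] at h2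
  rcases h1 with h1 | ⟨rfl, h1⟩
  · rcases h2 with h2 | ⟨rfl, h2⟩
    · exact orient_pos_of_lt h1 h2 τ0 τ1 σ0 σ1 ρ0 ρ1
    · rw [orient_rotate, orient_bp_self]
      exact mul_pos (sub_pos.2 h2) (ell_bp_pos hne τ0 τ1)
  · rw [orient_bp_self]
    exact mul_pos (sub_pos.2 h1) (ell_bp_pos hne.symm ρ0 ρ1)

/-- Seen from a chord, the boundary points between its ends are on the right. -/
lemma orient_neg_of_between {s t u : Fin 6} {τ σ ρ : ℝ} (hst : s ≠ t)
    (h1 : pos s τ < pos u ρ) (h2 : pos u ρ < pos t σ)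
    (τ0 : 0 < τ) (τ1 : τ < 1) (σ0 : 0 < σ) (σ1 : σ < 1) (ρ0 : 0 < ρ) (ρ1 : ρ < 1) :
    orient (bp s τ) (bp t σ) (bp u ρ) < 0 := by
  have := orient_pos h1 h2 hst τ0 τ1 ρ0 ρ1 σ0 σ1
  rw [orient_rotate, orient_swap, orient_rotate, orient_rotate]
  linarith

/-- Seen from a chord, the boundary points not between its ends are on the left. -/
lemma orient_pos_of_outside {s t u : Fin 6} {τ σ ρ : ℝ} (hst : s < t)
    (h : pos u ρ < pos s τ ∨ pos t σ < pos u ρ)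
    (τ0 : 0 < τ) (τ1 : τ < 1) (σ0 : 0 < σ) (σ1 : σ < 1) (ρ0 : 0 < ρ) (ρ1 : ρ < 1) :
    0 < orient (bp s τ) (bp t σ) (bp u ρ) := by
  have hst' := pos_lt_of_lt hst τ1 σ0
  rcases h with h | h
  · rw [orient_rotate, orient_rotate]
    refine orient_pos h hst' ?_ ρ0 ρ1 τ0 τ1 σ0 σ1
    rw [pos_lt_iff ρ0 ρ1 τ0 τ1] at h
    rcases h with h | h
    · exact (h.trans hst).ne
    · exact (h.1 ▸ hst).ne
  · refine orient_pos hst' h ?_ τ0 τ1 σ0 σ1 ρ0 ρ1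
    rw [pos_lt_iff σ0 σ1 ρ0 ρ1] at h
    rcases h with h | h
    · exact (hst.trans h).ne
    · exact (h.1 ▸ hst).ne

lemma orient_lineMap (P Q A B : ℝ × ℝ) (a b : ℝ) (h : a + b = 1) :
    orient P Q (a • A + b • B) = a * orient P Q A + b * orient P Q B := by
  obtain rfl : a = 1 - b := by linarith
  simp only [orient, Prod.fst_add, Prod.snd_add, Prod.smul_fst, Prod.smul_snd, smul_eq_mul]
  ring

lemma orient_eq_zero_of_mem_segment {P Q x : ℝ × ℝ} (h : x ∈ segment ℝ P Q) :
    orient P Q x = 0 := by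
  obtain ⟨a, b, -, -, hab, rfl⟩ := h
  rw [orient_lineMap _ _ _ _ _ _ hab]; unfold orient; ring

lemma disjoint_segment_of_orient_pos {P Q A B : ℝ × ℝ} (hA : 0 < orient P Q A)
    (hB : 0 < orient P Q B) : Disjoint (segment ℝ P Q) (segment ℝ A B) := by
  rw [Set.disjoint_left]
  rintro x hx ⟨a, b, ha, hb, hab, rfl⟩
  have := orient_eq_zero_of_mem_segment hx
  rw [orient_lineMap _ _ _ _ _ _ hab] at this
  rcases ha.eq_or_lt with rfl | ha
  · obtain rfl : b = 1 := by linarith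
    linarith
  · have := mul_pos ha hA
    have := mul_nonneg hb hB.le
    linarith

lemma disjoint_segment_of_orient_neg {P Q A B : ℝ × ℝ} (hA : orient P Q A < 0)
    (hB : orient P Q B < 0) : Disjoint (segment ℝ P Q) (segment ℝ A B) := by
  rw [segment_symm ℝ P Q]
  refine disjoint_segment_of_orient_pos ?_ ?_ <;> rw [orient_swap] <;> linarith

/-- Two chords whose ends do not alternate are disjoint. -/
lemma disjoint_chords {s t u v : Fin 6} {τ σ ρ κ : ℝ} (hst : s < t)
    (τ0 : 0 < τ) (τ1 : τ < 1) (σ0 : 0 < σ) (σ1 : σ < 1) (ρ0 : 0 < ρ) (ρ1 : ρ < 1)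
    (κ0 : 0 < κ) (κ1 : κ < 1)
    (h : (pos s τ < pos u ρ ∧ pos u ρ < pos t σ ∧ pos s τ < pos v κ ∧ pos v κ < pos t σ) ∨
      ((pos u ρ < pos s τ ∨ pos t σ < pos u ρ) ∧ (pos v κ < pos s τ ∨ pos t σ < pos v κ))) :
    Disjoint (segment ℝ (bp s τ) (bp t σ)) (segment ℝ (bp u ρ) (bp v κ)) := by
  rcases h with ⟨h1, h2, h3, h4⟩ | ⟨h1, h2⟩
  · exact disjoint_segment_of_orient_neg
      (orient_neg_of_between hst.ne h1 h2 τ0 τ1 σ0 σ1 ρ0 ρ1)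
      (orient_neg_of_between hst.ne h3 h4 τ0 τ1 σ0 σ1 κ0 κ1)
  · exact disjoint_segment_of_orient_pos
      (orient_pos_of_outside hst h1 τ0 τ1 σ0 σ1 ρ0 ρ1)
      (orient_pos_of_outside hst h2 τ0 τ1 σ0 σ1 κ0 κ1)

lemma ell_nonneg_of_mem_body (s : Fin 6) {x : ℝ × ℝ} (hx : x ∈ body) : 0 ≤ ell s x := by
  have hc : Convex ℝ {x : ℝ × ℝ | 0 ≤ ell s x} := by
    intro A hA B hB a b ha hb hab
    have hA : 0 ≤ ell s A := hA
    have hB : 0 ≤ ell s B := hB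
    change 0 ≤ ell s _
    unfold ell at *
    rw [orient_lineMap _ _ _ _ _ _ hab]
    positivity
  refine convexHull_min ?_ hc hx
  rintro _ ⟨k, rfl⟩
  change 0 ≤ ell s _
  unfold ell
  rw [orient_vertex]
  exact_mod_cast (intOrient_side s k).1

lemma vertex_mem_body (k : Fin 6) : vertex k ∈ body := subset_convexHull ℝ _ ⟨k, rfl⟩

lemma zero_mem_body : (0 : ℝ × ℝ) ∈ body := by
  have := (convex_convexHull ℝ (Set.range vertex)) (vertex_mem_body 0) (vertex_mem_body 3)
    (a := 1 / 2) (b := 1 / 2) (by norm_num) (by norm_num) (by norm_num)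
  have h0 : (0 : ℝ × ℝ) = (1 / 2 : ℝ) • vertex 0 + (1 / 2 : ℝ) • vertex 3 := by
    ext <;> simp [vertex]
  rw [h0]
  exact this

lemma mem_body_of_combination {A B x : ℝ × ℝ} (hA : A ∈ body) (hB : B ∈ body) {a b : ℝ}
    (ha : 0 ≤ a) (hb : 0 ≤ b) (hab : a + b ≤ 1) (hx : x = a • A + b • B) : x ∈ body := by
  have hc : Convex ℝ body := convex_convexHull ℝ _
  rcases eq_or_ne (a + b) 0 with h | h
  · obtain rfl : a = 0 := by linarith
    obtain rfl : b = 0 := by linarith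
    simpa [hx] using zero_mem_body
  · have hp : 0 < a + b := by positivity
    have h1 : (a / (a + b)) • A + (b / (a + b)) • B ∈ body :=
      hc hA hB (by positivity) (by positivity) (by field_simp)
    have h2 := hc.smul_mem_of_zero_mem zero_mem_body h1 ⟨hp.le, hab⟩
    rw [hx]
    convert h2 using 1
    rw [smul_add, smul_smul, smul_smul]
    congr 2 <;> field_simp

lemma mem_interior_body {x : ℝ × ℝ} (h : ∀ s, 0 < ell s x) : x ∈ interior body := by
  have ho : IsOpen {x : ℝ × ℝ | ∀ s, 0 < ell s x} := by
    simp only [Set.ofPred_forall]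
    refine isOpen_iInter_of_finite fun s => isOpen_lt continuous_const ?_
    unfold ell orient
    fun_prop
  refine interior_maximal ?_ ho h
  intro x hx
  have h0 := hx 0
  have h1 := hx 1
  have h2 := hx 2
  have h3 := hx 3
  have h4 := hx 4
  have h5 := hx 5
  simp [ell, orient, vertex] at h0 h1 h2 h3 h4 h5
  have v0 : ((1, 0) : ℝ × ℝ) ∈ body := vertex_mem_body 0
  have v1 : ((1, 1) : ℝ × ℝ) ∈ body := vertex_mem_body 1
  have v2 : ((0, 1) : ℝ × ℝ) ∈ body := vertex_mem_body 2
  have v3 : ((-1, 0) : ℝ × ℝ) ∈ body := vertex_mem_body 3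
  have v4 : ((-1, -1) : ℝ × ℝ) ∈ body := vertex_mem_body 4
  have v5 : ((0, -1) : ℝ × ℝ) ∈ body := vertex_mem_body 5
  -- The hexagon is cut into six triangles from its centre. The signs and the order of the
  -- coordinates select the triangle, and the inequality of its outer side bounds the sum of the
  -- coefficients by one.
  rcases le_total 0 x.1 with hx1 | hx1 <;> rcases le_total 0 x.2 with hx2 | hx2
  · rcases le_total x.1 x.2 with h | h
    · exact mem_body_of_combination v1 v2 (a := x.1) (b := x.2 - x.1) (by linarith)
        (by linarith) (by linarith) (by ext <;> simp)
    · exact mem_body_of_combination v1 v0 (a := x.2) (b := x.1 - x.2) (by linarith)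
        (by linarith) (by linarith) (by ext <;> simp)
  · exact mem_body_of_combination v0 v5 (a := x.1) (b := -x.2) (by linarith)
        (by linarith) (by linarith) (by ext <;> simp)
  · exact mem_body_of_combination v3 v2 (a := -x.1) (b := x.2) (by linarith)
        (by linarith) (by linarith) (by ext <;> simp)
  · rcases le_total x.1 x.2 with h | h
    · exact mem_body_of_combination v4 v3 (a := -x.2) (b := x.2 - x.1) (by linarith)
        (by linarith) (by linarith) (by ext <;> simp)
    · exact mem_body_of_combination v4 v5 (a := -x.1) (b := x.1 - x.2) (by linarith)
        (by linarith) (by linarith) (by ext <;> simp)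

lemma bp_ne {s t : Fin 6} {τ σ : ℝ} (hst : s ≠ t) (σ0 : 0 < σ) (σ1 : σ < 1) :
    bp s τ ≠ bp t σ := by
  intro h
  have := ell_bp_pos hst.symm σ0 σ1
  rw [← h, ell_bp_self] at this
  exact lt_irrefl _ this

/-- The line through the ends of a chord meets the hexagon in the chord. -/
lemma mem_segment_of_orient_eq_zero {s t : Fin 6} {τ σ : ℝ} (hst : s ≠ t)
    (τ0 : 0 < τ) (τ1 : τ < 1) (σ0 : 0 < σ) (σ1 : σ < 1) {x : ℝ × ℝ} (hx : x ∈ body)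
    (h : orient (bp s τ) (bp t σ) x = 0) : x ∈ segment ℝ (bp s τ) (bp t σ) := by
  set P := bp s τ with hP
  set Q := bp t σ with hQ
  have hPQ : P ≠ Q := bp_ne hst σ0 σ1
  obtain ⟨c, hc⟩ : ∃ c : ℝ, x = (1 - c) • P + c • Q := by
    unfold orient at h
    by_cases h1 : Q.1 = P.1
    · have h2 : Q.2 - P.2 ≠ 0 := fun h2 => hPQ (Prod.ext h1.symm (by linarith))
      have h3 : x.1 = P.1 := by
        have : (Q.2 - P.2) * (x.1 - P.1) = 0 := by rw [h1] at h; linarith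
        rcases mul_eq_zero.1 this with h | h
        · exact absurd h h2
        · linarith
      refine ⟨(x.2 - P.2) / (Q.2 - P.2), Prod.ext ?_ ?_⟩
      · simp [h1, h3]; ring
      · simp; field_simp; ring
    · have h2 : Q.1 - P.1 ≠ 0 := sub_ne_zero.2 h1
      refine ⟨(x.1 - P.1) / (Q.1 - P.1), Prod.ext ?_ ?_⟩
      · simp; field_simp; ring
      · simp; field_simp; linarith
  -- The two linear functions vanish at one end of the chord each, so their signs at `x` confine the
  -- parameter `c` to the unit interval.
  have e1 : ell s x = c * ell s Q := by
    rw [hc]; unfold ell; rw [orient_lineMap _ _ _ _ _ _ (by ring)]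
    have : orient (vertex s) (vertex (s + 1)) P = 0 := ell_bp_self s τ
    rw [this]; ring
  have e2 : ell t x = (1 - c) * ell t P := by
    rw [hc]; unfold ell; rw [orient_lineMap _ _ _ _ _ _ (by ring)]
    have : orient (vertex t) (vertex (t + 1)) Q = 0 := ell_bp_self t σ
    rw [this]; ring
  have p1 : 0 < ell s Q := ell_bp_pos hst.symm σ0 σ1
  have p2 : 0 < ell t P := ell_bp_pos hst τ0 τ1
  have n1 := ell_nonneg_of_mem_body s hx
  have n2 := ell_nonneg_of_mem_body t hx
  rw [e1] at n1
  rw [e2] at n2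
  exact ⟨1 - c, c, nonneg_of_mul_nonneg_left n2 p2, nonneg_of_mul_nonneg_left n1 p1,
    by ring, hc.symm⟩

/-- The straight arc. -/
def chordPath (P Q : ℝ × ℝ) (r : ℝ) : ℝ × ℝ := (1 - r) • P + r • Q

lemma isArc_chordPath (e : ArcClass) {τ σ : ℝ}
    (τ0 : 0 < τ) (τ1 : τ < 1) (σ0 : 0 < σ) (σ1 : σ < 1) :
    IsArc e (chordPath (bp e.s τ) (bp e.t σ)) := by
  refine ⟨?_, ?_, ?_, ?_, ?_⟩
  · unfold chordPath; fun_prop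
  · intro a _ b _ hab
    have h : (b - a) • (bp e.t σ - bp e.s τ) = 0 := by
      have : chordPath (bp e.s τ) (bp e.t σ) b - chordPath (bp e.s τ) (bp e.t σ) a = 0 :=
        sub_eq_zero.2 hab.symm
      rw [← this]; unfold chordPath; module
    rcases smul_eq_zero.1 h with h | h
    · linarith
    · exact absurd (sub_eq_zero.1 h).symm (bp_ne e.ne σ0 σ1)
  · exact mem_edge_iff.2 ⟨τ, τ0, τ1, by simp [chordPath]⟩
  · exact mem_edge_iff.2 ⟨σ, σ0, σ1, by simp [chordPath]⟩
  · intro r hr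
    refine mem_interior_body fun k => ?_
    unfold chordPath ell
    rw [orient_lineMap _ _ _ _ _ _ (by ring)]
    change 0 < (1 - r) * ell k _ + r * ell k _
    have r1 := sub_pos.2 hr.2
    have r0 := hr.1
    by_cases hk : e.s = k
    · subst hk
      rw [ell_bp_self]
      have := ell_bp_pos e.ne.symm σ0 σ1
      positivity
    · have h1 := ell_bp_pos hk τ0 τ1
      have h2 : 0 ≤ ell k (bp e.t σ) := by
        by_cases hk' : e.t = k
        · rw [hk', ell_bp_self]
        · exact (ell_bp_pos hk' σ0 σ1).le
      positivity

end Hexagon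

namespace Hexagon

/-! ### The intersection numbers of a foliation -/

/-- The pairs of sides `{x, y}` and `{s, t}` alternate. -/
def Alternate (x y s t : Fin 6) : Prop :=
  x ≠ s ∧ x ≠ t ∧ y ≠ s ∧ y ≠ t ∧
    ¬ ((min x y < s ∧ s < max x y) ↔ (min x y < t ∧ t < max x y))

instance (x y s t : Fin 6) : Decidable (Alternate x y s t) := by
  unfold Alternate; infer_instance

instance (e f : ArcClass) : Decidable (e.Crosses f) :=
  inferInstanceAs (Decidable (Alternate e.s e.t f.s f.t))

instance (e f : ArcClass) : Decidable (e.Same f) := by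
  unfold ArcClass.Same; infer_instance

lemma alternate_swap_right {x y s t : Fin 6} : Alternate x y s t ↔ Alternate x y t s := by
  revert x y s t; decide

lemma alternate_swap_left {x y s t : Fin 6} : Alternate x y s t ↔ Alternate y x s t := by
  revert x y s t; decide

/-- The parameter of a point of the side `s`. -/
noncomputable def par (s : Fin 6) (x : ℝ × ℝ) : ℝ :=
  ((x.1 - (vertex s).1) * ((vertex (s + 1)).1 - (vertex s).1) +
    (x.2 - (vertex s).2) * ((vertex (s + 1)).2 - (vertex s).2)) /
  (((vertex (s + 1)).1 - (vertex s).1) ^ 2 + ((vertex (s + 1)).2 - (vertex s).2) ^ 2)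

lemma par_bp (s : Fin 6) (τ : ℝ) : par s (bp s τ) = τ := by
  fin_cases s <;> simp [par, bp, vertex] <;> norm_num

lemma continuous_par (s : Fin 6) : Continuous (par s) := by
  unfold par; fun_prop

lemma par_mem {s : Fin 6} {x : ℝ × ℝ} (hx : x ∈ edge s) :
    0 < par s x ∧ par s x < 1 ∧ bp s (par s x) = x := by
  obtain ⟨τ, h0, h1, rfl⟩ := mem_edge_iff.1 hx
  rw [par_bp]; exact ⟨h0, h1, rfl⟩

lemma bp_mem_edge {s : Fin 6} {τ : ℝ} (h0 : 0 < τ) (h1 : τ < 1) : bp s τ ∈ edge s :=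
  mem_edge_iff.2 ⟨τ, h0, h1, rfl⟩

lemma edge_subset_body (s : Fin 6) : edge s ⊆ body :=
  (openSegment_subset_segment ℝ _ _).trans
    ((convex_convexHull ℝ _).segment_subset (vertex_mem_body s) (vertex_mem_body (s + 1)))

/-- The ends of an arc on the sides `u`, `v` alternating with `s`, `t` lie on different sides
of a chord from `s` to `t`. -/
lemma orient_mul_neg {s t u v : Fin 6} {τ σ ρ κ : ℝ} (hst : s ≠ t) (h : Alternate s t u v)
    (τ0 : 0 < τ) (τ1 : τ < 1) (σ0 : 0 < σ) (σ1 : σ < 1) (ρ0 : 0 < ρ) (ρ1 : ρ < 1)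
    (κ0 : 0 < κ) (κ1 : κ < 1) :
    orient (bp s τ) (bp t σ) (bp u ρ) * orient (bp s τ) (bp t σ) (bp v κ) < 0 := by
  wlog hlt : s < t generalizing s t τ σ
  · have := this hst.symm (alternate_swap_left.1 h) σ0 σ1 τ0 τ1
      (lt_of_le_of_ne (not_lt.1 hlt) hst.symm)
    rw [orient_swap (bp t σ), orient_swap (bp t σ)] at this
    linarith
  wlog hu : s < u ∧ u < t generalizing u v ρ κ
  · have hv : s < v ∧ v < t := by
      by_contra hv
      have h' := h.2.2.2.2
      rw [min_eq_left hlt.le, max_eq_right hlt.le] at h'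
      exact h' (by tauto)
    rw [mul_comm]
    exact this κ0 κ1 ρ0 ρ1 (alternate_swap_right.1 h) hv
  have hv : v < s ∨ t < v := by
    have h' := h.2.2.2.2
    rw [min_eq_left hlt.le, max_eq_right hlt.le] at h'
    by_contra hv
    push Not at hv
    exact h' ⟨fun _ => ⟨lt_of_le_of_ne hv.1 h.2.1, lt_of_le_of_ne hv.2 h.2.2.2.1.symm⟩,
      fun _ => hu⟩
  refine mul_neg_of_neg_of_pos ?_ ?_
  · exact orient_neg_of_between hst (pos_lt_of_lt hu.1 τ1 ρ0) (pos_lt_of_lt hu.2 ρ1 σ0)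
      τ0 τ1 σ0 σ1 ρ0 ρ1
  · exact orient_pos_of_outside hlt (hv.imp (fun h => pos_lt_of_lt h κ1 τ0)
      fun h => pos_lt_of_lt h σ1 κ0) τ0 τ1 σ0 σ1 κ0 κ1

lemma continuous_orient (P Q : ℝ × ℝ) : Continuous (orient P Q) := by
  unfold orient; fun_prop

/-- A path in the hexagon whose ends lie on different sides of a chord meets the chord. -/
lemma exists_mem_chord {s t : Fin 6} {τ σ : ℝ} (hst : s ≠ t)
    (τ0 : 0 < τ) (τ1 : τ < 1) (σ0 : 0 < σ) (σ1 : σ < 1) {γ : ℝ → ℝ × ℝ}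
    (hγ : ContinuousOn γ (Set.Icc 0 1)) (hb : ∀ r ∈ Set.Icc (0 : ℝ) 1, γ r ∈ body)
    (h : orient (bp s τ) (bp t σ) (γ 0) * orient (bp s τ) (bp t σ) (γ 1) < 0) :
    ∃ r ∈ Set.Icc (0 : ℝ) 1, γ r ∈ segment ℝ (bp s τ) (bp t σ) := by
  set g := fun r => orient (bp s τ) (bp t σ) (γ r)
  have hg : ContinuousOn g (Set.Icc 0 1) := (continuous_orient _ _).comp_continuousOn hγ
  have h0 : (0 : ℝ) ∈ g '' Set.Icc 0 1 := by
    rcases mul_neg_iff.1 h with ⟨h1, h2⟩ | ⟨h1, h2⟩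
    · exact intermediate_value_Icc' zero_le_one hg ⟨h2.le, h1.le⟩
    · exact intermediate_value_Icc zero_le_one hg ⟨h1.le, h2.le⟩
  obtain ⟨r, hr, hr0⟩ := h0
  exact ⟨r, hr, mem_segment_of_orient_eq_zero hst τ0 τ1 σ0 σ1 (hb r hr) hr0⟩

lemma IsArc.mem_body {e : ArcClass} {γ : ℝ → ℝ × ℝ} (h : IsArc e γ) :
    ∀ r ∈ Set.Icc (0 : ℝ) 1, γ r ∈ body := by
  intro r hr
  rcases hr.1.eq_or_lt with rfl | h0
  · exact edge_subset_body _ h.2.2.1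
  rcases hr.2.eq_or_lt with rfl | h1
  · exact edge_subset_body _ h.2.2.2.1
  exact interior_subset (h.2.2.2.2 r ⟨h0, h1⟩)

/-- The intermediate value argument of `exists_mem_chord`, applied to a straight path. -/
lemma not_disjoint_chords {s t u v : Fin 6} {τ σ ρ κ : ℝ} (hst : s ≠ t)
    (τ0 : 0 < τ) (τ1 : τ < 1) (σ0 : 0 < σ) (σ1 : σ < 1) (ρ0 : 0 < ρ) (ρ1 : ρ < 1)
    (κ0 : 0 < κ) (κ1 : κ < 1)
    (h : orient (bp s τ) (bp t σ) (bp u ρ) * orient (bp s τ) (bp t σ) (bp v κ) < 0) :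
    ¬ Disjoint (segment ℝ (bp s τ) (bp t σ)) (segment ℝ (bp u ρ) (bp v κ)) := by
  obtain ⟨r, hr, hm⟩ := exists_mem_chord (γ := chordPath (bp u ρ) (bp v κ)) hst τ0 τ1 σ0 σ1
    (by unfold chordPath; fun_prop)
    (fun r hr => (convex_convexHull ℝ _) (edge_subset_body u (bp_mem_edge ρ0 ρ1))
      (edge_subset_body v (bp_mem_edge κ0 κ1)) (sub_nonneg.2 hr.2) hr.1 (by ring))
    (by simpa [chordPath] using h)
  exact fun hd => Set.disjoint_left.1 hd hm
    ⟨1 - r, r, sub_nonneg.2 hr.2, hr.1, by ring, rfl⟩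

/-- The side of one of the two ends of a band. -/
def Band.endSide (b : Band) : Bool → Fin 6
  | true => b.s
  | false => b.t

/-- The parameter of one of the two ends of a leaf. -/
noncomputable def Band.endPar (b : Band) : Bool → ℝ → ℝ
  | true => fun u => par b.s (b.p u)
  | false => fun u => par b.t (b.q u)

lemma Band.endPar_mem (b : Band) (i : Bool) {u : ℝ} (hu : u ∈ Set.Icc 0 b.width) :
    0 < b.endPar i u ∧ b.endPar i u < 1 := by
  cases i
  · exact ⟨(par_mem (b.q_mem u hu)).1, (par_mem (b.q_mem u hu)).2.1⟩
  · exact ⟨(par_mem (b.p_mem u hu)).1, (par_mem (b.p_mem u hu)).2.1⟩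

lemma Band.continuousOn_endPar (b : Band) (i : Bool) :
    ContinuousOn (b.endPar i) (Set.Icc 0 b.width) := by
  cases i
  · exact (continuous_par _).comp_continuousOn b.continuousOn_q
  · exact (continuous_par _).comp_continuousOn b.continuousOn_p

lemma Band.leaf_eq (b : Band) (i : Bool) {u : ℝ} (hu : u ∈ Set.Icc 0 b.width) :
    b.leaf u = segment ℝ (bp (b.endSide i) (b.endPar i u)) (bp (b.endSide !i) (b.endPar (!i) u)) := by
  have hp := (par_mem (b.p_mem u hu)).2.2
  have hq := (par_mem (b.q_mem u hu)).2.2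
  cases i
  · rw [segment_symm]
    simp only [Band.endSide, Band.endPar, Bool.not_false, hp, hq, Band.leaf]
  · simp only [Band.endSide, Band.endPar, Bool.not_true, hp, hq, Band.leaf]

lemma Band.endSide_ne (b : Band) (i : Bool) : b.endSide i ≠ b.endSide !i := by
  cases i
  · exact b.ne.symm
  · exact b.ne

lemma MeasuredFoliation.disjoint_leaves (F : MeasuredFoliation) {k l : Fin F.n} (h : k ≠ l)
    {u u' : ℝ} (hu : u ∈ Set.Icc 0 (F.band k).width) (hu' : u' ∈ Set.Icc 0 (F.band l).width) :
    Disjoint ((F.band k).leaf u) ((F.band l).leaf u') :=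
  (F.disjoint_bands k l h).mono (Set.subset_biUnion_of_mem (u := fun u => (F.band k).leaf u) hu)
    (Set.subset_biUnion_of_mem (u := fun u => (F.band l).leaf u) hu')

/-- The bands of a foliation have pairwise disjoint classes. -/
lemma MeasuredFoliation.not_crosses (F : MeasuredFoliation) (k l : Fin F.n) :
    ¬ (F.band k).toArcClass.Crosses (F.band l).toArcClass := by
  intro h
  have hkl : k ≠ l := by
    rintro rfl
    exact h.1 rfl
  have hk : (0 : ℝ) ∈ Set.Icc 0 (F.band k).width := ⟨le_rfl, (F.band k).width_pos.le⟩
  have hl : (0 : ℝ) ∈ Set.Icc 0 (F.band l).width := ⟨le_rfl, (F.band l).width_pos.le⟩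
  have hd := F.disjoint_leaves hkl hk hl
  rw [Band.leaf_eq _ true hk, Band.leaf_eq _ true hl] at hd
  have a1 := (F.band k).endPar_mem true hk
  have a2 := (F.band k).endPar_mem false hk
  have a3 := (F.band l).endPar_mem true hl
  have a4 := (F.band l).endPar_mem false hl
  exact not_disjoint_chords (F.band k).ne a1.1 a1.2 a2.1 a2.2 a3.1 a3.2 a4.1 a4.2
    (orient_mul_neg (F.band k).ne h a1.1 a1.2 a2.1 a2.2 a3.1 a3.2 a4.1 a4.2) hd

/-- Compactness leaves room between the maximum of `K` and the minimum of `L`; an empty set is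
replaced by the end 0 or 1 of the interval. -/
lemma exists_gap {K L : Set ℝ} (hK : IsCompact K) (hL : IsCompact L)
    (K0 : ∀ x ∈ K, 0 < x ∧ x < 1) (L0 : ∀ x ∈ L, 0 < x ∧ x < 1)
    (h : ∀ x ∈ K, ∀ y ∈ L, x < y) :
    ∃ c, 0 < c ∧ c < 1 ∧ (∀ x ∈ K, x < c) ∧ ∀ y ∈ L, c < y := by
  obtain ⟨a, a0, a1, hKa, haL⟩ : ∃ a, 0 ≤ a ∧ a < 1 ∧ (∀ x ∈ K, x ≤ a) ∧ ∀ y ∈ L, a < y := by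
    rcases K.eq_empty_or_nonempty with rfl | hne
    · exact ⟨0, le_rfl, one_pos, by simp, fun y hy => (L0 y hy).1⟩
    · obtain ⟨a, ha, hmax⟩ := hK.exists_isGreatest hne
      exact ⟨a, (K0 a ha).1.le, (K0 a ha).2, fun x hx => hmax hx, fun y hy => h a ha y hy⟩
  obtain ⟨b, ab, b1, hLb⟩ : ∃ b, a < b ∧ b ≤ 1 ∧ ∀ y ∈ L, b ≤ y := by
    rcases L.eq_empty_or_nonempty with rfl | hne
    · exact ⟨1, a1, le_rfl, by simp⟩
    · obtain ⟨b, hb, hmin⟩ := hL.exists_isLeast hne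
      exact ⟨b, haL b hb, (L0 b hb).2.le, fun y hy => hmin hy⟩
  exact ⟨(a + b) / 2, by linarith, by linarith, fun x hx => by linarith [hKa x hx],
    fun y hy => by linarith [hLb y hy]⟩

/-- The parameters on the side `s` of the ends of the leaves whose other end is on a side
satisfying `p`. -/
def MeasuredFoliation.endSet (F : MeasuredFoliation) (s : Fin 6) (p : Fin 6 → Prop) : Set ℝ :=
  ⋃ k, ⋃ i, ⋃ (_ : (F.band k).endSide i = s ∧ p ((F.band k).endSide !i)),
    (F.band k).endPar i '' Set.Icc 0 (F.band k).width

lemma MeasuredFoliation.mem_endSet {F : MeasuredFoliation} {s : Fin 6} {p : Fin 6 → Prop} {x : ℝ} :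
    x ∈ F.endSet s p ↔ ∃ k i, ∃ u ∈ Set.Icc 0 (F.band k).width,
      (F.band k).endSide i = s ∧ p ((F.band k).endSide !i) ∧ (F.band k).endPar i u = x := by
  simp only [endSet, Set.mem_iUnion, Set.mem_image, exists_prop]
  constructor
  · rintro ⟨k, i, ⟨h1, h2⟩, u, hu, hx⟩; exact ⟨k, i, u, hu, h1, h2, hx⟩
  · rintro ⟨k, i, u, hu, h1, h2, hx⟩; exact ⟨k, i, ⟨h1, h2⟩, u, hu, hx⟩

lemma MeasuredFoliation.isCompact_endSet (F : MeasuredFoliation) (s : Fin 6) (p : Fin 6 → Prop) :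
    IsCompact (F.endSet s p) := by
  refine isCompact_iUnion fun k => isCompact_iUnion fun i => ?_
  by_cases h : (F.band k).endSide i = s ∧ p ((F.band k).endSide !i)
  · simp only [h]
    simpa using isCompact_Icc.image_of_continuousOn ((F.band k).continuousOn_endPar i)
  · simp [h]

lemma MeasuredFoliation.endSet_mem {F : MeasuredFoliation} {s : Fin 6} {p : Fin 6 → Prop} :
    ∀ x ∈ F.endSet s p, 0 < x ∧ x < 1 := by
  intro x hx
  obtain ⟨k, i, u, hu, -, -, rfl⟩ := mem_endSet.1 hx
  exact (F.band k).endPar_mem i hu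

/-- Two leaves with an end on the side `s`, whose other ends are on different sides: there is no
alternation. -/
lemma MeasuredFoliation.endPar_order (F : MeasuredFoliation) {s v w : Fin 6} (hvw : v ≠ w)
    {k l : Fin F.n} {i j : Bool} {u u' : ℝ}
    (hu : u ∈ Set.Icc 0 (F.band k).width) (hu' : u' ∈ Set.Icc 0 (F.band l).width)
    (hk : (F.band k).endSide i = s) (hk' : ((F.band k).endSide !i) = v)
    (hl : (F.band l).endSide j = s) (hl' : ((F.band l).endSide !j) = w) :
    (F.band k).endPar i u ≠ (F.band l).endPar j u' ∧
    0 ≤ orient (bp s ((F.band k).endPar i u)) (bp v ((F.band k).endPar (!i) u))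
        (bp s ((F.band l).endPar j u')) *
      orient (bp s ((F.band k).endPar i u)) (bp v ((F.band k).endPar (!i) u))
        (bp w ((F.band l).endPar (!j) u')) := by
  -- Within one band, two ends on the same side are the same end, and then the other ends share a
  -- side too.
  have hkl : k ≠ l := by
    rintro rfl
    cases i <;> cases j <;> simp only [Bool.not_true, Bool.not_false] at hk hk' hl hl'
    · exact hvw (hk'.symm.trans hl')
    · exact (F.band k).ne (hl.trans hk.symm)
    · exact (F.band k).ne (hk.trans hl.symm)
    · exact hvw (hk'.symm.trans hl')
  have hd := F.disjoint_leaves hkl hu hu'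
  rw [Band.leaf_eq _ i hu, Band.leaf_eq _ j hu', hk, hk', hl, hl'] at hd
  have hsv : s ≠ v := by rw [← hk, ← hk']; exact (F.band k).endSide_ne i
  have a1 := (F.band k).endPar_mem i hu
  have a2 := (F.band k).endPar_mem (!i) hu
  have a3 := (F.band l).endPar_mem j hu'
  have a4 := (F.band l).endPar_mem (!j) hu'
  constructor
  · intro h
    rw [h] at hd
    exact Set.disjoint_left.1 hd (left_mem_segment ℝ _ _) (left_mem_segment ℝ _ _)
  · by_contra h
    exact not_disjoint_chords hsv a1.1 a1.2 a2.1 a2.2 a3.1 a3.2 a4.1 a4.2 (not_le.1 h) hd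

/-- An arc from `s` to `t` in the gap of the leaves. -/
lemma MeasuredFoliation.exists_gap_arc (F : MeasuredFoliation) {s t : Fin 6} (hst : s < t) :
    ∃ τ σ, 0 < τ ∧ τ < 1 ∧ 0 < σ ∧ σ < 1 ∧
      ∀ k, ∀ u ∈ Set.Icc 0 (F.band k).width,
        ((segment ℝ (bp s τ) (bp t σ)) ∩ (F.band k).leaf u).Subsingleton ∧
        (¬ Alternate (F.band k).s (F.band k).t s t →
          Disjoint (segment ℝ (bp s τ) (bp t σ)) ((F.band k).leaf u)) := by
  -- The chord should separate the sides strictly between `s` and `t` from the rest. On `s` the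
  -- leaves going to the outside come first, on `t` those going to the inside; the ends of the chord
  -- are put in between.
  set p : Fin 6 → Prop := fun v => s < v ∧ v < t with hp
  obtain ⟨τ, τ0, τ1, hτ, hτ'⟩ : ∃ τ, 0 < τ ∧ τ < 1 ∧ (∀ x ∈ F.endSet s (fun v => ¬ p v), x < τ) ∧
      ∀ y ∈ F.endSet s p, τ < y := by
    refine exists_gap (F.isCompact_endSet _ _) (F.isCompact_endSet _ _) endSet_mem endSet_mem ?_
    intro x hx y hy
    obtain ⟨l, j, u', hu', hl, hl', rfl⟩ := mem_endSet.1 hx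
    obtain ⟨k, i, u, hu, hk, hk', rfl⟩ := mem_endSet.1 hy
    obtain ⟨hne, ho⟩ := F.endPar_order (fun h => hl' (by rw [← h]; exact hk')) hu hu' hk rfl hl rfl
    -- In the wrong order the ends of the two leaves would alternate, against their disjointness.
    by_contra hlt
    have hlt := lt_of_le_of_ne (not_lt.1 hlt) hne
    have a1 := (F.band k).endPar_mem i hu
    have a2 := (F.band k).endPar_mem (!i) hu
    have a3 := (F.band l).endPar_mem j hu'
    have a4 := (F.band l).endPar_mem (!j) hu'
    have o1 := orient_neg_of_between (s := s) (t := (F.band k).endSide !i) (u := s) hk'.1.ne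
      ((pos_lt_iff a1.1 a1.2 a3.1 a3.2).2 (Or.inr ⟨rfl, hlt⟩)) (pos_lt_of_lt hk'.1 a3.2 a2.1)
      a1.1 a1.2 a2.1 a2.2 a3.1 a3.2
    have hne' : (F.band l).endSide (!j) ≠ s := hl ▸ ((F.band l).endSide_ne j).symm
    have hw : (F.band l).endSide (!j) < s ∨ (F.band k).endSide (!i) < (F.band l).endSide (!j) := by
      rcases lt_or_ge ((F.band l).endSide (!j)) s with h | h
      · exact Or.inl h
      · right
        have h' := lt_of_le_of_ne h hne'.symm
        by_contra hc
        exact hl' ⟨h', (not_lt.1 hc).trans_lt hk'.2⟩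
    have o2 := orient_pos_of_outside (u := (F.band l).endSide !j) hk'.1
      (hw.imp (fun h => pos_lt_of_lt h a4.2 a1.1) (fun h => pos_lt_of_lt h a2.2 a4.1))
      a1.1 a1.2 a2.1 a2.2 a4.1 a4.2
    exact absurd ho (not_le.2 (mul_neg_of_neg_of_pos o1 o2))
  obtain ⟨σ, σ0, σ1, hσ, hσ'⟩ : ∃ σ, 0 < σ ∧ σ < 1 ∧ (∀ x ∈ F.endSet t p, x < σ) ∧
      ∀ y ∈ F.endSet t (fun v => ¬ p v), σ < y := by
    refine exists_gap (F.isCompact_endSet _ _) (F.isCompact_endSet _ _) endSet_mem endSet_mem ?_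
    intro x hx y hy
    obtain ⟨k, i, u, hu, hk, hk', rfl⟩ := mem_endSet.1 hx
    obtain ⟨l, j, u', hu', hl, hl', rfl⟩ := mem_endSet.1 hy
    obtain ⟨hne, ho⟩ := F.endPar_order (fun h => hl' (by rw [← h]; exact hk')) hu hu' hk rfl hl rfl
    by_contra hlt
    have hlt := lt_of_le_of_ne (not_lt.1 hlt) hne.symm
    have a1 := (F.band k).endPar_mem i hu
    have a2 := (F.band k).endPar_mem (!i) hu
    have a3 := (F.band l).endPar_mem j hu'
    have a4 := (F.band l).endPar_mem (!j) hu'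
    have o1 := orient_neg_of_between (s := (F.band k).endSide !i) (t := t) (u := t) hk'.2.ne
      (pos_lt_of_lt hk'.2 a2.2 a3.1) ((pos_lt_iff a3.1 a3.2 a1.1 a1.2).2 (Or.inr ⟨rfl, hlt⟩))
      a2.1 a2.2 a1.1 a1.2 a3.1 a3.2
    have hne' : (F.band l).endSide (!j) ≠ t := hl ▸ ((F.band l).endSide_ne j).symm
    have hw : (F.band l).endSide (!j) < (F.band k).endSide (!i) ∨ t < (F.band l).endSide (!j) := by
      rcases lt_or_ge t ((F.band l).endSide (!j)) with h | h
      · exact Or.inr h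
      · left
        have h' := lt_of_le_of_ne h hne'
        by_contra hc
        exact hl' ⟨hk'.1.trans_le (not_lt.1 hc), h'⟩
    have o2 := orient_pos_of_outside (u := (F.band l).endSide !j) hk'.2
      (hw.imp (fun h => pos_lt_of_lt h a4.2 a2.1) (fun h => pos_lt_of_lt h a1.2 a4.1))
      a2.1 a2.2 a1.1 a1.2 a4.1 a4.2
    rw [orient_swap, orient_swap (bp t _)] at ho
    have := mul_neg_of_neg_of_pos o1 o2
    linarith
  refine ⟨τ, σ, τ0, τ1, σ0, σ1, fun k u hu => ?_⟩
  set b := F.band k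
  have key : ∀ i, (b.endSide i = s → p (b.endSide !i) → τ < b.endPar i u) ∧
      (b.endSide i = s → ¬ p (b.endSide !i) → b.endPar i u < τ) ∧
      (b.endSide i = t → p (b.endSide !i) → b.endPar i u < σ) ∧
      (b.endSide i = t → ¬ p (b.endSide !i) → σ < b.endPar i u) := fun i =>
    ⟨fun h1 h2 => hτ' _ (mem_endSet.2 ⟨k, i, u, hu, h1, h2, rfl⟩),
      fun h1 h2 => hτ _ (mem_endSet.2 ⟨k, i, u, hu, h1, h2, rfl⟩),
      fun h1 h2 => hσ _ (mem_endSet.2 ⟨k, i, u, hu, h1, h2, rfl⟩),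
      fun h1 h2 => hσ' _ (mem_endSet.2 ⟨k, i, u, hu, h1, h2, rfl⟩)⟩
  -- This describes the leaf ends, on `x` with other end on `y`, that lie between the ends of the
  -- chord; on `s` and `t` themselves the choice of the gap decides by means of `y`.
  set In : Fin 6 → Fin 6 → Prop := fun x y => p x ∨ ((x = s ∨ x = t) ∧ p y) with hIn
  have hin : ∀ i, In (b.endSide i) (b.endSide !i) →
      orient (bp s τ) (bp t σ) (bp (b.endSide i) (b.endPar i u)) < 0 := by
    intro i h
    have a := b.endPar_mem i hu
    obtain ⟨h1, h2⟩ : pos s τ < pos (b.endSide i) (b.endPar i u) ∧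
        pos (b.endSide i) (b.endPar i u) < pos t σ := by
      rcases h with h | ⟨h | h, h'⟩
      · exact ⟨pos_lt_of_lt h.1 τ1 a.1, pos_lt_of_lt h.2 a.2 σ0⟩
      · refine ⟨?_, ?_⟩
        · rw [pos_lt_iff τ0 τ1 a.1 a.2]; exact Or.inr ⟨h.symm, (key i).1 h h'⟩
        · rw [h]; exact pos_lt_of_lt hst a.2 σ0
      · refine ⟨?_, ?_⟩
        · rw [h]; exact pos_lt_of_lt hst τ1 a.1
        · rw [pos_lt_iff a.1 a.2 σ0 σ1]; exact Or.inr ⟨h, (key i).2.2.1 h h'⟩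
    exact orient_neg_of_between hst.ne h1 h2 τ0 τ1 σ0 σ1 a.1 a.2
  have hout : ∀ i, ¬ In (b.endSide i) (b.endSide !i) →
      0 < orient (bp s τ) (bp t σ) (bp (b.endSide i) (b.endPar i u)) := by
    intro i h
    have a := b.endPar_mem i hu
    refine orient_pos_of_outside hst ?_ τ0 τ1 σ0 σ1 a.1 a.2
    rcases lt_trichotomy (b.endSide i) s with h1 | h1 | h1
    · exact Or.inl (pos_lt_of_lt h1 a.2 τ0)
    · left
      rw [pos_lt_iff a.1 a.2 τ0 τ1]
      exact Or.inr ⟨h1, (key i).2.1 h1 fun hc => h (Or.inr ⟨Or.inl h1, hc⟩)⟩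
    · right
      rcases lt_trichotomy (b.endSide i) t with h2 | h2 | h2
      · exact absurd (Or.inl ⟨h1, h2⟩) h
      · rw [pos_lt_iff σ0 σ1 a.1 a.2]
        exact Or.inr ⟨h2.symm, (key i).2.2.2 h2 fun hc => h (Or.inr ⟨Or.inr h2, hc⟩)⟩
      · exact pos_lt_of_lt h2 σ1 a.1
  -- If the sides do not alternate, both ends of the leaf are on the same side of the chord. This
  -- includes leaves that share a side with the chord or are parallel to it.
  have hIn_iff : ¬ Alternate b.s b.t s t → (In b.s b.t ↔ In b.t b.s) := by
    have : ∀ x y s t : Fin 6, s < t → x ≠ y → ¬ Alternate x y s t →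
        (((s < x ∧ x < t) ∨ ((x = s ∨ x = t) ∧ s < y ∧ y < t)) ↔
          ((s < y ∧ y < t) ∨ ((y = s ∨ y = t) ∧ s < x ∧ x < t))) := by decide
    exact this _ _ _ _ hst b.ne
  have hleaf := b.leaf_eq true hu
  rw [hleaf]
  have hsame : (In b.s b.t ↔ In b.t b.s) → Disjoint (segment ℝ (bp s τ) (bp t σ))
      (segment ℝ (bp (b.endSide true) (b.endPar true u))
        (bp (b.endSide !true) (b.endPar (!true) u))) := by
    intro h
    by_cases hI : In b.s b.t
    · exact disjoint_segment_of_orient_neg (hin true hI) (hin false (h.1 hI))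
    · exact disjoint_segment_of_orient_pos (hout true hI) (hout false fun h' => hI (h.2 h'))
  refine ⟨?_, fun h => hsame (hIn_iff h)⟩
  by_cases hI : In b.s b.t ↔ In b.t b.s
  · rw [(hsame hI).inter_eq]; exact Set.subsingleton_empty
  · have hne : orient (bp s τ) (bp t σ) (bp (b.endSide true) (b.endPar true u)) ≠
        orient (bp s τ) (bp t σ) (bp (b.endSide !true) (b.endPar (!true) u)) := by
      by_cases h1 : In b.s b.t
      · have h2 : ¬ In b.t b.s := fun h => hI ⟨fun _ => h, fun _ => h1⟩
        exact ((hin true h1).trans (hout false h2)).ne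
      · have h2 : In b.t b.s := by by_contra h2; exact hI ⟨fun h => absurd h h1, fun h => absurd h h2⟩
        exact ((hin false h2).trans (hout true h1)).ne'
    rintro x ⟨hx, a, c, -, -, hac, rfl⟩ y ⟨hy, a', c', -, -, hac', rfl⟩
    have e1 := orient_eq_zero_of_mem_segment hx
    have e2 := orient_eq_zero_of_mem_segment hy
    rw [orient_lineMap _ _ _ _ _ _ hac] at e1
    rw [orient_lineMap _ _ _ _ _ _ hac'] at e2
    obtain rfl : a = 1 - c := by linarith
    obtain rfl : a' = 1 - c' := by linarith
    -- Along the leaf the orientation is affine with different values at the ends, so it vanishes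
    -- only once.
    have : (c - c') * (orient (bp s τ) (bp t σ) (bp (b.endSide true) (b.endPar true u)) -
        orient (bp s τ) (bp t σ) (bp (b.endSide !true) (b.endPar (!true) u))) = 0 := by
      linear_combination e2 - e1
    rcases mul_eq_zero.1 this with h | h
    · obtain rfl : c = c' := by linarith
      rfl
    · exact absurd (sub_eq_zero.1 h) hne

lemma MeasuredFoliation.exists_gap_arc' (F : MeasuredFoliation) (e : ArcClass) :
    ∃ τ σ, 0 < τ ∧ τ < 1 ∧ 0 < σ ∧ σ < 1 ∧
      ∀ k, ∀ u ∈ Set.Icc 0 (F.band k).width,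
        ((segment ℝ (bp e.s τ) (bp e.t σ)) ∩ (F.band k).leaf u).Subsingleton ∧
        (¬ (F.band k).toArcClass.Crosses e →
          Disjoint (segment ℝ (bp e.s τ) (bp e.t σ)) ((F.band k).leaf u)) := by
  rcases lt_or_gt_of_ne e.ne with h | h
  · exact F.exists_gap_arc h
  · obtain ⟨τ, σ, τ0, τ1, σ0, σ1, H⟩ := F.exists_gap_arc h
    refine ⟨σ, τ, σ0, σ1, τ0, τ1, fun k u hu => ?_⟩
    rw [segment_symm]
    exact ⟨(H k u hu).1, fun hc => (H k u hu).2 fun ha => hc (alternate_swap_right.1 ha)⟩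

/-- The intersection number is the total width of the bands that cross the arc. -/
theorem MeasuredFoliation.inter_eq (F : MeasuredFoliation) (e : ArcClass) :
    F.inter e = ∑ k, if (F.band k).toArcClass.Crosses e then (F.band k).width else 0 := by
  -- Lower bound: a leaf of a crossing band separates the ends of every arc of the class, so it is
  -- hit at least once.
  have hlow : ∀ γ, IsArc e γ →
      (∑ k, if (F.band k).toArcClass.Crosses e then ENNReal.ofReal (F.band k).width else 0)
        ≤ F.measure γ := by
    intro γ hγ
    refine Finset.sum_le_sum fun k _ => ?_
    split_ifs with hc
    swap
    · exact zero_le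
    have h1 : ENNReal.ofReal (F.band k).width =
        ∫⁻ _ in Set.Icc 0 (F.band k).width, (1 : ℝ≥0∞) := by simp
    rw [h1]
    refine MeasureTheory.setLIntegral_mono' measurableSet_Icc fun u hu => ?_
    have hne : {r ∈ Set.Icc (0 : ℝ) 1 | γ r ∈ (F.band k).leaf u}.Nonempty := by
      obtain ⟨ρ, ρ0, ρ1, hρ⟩ := mem_edge_iff.1 hγ.2.2.1
      obtain ⟨κ, κ0, κ1, hκ⟩ := mem_edge_iff.1 hγ.2.2.2.1
      have a1 := (F.band k).endPar_mem true hu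
      have a2 := (F.band k).endPar_mem false hu
      obtain ⟨r, hr, hm⟩ := exists_mem_chord (F.band k).ne a1.1 a1.2 a2.1 a2.2 hγ.1 hγ.mem_body
        (by rw [hρ, hκ]; exact orient_mul_neg (F.band k).ne hc a1.1 a1.2 a2.1 a2.2 ρ0 ρ1 κ0 κ1)
      refine ⟨r, hr, ?_⟩
      rw [Band.leaf_eq _ true hu]
      exact hm
    have : (1 : ℕ∞) ≤ {r ∈ Set.Icc (0 : ℝ) 1 | γ r ∈ (F.band k).leaf u}.encard :=
      Set.one_le_encard_iff_nonempty.2 hne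
    calc (1 : ℝ≥0∞) = ((1 : ℕ∞) : ℝ≥0∞) := by simp
      _ ≤ _ := by exact_mod_cast this
  -- Upper bound: the chord through the gaps meets each leaf of a crossing band at most once and no
  -- other leaf, so the infimum is attained.
  have hup : ∃ γ, IsArc e γ ∧ F.measure γ ≤
      (∑ k, if (F.band k).toArcClass.Crosses e then ENNReal.ofReal (F.band k).width else 0) := by
    obtain ⟨τ, σ, τ0, τ1, σ0, σ1, H⟩ := F.exists_gap_arc' e
    have harc := isArc_chordPath e τ0 τ1 σ0 σ1
    have hseg : ∀ r ∈ Set.Icc (0 : ℝ) 1, chordPath (bp e.s τ) (bp e.t σ) r ∈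
        segment ℝ (bp e.s τ) (bp e.t σ) := fun r hr =>
      ⟨1 - r, r, sub_nonneg.2 hr.2, hr.1, by ring, rfl⟩
    refine ⟨_, harc, Finset.sum_le_sum fun k _ => ?_⟩
    split_ifs with hc
    · have h1 : ENNReal.ofReal (F.band k).width =
          ∫⁻ _ in Set.Icc 0 (F.band k).width, (1 : ℝ≥0∞) := by simp
      rw [h1]
      refine MeasureTheory.setLIntegral_mono' measurableSet_Icc fun u hu => ?_
      have hs : {r ∈ Set.Icc (0 : ℝ) 1 |
          chordPath (bp e.s τ) (bp e.t σ) r ∈ (F.band k).leaf u}.Subsingleton := by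
        rintro r ⟨hr, hr'⟩ r' ⟨hr1, hr1'⟩
        exact harc.2.1 hr hr1 ((H k u hu).1 ⟨hseg r hr, hr'⟩ ⟨hseg r' hr1, hr1'⟩)
      have : {r ∈ Set.Icc (0 : ℝ) 1 |
          chordPath (bp e.s τ) (bp e.t σ) r ∈ (F.band k).leaf u}.encard ≤ (1 : ℕ∞) :=
        Set.encard_le_one_iff_subsingleton.2 hs
      calc _ ≤ ((1 : ℕ∞) : ℝ≥0∞) := by exact_mod_cast this
        _ = 1 := by simp
    · rw [nonpos_iff_eq_zero, MeasureTheory.setLIntegral_congr_fun (g := fun _ => 0)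
        measurableSet_Icc]
      · simp
      · intro u hu
        have : {r ∈ Set.Icc (0 : ℝ) 1 |
            chordPath (bp e.s τ) (bp e.t σ) r ∈ (F.band k).leaf u} = ∅ := by
          rw [Set.eq_empty_iff_forall_notMem]
          rintro r ⟨hr, hr'⟩
          exact Set.disjoint_left.1 ((H k u hu).2 hc) (hseg r hr) hr'
        simp only [this]
        simp
  have hinf : (⨅ (γ : ℝ → ℝ × ℝ) (_ : IsArc e γ), F.measure γ) =
      ∑ k, if (F.band k).toArcClass.Crosses e then ENNReal.ofReal (F.band k).width else 0 := by
    refine le_antisymm ?_ (le_iInf₂ hlow)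
    obtain ⟨γ, hγ, hle⟩ := hup
    exact (iInf₂_le γ hγ).trans hle
  unfold MeasuredFoliation.inter
  rw [hinf, ENNReal.toReal_sum]
  · refine Finset.sum_congr rfl fun k _ => ?_
    split_ifs
    · exact ENNReal.toReal_ofReal (F.band k).width_pos.le
    · rfl
  · intro k _
    split_ifs
    · exact ENNReal.ofReal_ne_top
    · exact ENNReal.zero_ne_top

end Hexagon

noncomputable section
namespace Hexagon

/-! ### Weights -/

/-- The arc joining the side `k` to the opposite side. -/
def ArcClass.long (k : Fin 6) : ArcClass where
  s := k
  t := k + 3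
  ne := by revert k; decide
  not_next := by revert k; decide
  not_prev := by revert k; decide

/-- The value at `e` of the function given by `f` on the arcs parallel to the sides and by `g` on
the arcs joining opposite sides. -/
def ArcClass.ev {α : Type*} (f g : Fin 6 → α) (e : ArcClass) : α :=
  if e.t = e.s + 3 then g e.s else if e.t = e.s + 2 then f (e.s + 1) else f (e.s - 1)

lemma ArcClass.ev_side {α : Type*} (f g : Fin 6 → α) (k : Fin 6) : (ArcClass.side k).ev f g = f k := by
  have h1 : ∀ k : Fin 6, k + 1 ≠ k - 1 + 3 ∧ k + 1 = k - 1 + 2 ∧ k - 1 + 1 = k := by decide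
  obtain ⟨h1, h2, h3⟩ := h1 k
  simp only [ev, side, if_neg h1, if_pos h2, h3]

lemma ArcClass.ev_long {α : Type*} (f g : Fin 6 → α) (k : Fin 6) : (ArcClass.long k).ev f g = g k := by
  simp [ev, long]

/-- Each class is that of the arc parallel to a side or of an arc joining opposite sides. -/
lemma ArcClass.ev_cases (e : ArcClass) :
    (∃ k, e.Same (side k) ∧ ∀ {α : Type} (f g : Fin 6 → α), e.ev f g = f k) ∨
    (∃ k, e.Same (long k) ∧ ∀ {α : Type} (f g : Fin 6 → α), e.ev f g = g k) := by
  have h : ∀ s t : Fin 6, s ≠ t → s + 1 ≠ t → t + 1 ≠ s → t = s + 3 ∨ (t = s + 2 ∧ t ≠ s + 3) ∨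
      (t ≠ s + 3 ∧ t ≠ s + 2 ∧ s = s - 1 + 1 ∧ t = s - 1 - 1) := by decide
  rcases h e.s e.t e.ne e.not_next e.not_prev with h | ⟨h, h'⟩ | ⟨h, h', h1, h2⟩
  · exact Or.inr ⟨e.s, Or.inl ⟨rfl, h⟩, fun f g => by simp [ev, h]⟩
  · refine Or.inl ⟨e.s + 1, Or.inl ⟨by simp [side], h.trans ((by decide : ∀ s : Fin 6, s + 2 = s + 1 + 1) e.s)⟩, fun f g => ?_⟩
    simp only [ev, if_neg h', if_pos h]
  · refine Or.inl ⟨e.s - 1, Or.inr ⟨h1, h2⟩, fun f g => ?_⟩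
    simp only [ev, if_neg h, if_neg h']

/-- Weights on the classes of arcs, the arcs of positive weight being disjoint: `a k` is the weight
of the arc parallel to the side `k`, and `b k` that of the arc from the side `k` to the opposite
one. -/
@[ext]
structure Weight where
  a : Fin 6 → ℝ
  b : Fin 6 → ℝ
  b_add_three : ∀ k, b (k + 3) = b k
  a_nonneg : ∀ k, 0 ≤ a k
  b_nonneg : ∀ k, 0 ≤ b k
  a_mul_a : ∀ k, a k * a (k + 1) = 0
  a_mul_b : ∀ k, a k * b k = 0
  b_mul_b : ∀ k, b k * b (k + 1) = 0

namespace Weight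

variable (W : Weight)

/-- The intersection number with the arc parallel to the side `k`. -/
def deg (k : Fin 6) : ℝ := W.a (k + 1) + W.a (k - 1) + W.b k

/-- The intersection number with the arc from the side `k` to the opposite one. -/
def crossLong (k : Fin 6) : ℝ := W.a k + W.a (k + 3) + W.b (k + 1) + W.b (k + 2)

/-- The intersection number with an arc. -/
def cross (e : ArcClass) : ℝ := e.ev W.deg W.crossLong

/-- The weight of an arc. -/
def wt (e : ArcClass) : ℝ := e.ev W.a W.b

lemma wt_nonneg (e : ArcClass) : 0 ≤ W.wt e := by
  unfold wt ArcClass.ev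
  split_ifs
  exacts [W.b_nonneg _, W.a_nonneg _, W.a_nonneg _]

lemma deg_nonneg (k : Fin 6) : 0 ≤ W.deg k :=
  add_nonneg (add_nonneg (W.a_nonneg _) (W.a_nonneg _)) (W.b_nonneg _)

lemma crossLong_nonneg (k : Fin 6) : 0 ≤ W.crossLong k :=
  add_nonneg (add_nonneg (add_nonneg (W.a_nonneg _) (W.a_nonneg _)) (W.b_nonneg _)) (W.b_nonneg _)

lemma cross_nonneg (e : ArcClass) : 0 ≤ W.cross e := by
  unfold cross ArcClass.ev
  split_ifs
  exacts [W.crossLong_nonneg _, W.deg_nonneg _, W.deg_nonneg _]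

end Weight

/-- Equality of the unordered pairs `{x, y}` and `{s, t}`. -/
def sameNat (x y s t : Fin 6) : ℕ := if (x = s ∧ y = t) ∨ (x = t ∧ y = s) then 1 else 0

lemma same_ite (f e : ArcClass) (w : ℝ) :
    (if f.Same e then w else 0) = sameNat f.s f.t e.s e.t * w := by
  unfold sameNat
  by_cases h : f.Same e
  · have h' : (f.s = e.s ∧ f.t = e.t) ∨ (f.s = e.t ∧ f.t = e.s) := h
    simp only [if_pos h, if_pos h']; simp
  · have h' : ¬ ((f.s = e.s ∧ f.t = e.t) ∨ (f.s = e.t ∧ f.t = e.s)) := h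
    simp only [if_neg h, if_neg h']; simp

/-- The arcs crossing the one parallel to `k` are exactly those ending on the side `k`, which form
three classes. -/
lemma alternate_ite_side : ∀ x y k : Fin 6, x ≠ y → x + 1 ≠ y → y + 1 ≠ x →
    (if Alternate x y (k - 1) (k + 1) then 1 else 0) =
      sameNat x y (k + 1 - 1) (k + 1 + 1) + sameNat x y (k - 1 - 1) (k - 1 + 1) +
        sameNat x y k (k + 3) := by decide

/-- An arc joining opposite sides is crossed by the two short arcs around its ends and by the two
other long arcs. -/
lemma alternate_ite_long : ∀ x y k : Fin 6, x ≠ y → x + 1 ≠ y → y + 1 ≠ x →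
    (if Alternate x y k (k + 3) then 1 else 0) =
      sameNat x y (k - 1) (k + 1) + sameNat x y (k + 3 - 1) (k + 3 + 1) +
        sameNat x y (k + 1) (k + 1 + 3) + sameNat x y (k + 2) (k + 2 + 3) := by decide

namespace MeasuredFoliation

variable (F : MeasuredFoliation)

/-- The total width of the bands in a class. -/
def total (e : ArcClass) : ℝ :=
  ∑ i, if (F.band i).toArcClass.Same e then (F.band i).width else 0

lemma total_nonneg (e : ArcClass) : 0 ≤ F.total e :=
  Finset.sum_nonneg fun i _ => by
    split_ifs
    exacts [(F.band i).width_pos.le, le_rfl]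

lemma total_eq_zero_iff (e : ArcClass) :
    F.total e = 0 ↔ ∀ i, ¬ (F.band i).toArcClass.Same e := by
  unfold total
  rw [Finset.sum_eq_zero_iff_of_nonneg]
  · refine ⟨fun h i hi => ?_, fun h i _ => if_neg (h i)⟩
    have := h i (Finset.mem_univ i)
    rw [if_pos hi] at this
    exact (F.band i).width_pos.ne' this
  · intro i _
    split_ifs
    exacts [(F.band i).width_pos.le, le_rfl]

lemma total_mul_total {e f : ArcClass} (h : e.Crosses f) : F.total e * F.total f = 0 := by
  rw [mul_eq_zero]
  by_contra hc
  push Not at hc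
  simp only [ne_eq, total_eq_zero_iff, not_forall, not_not] at hc
  obtain ⟨⟨i, hi⟩, j, hj⟩ := hc
  refine F.not_crosses i j ?_
  change Alternate _ _ _ _
  have h : Alternate e.s e.t f.s f.t := h
  rcases hi with ⟨h1, h2⟩ | ⟨h1, h2⟩ <;> rcases hj with ⟨h3, h4⟩ | ⟨h3, h4⟩ <;>
    rw [h1, h2, h3, h4]
  · exact h
  · exact alternate_swap_right.1 h
  · exact alternate_swap_left.1 h
  · exact alternate_swap_left.1 (alternate_swap_right.1 h)

/-- The weight given by a foliation. -/
def weight : Weight where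
  a k := F.total (ArcClass.side k)
  b k := F.total (ArcClass.long k)
  b_add_three k := by
    refine Finset.sum_congr rfl fun i _ => ?_
    refine if_congr ?_ rfl rfl
    have : k + 3 + 3 = k := by revert k; decide
    simp only [ArcClass.Same, ArcClass.long, this]
    tauto
  a_nonneg k := F.total_nonneg _
  b_nonneg k := F.total_nonneg _
  a_mul_a k := F.total_mul_total (by revert k; decide)
  a_mul_b k := F.total_mul_total (by revert k; decide)
  b_mul_b k := F.total_mul_total (by revert k; decide)

lemma total_congr {e f : ArcClass} (h : e.Same f) : F.total e = F.total f := by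
  refine Finset.sum_congr rfl fun i _ => if_congr ?_ rfl rfl
  unfold ArcClass.Same at *
  rcases h with ⟨h1, h2⟩ | ⟨h1, h2⟩ <;> rw [h1, h2]
  tauto

lemma inter_congr {e f : ArcClass} (h : e.Same f) : F.inter e = F.inter f := by
  rw [inter_eq, inter_eq]
  refine Finset.sum_congr rfl fun i _ => if_congr ?_ rfl rfl
  change Alternate _ _ _ _ ↔ Alternate _ _ _ _
  rcases h with ⟨h1, h2⟩ | ⟨h1, h2⟩ <;> rw [h1, h2]
  exact alternate_swap_right

lemma wt_weight (e : ArcClass) : F.weight.wt e = F.total e := by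
  unfold Weight.wt
  rcases e.ev_cases with ⟨k, hk, h⟩ | ⟨k, hk, h⟩ <;> rw [h, F.total_congr hk] <;> rfl

lemma inter_side (k : Fin 6) : F.inter (ArcClass.side k) = F.weight.deg k := by
  rw [inter_eq]
  simp only [Weight.deg, weight, total, ← Finset.sum_add_distrib, same_ite]
  refine Finset.sum_congr rfl fun i _ => ?_
  have h := alternate_ite_side (F.band i).s (F.band i).t k (F.band i).ne (F.band i).not_next
    (F.band i).not_prev
  have h' := congrArg (fun n : ℕ => (n : ℝ) * (F.band i).width) h
  simp only [Nat.cast_add, add_mul, Nat.cast_ite, Nat.cast_one, Nat.cast_zero, ite_mul, one_mul,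
    zero_mul] at h'
  exact h'

lemma inter_long (k : Fin 6) : F.inter (ArcClass.long k) = F.weight.crossLong k := by
  rw [inter_eq]
  simp only [Weight.crossLong, weight, total, ← Finset.sum_add_distrib, same_ite]
  refine Finset.sum_congr rfl fun i _ => ?_
  have h := alternate_ite_long (F.band i).s (F.band i).t k (F.band i).ne (F.band i).not_next
    (F.band i).not_prev
  have h' := congrArg (fun n : ℕ => (n : ℝ) * (F.band i).width) h
  simp only [Nat.cast_add, add_mul, Nat.cast_ite, Nat.cast_one, Nat.cast_zero, ite_mul, one_mul,
    zero_mul] at h'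
  exact h'

theorem inter_eq_cross (e : ArcClass) : F.inter e = F.weight.cross e := by
  unfold Weight.cross
  rcases e.ev_cases with ⟨k, hk, h⟩ | ⟨k, hk, h⟩ <;> rw [h, F.inter_congr hk]
  · exact F.inter_side k
  · exact F.inter_long k

lemma interVec_eq : F.interVec = F.weight.deg := funext F.inter_side

end MeasuredFoliation

/-! ### Realization of weights -/

/-- Where on the side `s` the bands from `s` to `t` start. -/
def slot (s t : Fin 6) : ℕ := if t = s + 2 then 3 else if t = s + 3 then 2 else 1

lemma slot_mem (s t : Fin 6) : 1 ≤ slot s t ∧ slot s t ≤ 3 := by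
  unfold slot; split_ifs <;> simp

lemma slot_bounds (s t : Fin 6) {x : ℝ} (h : |x| ≤ 1 / 16) :
    0 < (slot s t : ℝ) / 4 + x ∧ (slot s t : ℝ) / 4 + x < 1 := by
  obtain ⟨h1, h2⟩ := slot_mem s t
  have h1 : (1 : ℝ) ≤ slot s t := by exact_mod_cast h1
  have h2 : (slot s t : ℝ) ≤ 3 := by exact_mod_cast h2
  rw [abs_le] at h
  constructor <;> linarith [h.1, h.2]

lemma pos_slot_lt {s t u v : Fin 6} {x y : ℝ} (hx : |x| ≤ 1 / 16) (hy : |y| ≤ 1 / 16)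
    (h : 4 * (s : ℕ) + slot s t < 4 * (u : ℕ) + slot u v) :
    pos s (slot s t / 4 + x) < pos u (slot u v / 4 + y) := by
  have h' : (4 : ℝ) * (s : ℕ) + slot s t + 1 ≤ 4 * (u : ℕ) + slot u v := by exact_mod_cast h
  rw [abs_le] at hx hy
  unfold pos
  linarith [hx.1, hx.2, hy.1, hy.2]

/-- On each side the three possible bands start at 1/4, 1/2, 3/4, in the reverse of the cyclic order
of their targets, so that bands leaving one side do not cross. In units of a quarter side, all
positions are integers and non-alternation is a finite check. -/
lemma slot_order : ∀ s t u v : Fin 6, s < t → s + 1 ≠ t → t + 1 ≠ s → u ≠ v → u + 1 ≠ v → v + 1 ≠ u →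
    ¬ ((s = u ∧ t = v) ∨ (s = v ∧ t = u)) → ¬ Alternate s t u v →
    ((4 * (s : ℕ) + slot s t < 4 * (u : ℕ) + slot u v ∧
      4 * (u : ℕ) + slot u v < 4 * (t : ℕ) + slot t s ∧
      4 * (s : ℕ) + slot s t < 4 * (v : ℕ) + slot v u ∧
      4 * (v : ℕ) + slot v u < 4 * (t : ℕ) + slot t s) ∨
    ((4 * (u : ℕ) + slot u v < 4 * (s : ℕ) + slot s t ∨
      4 * (t : ℕ) + slot t s < 4 * (u : ℕ) + slot u v) ∧
     (4 * (v : ℕ) + slot v u < 4 * (s : ℕ) + slot s t ∨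
      4 * (t : ℕ) + slot t s < 4 * (v : ℕ) + slot v u))) := by decide

lemma disjoint_slots {e f : ArcClass} (hs : ¬ e.Same f) (hc : ¬ e.Crosses f) {x x' y y' : ℝ}
    (hx : |x| ≤ 1 / 16) (hx' : |x'| ≤ 1 / 16) (hy : |y| ≤ 1 / 16) (hy' : |y'| ≤ 1 / 16) :
    Disjoint
      (segment ℝ (bp e.s (slot e.s e.t / 4 + x)) (bp e.t (slot e.t e.s / 4 + x')))
      (segment ℝ (bp f.s (slot f.s f.t / 4 + y)) (bp f.t (slot f.t f.s / 4 + y'))) := by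
  have key : ∀ s t u v : Fin 6, s < t → s + 1 ≠ t → t + 1 ≠ s → u ≠ v → u + 1 ≠ v → v + 1 ≠ u →
      ¬ ((s = u ∧ t = v) ∨ (s = v ∧ t = u)) → ¬ Alternate s t u v →
      ∀ {x x' y y' : ℝ}, |x| ≤ 1 / 16 → |x'| ≤ 1 / 16 → |y| ≤ 1 / 16 → |y'| ≤ 1 / 16 →
      Disjoint (segment ℝ (bp s (slot s t / 4 + x)) (bp t (slot t s / 4 + x')))
        (segment ℝ (bp u (slot u v / 4 + y)) (bp v (slot v u / 4 + y'))) := by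
    intro s t u v hst h1 h2 h3 h4 h5 h6 h7 x x' y y' hx hx' hy hy'
    refine disjoint_chords hst (slot_bounds _ _ hx).1 (slot_bounds _ _ hx).2
      (slot_bounds _ _ hx').1 (slot_bounds _ _ hx').2 (slot_bounds _ _ hy).1
      (slot_bounds _ _ hy).2 (slot_bounds _ _ hy').1 (slot_bounds _ _ hy').2 ?_
    rcases slot_order s t u v hst h1 h2 h3 h4 h5 h6 h7 with ⟨k1, k2, k3, k4⟩ | ⟨k1, k2⟩
    · exact Or.inl ⟨pos_slot_lt hx hy k1, pos_slot_lt hy hx' k2, pos_slot_lt hx hy' k3,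
        pos_slot_lt hy' hx' k4⟩
    · exact Or.inr ⟨k1.imp (pos_slot_lt hy hx) (pos_slot_lt hx' hy),
        k2.imp (pos_slot_lt hy' hx) (pos_slot_lt hx' hy')⟩
  rcases lt_or_gt_of_ne e.ne with h | h
  · exact key _ _ _ _ h e.not_next e.not_prev f.ne f.not_next f.not_prev hs hc hx hx' hy hy'
  · rw [segment_symm ℝ (bp e.s _)]
    exact key _ _ _ _ h e.not_prev e.not_next f.ne f.not_next f.not_prev
      (fun h => hs (by unfold ArcClass.Same; tauto)) (fun h => hc (alternate_swap_left.1 h))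
      hx' hx hy hy'

/-- The two ends move in opposite directions along the boundary, which makes the leaves of a band
nested. -/
lemma disjoint_leaves_slot (e : ArcClass) {x y : ℝ} (hx : |x| ≤ 1 / 16) (hy : |y| ≤ 1 / 16)
    (h : x < y) :
    Disjoint
      (segment ℝ (bp e.s (slot e.s e.t / 4 + x)) (bp e.t (slot e.t e.s / 4 + -x)))
      (segment ℝ (bp e.s (slot e.s e.t / 4 + y)) (bp e.t (slot e.t e.s / 4 + -y))) := by
  have hx' : |-x| ≤ 1 / 16 := by rwa [abs_neg]
  have hy' : |-y| ≤ 1 / 16 := by rwa [abs_neg]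
  have b1 := slot_bounds e.s e.t hx
  have b2 := slot_bounds e.t e.s hx'
  have b3 := slot_bounds e.s e.t hy
  have b4 := slot_bounds e.t e.s hy'
  rcases lt_or_gt_of_ne e.ne with hlt | hlt
  · refine disjoint_chords hlt b1.1 b1.2 b2.1 b2.2 b3.1 b3.2 b4.1 b4.2 (Or.inl ⟨?_, ?_, ?_, ?_⟩)
    · unfold pos; linarith
    · exact pos_lt_of_lt hlt b3.2 b2.1
    · exact pos_lt_of_lt hlt b1.2 b4.1
    · unfold pos; linarith
  · rw [segment_symm ℝ (bp e.s _)]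
    refine disjoint_chords hlt b2.1 b2.2 b1.1 b1.2 b3.1 b3.2 b4.1 b4.2 (Or.inr ⟨?_, ?_⟩)
    · right; unfold pos; linarith
    · left; unfold pos; linarith

lemma abs_slot_le {w u : ℝ} (hw : 0 < w) (hu : u ∈ Set.Icc 0 w) : |u / w / 16| ≤ 1 / 16 := by
  have h0 : 0 ≤ u / w := div_nonneg hu.1 hw.le
  have h1 : u / w ≤ 1 := (div_le_one hw).2 hu.2
  rw [abs_of_nonneg (by positivity)]
  linarith

/-- A band of given class and width. -/
def standardBand (e : ArcClass) (w : ℝ) (hw : 0 < w) : Band where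
  toArcClass := e
  width := w
  width_pos := hw
  p u := bp e.s (slot e.s e.t / 4 + u / w / 16)
  q u := bp e.t (slot e.t e.s / 4 + -(u / w / 16))
  continuousOn_p := by unfold bp; fun_prop
  continuousOn_q := by unfold bp; fun_prop
  p_mem u hu := bp_mem_edge (slot_bounds _ _ (abs_slot_le hw hu)).1
    (slot_bounds _ _ (abs_slot_le hw hu)).2
  q_mem u hu := by
    have h : |-(u / w / 16)| ≤ 1 / 16 := by rw [abs_neg]; exact abs_slot_le hw hu
    exact bp_mem_edge (slot_bounds _ _ h).1 (slot_bounds _ _ h).2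
  disjoint_leaves u hu u' hu' hne := by
    rcases lt_or_gt_of_ne hne with h | h
    · exact disjoint_leaves_slot e (abs_slot_le hw hu) (abs_slot_le hw hu') (by gcongr)
    · exact (disjoint_leaves_slot e (abs_slot_le hw hu') (abs_slot_le hw hu) (by gcongr)).symm

lemma disjoint_standardBand {e f : ArcClass} (hs : ¬ e.Same f) (hc : ¬ e.Crosses f) {w w' : ℝ}
    (hw : 0 < w) (hw' : 0 < w') :
    Disjoint (standardBand e w hw).support (standardBand f w' hw').support := by
  unfold Band.support
  simp only [Set.disjoint_iUnion_left, Set.disjoint_iUnion_right]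
  intro u' hu' u hu
  have h1 : |-(u / w / 16)| ≤ 1 / 16 := by rw [abs_neg]; exact abs_slot_le hw hu
  have h2 : |-(u' / w' / 16)| ≤ 1 / 16 := by rw [abs_neg]; exact abs_slot_le hw' hu'
  exact disjoint_slots hs hc (abs_slot_le hw hu) h1 (abs_slot_le hw' hu') h2

/-- The nine classes of arcs. -/
def classOf : Fin 6 ⊕ Fin 3 → ArcClass
  | Sum.inl k => ArcClass.side k
  | Sum.inr k => ArcClass.long (k.castLE (by norm_num))

lemma same_classOf : ∀ c c' : Fin 6 ⊕ Fin 3, (classOf c).Same (classOf c') ↔ c = c' := by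
  decide

namespace Weight

lemma wt_mul_wt (W : Weight) : ∀ c c' : Fin 6 ⊕ Fin 3, (classOf c).Crosses (classOf c') →
    W.wt (classOf c) * W.wt (classOf c') = 0 := by
  have e1 : ∀ k : Fin 6, W.wt (classOf (Sum.inl k)) = W.a k := fun k => ArcClass.ev_side _ _ k
  have e2 : ∀ k : Fin 3, W.wt (classOf (Sum.inr k)) = W.b (k.castLE (by norm_num)) :=
    fun k => ArcClass.ev_long _ _ _
  have d1 : ∀ k l : Fin 6, (classOf (Sum.inl k)).Crosses (classOf (Sum.inl l)) →
      l = k + 1 ∨ k = l + 1 := by decide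
  have d2 : ∀ (k : Fin 6) (l : Fin 3), ((classOf (Sum.inl k)).Crosses (classOf (Sum.inr l)) ∨
      (classOf (Sum.inr l)).Crosses (classOf (Sum.inl k))) →
      k = l.castLE (by norm_num) ∨ k = l.castLE (by norm_num) + 3 := by decide
  have d3 : ∀ k l : Fin 3, (classOf (Sum.inr k)).Crosses (classOf (Sum.inr l)) →
      (l.castLE (by norm_num) : Fin 6) = k.castLE (by norm_num) + 1 ∨
      (k.castLE (by norm_num) : Fin 6) = l.castLE (by norm_num) + 1 ∨
      (k.castLE (by norm_num) : Fin 6) + 3 = l.castLE (by norm_num) + 1 ∨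
      (l.castLE (by norm_num) : Fin 6) + 3 = k.castLE (by norm_num) + 1 := by decide
  rintro (k | k) (l | l) h
  · rw [e1, e1]
    rcases d1 k l h with rfl | rfl
    · exact W.a_mul_a _
    · rw [mul_comm]; exact W.a_mul_a _
  · rw [e1, e2]
    rcases d2 k l (Or.inl h) with h | h
    · rw [← h]; exact W.a_mul_b k
    · rw [← W.b_add_three, ← h]; exact W.a_mul_b k
  · rw [e1, e2, mul_comm]
    rcases d2 l k (Or.inr h) with h | h
    · rw [← h]; exact W.a_mul_b l
    · rw [← W.b_add_three, ← h]; exact W.a_mul_b l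
  · rw [e2, e2]
    rcases d3 k l h with h | h | h | h
    · rw [h]; exact W.b_mul_b _
    · rw [h, mul_comm]; exact W.b_mul_b _
    · rw [← W.b_add_three (Fin.castLE _ k), h, mul_comm]; exact W.b_mul_b _
    · rw [← W.b_add_three (Fin.castLE _ l), h]; exact W.b_mul_b _

/-- The classes of positive weight. -/
abbrev Support (W : Weight) : Type := {c : Fin 6 ⊕ Fin 3 // 0 < W.wt (classOf c)}

lemma sum_support (W : Weight) (c : Fin 6 ⊕ Fin 3) :
    (∑ i : W.Support, if (classOf i.1).Same (classOf c) then W.wt (classOf i.1) else 0) =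
      W.wt (classOf c) := by
  classical
  simp only [same_classOf]
  by_cases h : 0 < W.wt (classOf c)
  · rw [Finset.sum_eq_single ⟨c, h⟩]
    · simp
    · rintro ⟨i, hi⟩ - hne
      rw [if_neg]
      rintro rfl
      exact hne rfl
    · simp
  · rw [Finset.sum_eq_zero, le_antisymm (not_lt.1 h) (W.wt_nonneg _)]
    rintro ⟨i, hi⟩ -
    rw [if_neg]
    rintro rfl
    exact h hi

/-- Each nonzero weight is given by a foliation. -/
theorem exists_foliation (W : Weight) (hW : W.deg ≠ 0) : ∃ F : MeasuredFoliation, F.weight = W := by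
  classical
  let E : Fin (Fintype.card W.Support) ≃ W.Support := (Fintype.equivFin _).symm
  -- With no class of positive weight all weights vanish, and so do the intersection numbers.
  have hpos : 0 < Fintype.card W.Support := by
    rw [Fintype.card_pos_iff]
    by_contra hemp
    have h0 : ∀ c, W.wt (classOf c) = 0 := fun c =>
      le_antisymm (not_lt.1 fun h => hemp ⟨⟨c, h⟩⟩) (W.wt_nonneg _)
    have ha : ∀ k, W.a k = 0 := fun k => by
      rw [← ArcClass.ev_side W.a W.b]; exact h0 (Sum.inl k)
    have hb3 : ∀ k : Fin 3, W.b (k.castLE (by norm_num)) = 0 := fun k => by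
      rw [← ArcClass.ev_long W.a W.b]; exact h0 (Sum.inr k)
    have hb : ∀ k, W.b k = 0 := by
      intro k
      have : ∀ k : Fin 6, ∃ j : Fin 3, k = j.castLE (by norm_num) ∨
        k = j.castLE (by norm_num) + 3 := by decide
      obtain ⟨j, rfl | rfl⟩ := this k
      · exact hb3 j
      · rw [W.b_add_three]; exact hb3 j
    exact hW (funext fun k => by simp [deg, ha, hb])
  let F : MeasuredFoliation :=
    { n := Fintype.card W.Support
      n_pos := hpos
      band := fun i => standardBand (classOf (E i).1) _ (E i).2
      disjoint_bands := fun k l hkl => disjoint_standardBand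
        (fun h => hkl (E.injective (Subtype.ext ((same_classOf _ _).1 h))))
        (fun h => absurd (W.wt_mul_wt _ _ h) (mul_pos (E k).2 (E l).2).ne') _ _ }
  have ht : ∀ c, F.total (classOf c) = W.wt (classOf c) := by
    intro c
    rw [← W.sum_support c]
    exact E.sum_comp fun i : W.Support =>
      if (classOf i.1).Same (classOf c) then W.wt (classOf i.1) else 0
  refine ⟨F, Weight.ext (funext fun k => ?_) (funext fun k => ?_)⟩
  · exact (ht (Sum.inl k)).trans (ArcClass.ev_side _ _ _)
  · have : ∀ k : Fin 6, ∃ j : Fin 3, k = j.castLE (by norm_num) ∨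
      k = j.castLE (by norm_num) + 3 := by decide
    obtain ⟨j, rfl | rfl⟩ := this k
    · exact (ht (Sum.inr j)).trans (ArcClass.ev_long _ _ _)
    · rw [W.b_add_three, F.weight.b_add_three]
      exact (ht (Sum.inr j)).trans (ArcClass.ev_long _ _ _)

end Weight

end Hexagon
end

noncomputable section
namespace Hexagon

open Real

/-! ### The side lengths of right hexagons -/

/-- The law of cosines for the side lengths of a right hexagon. -/
structure IsHex (l : Fin 6 → ℝ) : Prop where
  pos : ∀ k, 0 < l k
  law : ∀ k, cosh (l (k + 1)) * (sinh (l k) * sinh (l (k + 2))) =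
    cosh (l k) * cosh (l (k + 2)) + cosh (l (k + 4))

/-- The distance of the side `k` to the opposite side. -/
def longLen (l : Fin 6 → ℝ) (k : Fin 6) : ℝ := arcosh (sinh (l (k + 1)) * sinh (l (k + 2)))

/-- The length of an arc. -/
def hexLen (l : Fin 6 → ℝ) (e : ArcClass) : ℝ := e.ev l (longLen l)

lemma cosh_inj_of_pos {x y : ℝ} (hx : 0 < x) (hy : 0 < y) (h : cosh x = cosh y) : x = y :=
  cosh_strictMonoOn.injOn hx.le hy.le h

lemma exists_cosh_sinh {c s : ℝ} (hc : 0 < c) (hs : 0 < s) (h : c ^ 2 - s ^ 2 = 1) :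
    ∃ x, 0 < x ∧ cosh x = c ∧ sinh x = s := by
  have h1 : sinh (arsinh s) = s := sinh_arsinh s
  refine ⟨arsinh s, ?_, ?_, h1⟩
  · rw [← sinh_pos_iff, h1]; exact hs
  · rw [cosh_arsinh]
    rw [Real.sqrt_eq_iff_mul_self_eq_of_pos hc]
    linarith

namespace IsHex

variable {l : Fin 6 → ℝ}

lemma rotate (h : IsHex l) (j : Fin 6) : IsHex (fun k => l (k + j)) where
  pos k := h.pos _
  law k := by
    have := h.law (k + j)
    have e : ∀ i : Fin 6, k + j + i = k + i + j := fun i => add_right_comm k j i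
    simpa only [e] using this

lemma sinh_pos (h : IsHex l) (k : Fin 6) : 0 < sinh (l k) := sinh_pos_iff.2 (h.pos k)

/-- Squaring the two laws of cosines gives the same symmetric expression in `c0`, `c2`, `c4` for `s0
* s1 * s2` and `s3 * s4 * s2`; positivity allows square roots to be taken. -/
lemma sine_aux {c0 s0 c1 s1 c2 s2 c3 s3 c4 s4 : ℝ} (p0 : 0 < s0) (p1 : 0 < s1)
    (p2 : 0 < s2) (p3 : 0 < s3) (p4 : 0 < s4)
    (q0 : c0 ^ 2 = s0 ^ 2 + 1) (q1 : c1 ^ 2 = s1 ^ 2 + 1) (q2 : c2 ^ 2 = s2 ^ 2 + 1)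
    (q3 : c3 ^ 2 = s3 ^ 2 + 1) (q4 : c4 ^ 2 = s4 ^ 2 + 1)
    (h1 : c1 * (s0 * s2) = c0 * c2 + c4) (h3 : c3 * (s2 * s4) = c2 * c4 + c0) :
    s0 * s1 = s3 * s4 := by
  have e1 : (s0 * s1 * s2) ^ 2 = c0 ^ 2 + c2 ^ 2 + c4 ^ 2 + 2 * c0 * c2 * c4 - 1 := by
    linear_combination (c1 * (s0 * s2) + (c0 * c2 + c4)) * h1 - s0 ^ 2 * s2 ^ 2 * q1
      + (c2 ^ 2 - 1) * q0 + s0 ^ 2 * q2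
  have e2 : (s3 * s4 * s2) ^ 2 = c0 ^ 2 + c2 ^ 2 + c4 ^ 2 + 2 * c0 * c2 * c4 - 1 := by
    linear_combination (c3 * (s2 * s4) + (c2 * c4 + c0)) * h3 - s2 ^ 2 * s4 ^ 2 * q3
      + (c4 ^ 2 - 1) * q2 + s2 ^ 2 * q4
  have e3 : s0 * s1 * s2 = s3 * s4 * s2 :=
    (sq_eq_sq₀ (by positivity) (by positivity)).1 (e1.trans e2.symm)
  exact mul_right_cancel₀ p2.ne' e3

/-- The law of sines. -/
lemma sine (h : IsHex l) (k : Fin 6) :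
    sinh (l k) * sinh (l (k + 1)) = sinh (l (k + 3)) * sinh (l (k + 4)) := by
  have h3 := h.law (k + 2)
  have e : k + 2 + 1 = k + 3 ∧ k + 2 + 2 = k + 4 ∧ k + 2 + 4 = k := by clear * -; revert k; decide
  rw [e.1, e.2.1, e.2.2] at h3
  exact sine_aux (h.sinh_pos _) (h.sinh_pos _) (h.sinh_pos (k + 2)) (h.sinh_pos _) (h.sinh_pos _)
    (cosh_sq _) (cosh_sq _) (cosh_sq _) (cosh_sq _) (cosh_sq _) (h.law k) h3

lemma law_even (h : IsHex l) (k : Fin 6) : cosh (l k) * (sinh (l (k + 5)) * sinh (l (k + 1))) =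
    cosh (l (k + 5)) * cosh (l (k + 1)) + cosh (l (k + 3)) := by
  have := h.law (k + 5)
  have e : k + 5 + 1 = k ∧ k + 5 + 2 = k + 1 ∧ k + 5 + 4 = k + 3 := by clear * -; revert k; decide
  rwa [e.1, e.2.1, e.2.2] at this

lemma law_odd (h : IsHex l) (k : Fin 6) : cosh (l (k + 3)) * (sinh (l (k + 2)) * sinh (l (k + 4))) =
    cosh (l (k + 2)) * cosh (l (k + 4)) + cosh (l k) := by
  have := h.law (k + 2)
  have e : k + 2 + 1 = k + 3 ∧ k + 2 + 2 = k + 4 ∧ k + 2 + 4 = k := by clear * -; revert k; decide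
  rwa [e.1, e.2.1, e.2.2] at this

lemma sine' (h : IsHex l) (k : Fin 6) :
    sinh (l (k + 1)) * sinh (l (k + 2)) = sinh (l (k + 4)) * sinh (l (k + 5)) := by
  have := h.sine (k + 1)
  have e : k + 1 + 1 = k + 2 ∧ k + 1 + 3 = k + 4 ∧ k + 1 + 4 = k + 5 := by clear * -; revert k; decide
  rwa [e.1, e.2.1, e.2.2] at this

/-- The two pentagons cut off by the arc from the side `k` to the opposite side determine the
side `k`. -/
lemma side_eq (h : IsHex l) (k : Fin 6) :
    cosh (l k) * ((sinh (l (k + 1)) * sinh (l (k + 2))) ^ 2 - 1) =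
      cosh (l (k + 1)) * cosh (l (k + 5)) * (sinh (l (k + 2)) * sinh (l (k + 4))) +
      cosh (l (k + 2)) * cosh (l (k + 4)) := by
  have h1 := h.law_even k
  have h2 := h.law_odd k
  have h3 := h.sine' k
  linear_combination sinh (l (k + 2)) * sinh (l (k + 4)) * h1 + h2 +
    cosh (l k) * (sinh (l (k + 1)) * sinh (l (k + 2))) * h3

/-- The right side of `side_eq` is positive. This makes the `arcosh` in `longLen` meaningful, and
later bounds `log (sinh (l k))` from below. -/
lemma one_lt_long (h : IsHex l) (k : Fin 6) : 1 < sinh (l (k + 1)) * sinh (l (k + 2)) := by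
  have h1 := h.side_eq k
  have p0 := cosh_pos (l k)
  have p1 := cosh_pos (l (k + 1))
  have p2 := cosh_pos (l (k + 2))
  have p4 := cosh_pos (l (k + 4))
  have p5 := cosh_pos (l (k + 5))
  have s1 := h.sinh_pos (k + 1)
  have s2 := h.sinh_pos (k + 2)
  have s4 := h.sinh_pos (k + 4)
  have h2 : 0 < cosh (l k) * ((sinh (l (k + 1)) * sinh (l (k + 2))) ^ 2 - 1) := by
    rw [h1]; positivity
  have h3 := pos_of_mul_pos_right h2 p0.le
  have h4 : 0 < sinh (l (k + 1)) * sinh (l (k + 2)) := by positivity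
  nlinarith

lemma cosh_longLen (h : IsHex l) (k : Fin 6) :
    cosh (longLen l k) = sinh (l (k + 1)) * sinh (l (k + 2)) :=
  cosh_arcosh (h.one_lt_long k).le

lemma longLen_pos (h : IsHex l) (k : Fin 6) : 0 < longLen l k := arcosh_pos (h.one_lt_long k)

lemma longLen_add_three (h : IsHex l) (k : Fin 6) : longLen l (k + 3) = longLen l k := by
  have e : k + 3 + 1 = k + 4 ∧ k + 3 + 2 = k + 5 := by clear * -; revert k; decide
  unfold longLen
  rw [e.1, e.2, h.sine' k]

lemma hexLen_pos (h : IsHex l) (e : ArcClass) : 0 < hexLen l e := by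
  unfold hexLen ArcClass.ev
  split_ifs
  exacts [h.longLen_pos _, h.pos _, h.pos _]

/-- After squaring, this is `1 ≤ (sinh (l (k + 1)) * sinh (l (k + 2))) ^ 2` and its analogue for the
other pentagon. -/
lemma cosh_le_sinh_mul (h : IsHex l) (k : Fin 6) :
    cosh (l (k + 2)) ≤ sinh (l (k + 2)) * cosh (l (k + 1)) ∧
    cosh (l (k + 4)) ≤ sinh (l (k + 4)) * cosh (l (k + 5)) := by
  have s1 := h.sinh_pos (k + 1)
  have s2 := h.sinh_pos (k + 2)
  have s4 := h.sinh_pos (k + 4)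
  have s5 := h.sinh_pos (k + 5)
  have C1 := h.one_lt_long k
  have C2 : 1 < sinh (l (k + 4)) * sinh (l (k + 5)) := h.sine' k ▸ C1
  constructor
  · refine le_of_sq_le_sq ?_ (mul_nonneg s2.le (cosh_pos _).le)
    rw [mul_pow, cosh_sq, cosh_sq]
    nlinarith
  · refine le_of_sq_le_sq ?_ (mul_nonneg s4.le (cosh_pos _).le)
    rw [mul_pow, cosh_sq, cosh_sq]
    nlinarith

/-- The side `k` is estimated by the lengths of the three arcs that end on it. -/
lemma side_bounds (h : IsHex l) (k : Fin 6) :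
    cosh (longLen l k) ^ 2 * cosh (l (k + 1)) * cosh (l (k + 5)) ≤
      cosh (l k) * (sinh (longLen l k) ^ 2 * sinh (l (k + 1)) * sinh (l (k + 5))) ∧
    cosh (l k) * (sinh (longLen l k) ^ 2 * sinh (l (k + 1)) * sinh (l (k + 5))) ≤
      2 * (cosh (longLen l k) ^ 2 * cosh (l (k + 1)) * cosh (l (k + 5))) := by
  have h1 := h.side_eq k
  have h2 := h.cosh_longLen k
  have h3 := h.sine' k
  have h4 : sinh (longLen l k) ^ 2 = (sinh (l (k + 1)) * sinh (l (k + 2))) ^ 2 - 1 := by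
    rw [sinh_sq, h2]
  obtain ⟨h5, h6⟩ := h.cosh_le_sinh_mul k
  have s1 := h.sinh_pos (k + 1)
  have s5 := h.sinh_pos (k + 5)
  have s2 := h.sinh_pos (k + 2)
  have p1 := cosh_pos (l (k + 2))
  have p2 := cosh_pos (l (k + 4))
  have p15 := mul_pos s1 s5
  have e1 : cosh (longLen l k) ^ 2 * cosh (l (k + 1)) * cosh (l (k + 5)) =
      (cosh (l (k + 1)) * cosh (l (k + 5)) * (sinh (l (k + 2)) * sinh (l (k + 4)))) *
        (sinh (l (k + 1)) * sinh (l (k + 5))) := by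
    rw [h2]
    linear_combination (sinh (l (k + 1)) * sinh (l (k + 2)) * cosh (l (k + 1)) *
      cosh (l (k + 5))) * h3
  have e2 : cosh (l k) * (sinh (longLen l k) ^ 2 * sinh (l (k + 1)) * sinh (l (k + 5))) =
      (cosh (l (k + 1)) * cosh (l (k + 5)) * (sinh (l (k + 2)) * sinh (l (k + 4))) +
      cosh (l (k + 2)) * cosh (l (k + 4))) * (sinh (l (k + 1)) * sinh (l (k + 5))) := by
    rw [h4, ← h1]; ring
  -- In `side_eq` the second summand is at most the first, so the sum is known up to a factor 2,
  -- which disappears after taking logarithms and rescaling.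
  have e3 : cosh (l (k + 2)) * cosh (l (k + 4)) ≤
      cosh (l (k + 1)) * cosh (l (k + 5)) * (sinh (l (k + 2)) * sinh (l (k + 4))) := by
    calc cosh (l (k + 2)) * cosh (l (k + 4)) ≤ (sinh (l (k + 2)) * cosh (l (k + 1))) *
        (sinh (l (k + 4)) * cosh (l (k + 5))) := mul_le_mul h5 h6 p2.le (p1.le.trans h5)
      _ = _ := by ring
  rw [e1, e2]
  constructor
  · refine mul_le_mul_of_nonneg_right ?_ p15.le
    have := mul_pos p1 p2
    linarith
  · rw [← mul_assoc 2]
    refine mul_le_mul_of_nonneg_right ?_ p15.le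
    linarith

/-- A hexagon is determined by three alternate sides. -/
lemma eq_of_alternate {l' : Fin 6 → ℝ} (h : IsHex l) (h' : IsHex l') {k : Fin 6}
    (h0 : l k = l' k) (h2 : l (k + 2) = l' (k + 2)) (h4 : l (k + 4) = l' (k + 4)) : l = l' := by
  have e : ∀ j : Fin 6, j + 2 + 2 = j + 4 ∧ j + 2 + 4 = j ∧ j + 4 + 2 = j ∧ j + 4 + 4 = j + 2 ∧
      ∀ i, i = j ∨ i = j + 2 ∨ i = j + 4 ∨ i = j + 1 ∨ i = j + 2 + 1 ∨ i = j + 4 + 1 := by decide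
  have key : ∀ j, l j = l' j → l (j + 2) = l' (j + 2) → l (j + 4) = l' (j + 4) →
      l (j + 1) = l' (j + 1) := by
    intro j e0 e2 e4
    have a := h.law j
    have b := h'.law j
    rw [e0, e2, e4] at a
    refine cosh_inj_of_pos (h.pos _) (h'.pos _) ?_
    exact mul_right_cancel₀ (mul_pos (h'.sinh_pos _) (h'.sinh_pos _)).ne' (a.trans b.symm)
  have h1 := key k h0 h2 h4
  have h3 := key (k + 2) h2 (by rw [(e k).1]; exact h4) (by rw [(e k).2.1]; exact h0)
  have h5 := key (k + 4) h4 (by rw [(e k).2.2.1]; exact h0) (by rw [(e k).2.2.2.1]; exact h2)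
  funext i
  rcases (e k).2.2.2.2 i with rfl | rfl | rfl | rfl | rfl | rfl
  exacts [h0, h2, h4, h1, h3, h5]

/-- A hexagon is determined by two pairs of adjacent sides. -/
lemma eq_of_pairs {l' : Fin 6 → ℝ} (h : IsHex l) (h' : IsHex l') {k : Fin 6}
    (h1 : l (k + 1) = l' (k + 1)) (h2 : l (k + 2) = l' (k + 2)) (h4 : l (k + 4) = l' (k + 4))
    (h5 : l (k + 5) = l' (k + 5)) : l = l' := by
  have a := h.side_eq k
  have b := h'.side_eq k
  rw [h1, h2, h4, h5] at a
  have C := h'.one_lt_long k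
  have h0 : l k = l' k := cosh_inj_of_pos (h.pos _) (h'.pos _)
    (mul_right_cancel₀ (sub_pos.2 (one_lt_pow₀ C two_ne_zero)).ne' (a.trans b.symm))
  exact eq_of_alternate h h' h0 h2 h4

end IsHex

lemma isHex_iff {l0 l1 l2 l3 l4 l5 : ℝ} : IsHex ![l0, l1, l2, l3, l4, l5] ↔
    (0 < l0 ∧ 0 < l1 ∧ 0 < l2 ∧ 0 < l3 ∧ 0 < l4 ∧ 0 < l5) ∧
    cosh l1 * (sinh l0 * sinh l2) = cosh l0 * cosh l2 + cosh l4 ∧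
    cosh l2 * (sinh l1 * sinh l3) = cosh l1 * cosh l3 + cosh l5 ∧
    cosh l3 * (sinh l2 * sinh l4) = cosh l2 * cosh l4 + cosh l0 ∧
    cosh l4 * (sinh l3 * sinh l5) = cosh l3 * cosh l5 + cosh l1 ∧
    cosh l5 * (sinh l4 * sinh l0) = cosh l4 * cosh l0 + cosh l2 ∧
    cosh l0 * (sinh l5 * sinh l1) = cosh l5 * cosh l1 + cosh l3 := by
  constructor
  · intro h
    exact ⟨⟨h.pos 0, h.pos 1, h.pos 2, h.pos 3, h.pos 4, h.pos 5⟩, h.law 0, h.law 1, h.law 2,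
      h.law 3, h.law 4, h.law 5⟩
  · rintro ⟨⟨p0, p1, p2, p3, p4, p5⟩, e0, e1, e2, e3, e4, e5⟩
    refine ⟨fun k => ?_, fun k => ?_⟩
    · fin_cases k
      exacts [p0, p1, p2, p3, p4, p5]
    · fin_cases k
      exacts [e0, e1, e2, e3, e4, e5]

/-- Multiplied by `T`, two of the six laws of cosines become polynomial identities in the four given
sides. Reflecting the hexagon gives the other four laws. -/
lemma pentagon_aux {c0 s0 c1 s1 c2 s2 c3 c4 s4 c5 s5 T : ℝ}
    (q1 : c1 ^ 2 = s1 ^ 2 + 1) (q2 : c2 ^ 2 = s2 ^ 2 + 1)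
    (hT : T = (s1 * s2) ^ 2 - 1) (hT0 : T ≠ 0) (h : s1 * s2 = s4 * s5)
    (hc0 : c0 * T = c1 * c5 * (s2 * s4) + c2 * c4) (hs0 : s0 * T = c2 * s4 * c5 + s2 * c1 * c4)
    (hc3 : c3 * T = c2 * c4 * (s1 * s5) + c1 * c5) :
    c1 * (s0 * s2) = c0 * c2 + c4 ∧ c3 * (s2 * s4) = c2 * c4 + c0 := by
  constructor
  · refine mul_right_cancel₀ hT0 ?_
    linear_combination c1 * s2 * hs0 - c2 * hc0 - c4 * hT + s2 ^ 2 * c4 * q1 - c4 * q2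
  · refine mul_right_cancel₀ hT0 ?_
    linear_combination s2 * s4 * hc3 - hc0 - c2 * c4 * hT - c2 * c4 * (s1 * s2) * h

/-- The numbers prescribed for `cosh x` and `sinh x` are the addition formulas for the sum of the
two segments into which the common perpendicular cuts the side. Their squares differ by one because
each segment contributes a factor `T`. -/
lemma pentagon_exists {c1 s1 c2 s2 c4 s4 c5 s5 T : ℝ}
    (p2 : 0 < s2) (p4 : 0 < s4)
    (r1 : 0 < c1) (r2 : 0 < c2) (r4 : 0 < c4) (r5 : 0 < c5)
    (q1 : c1 ^ 2 = s1 ^ 2 + 1) (q2 : c2 ^ 2 = s2 ^ 2 + 1) (q4 : c4 ^ 2 = s4 ^ 2 + 1)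
    (q5 : c5 ^ 2 = s5 ^ 2 + 1)
    (hT : T = (s1 * s2) ^ 2 - 1) (hT0 : 0 < T) (h : s1 * s2 = s4 * s5) :
    ∃ x, 0 < x ∧ cosh x * T = c1 * c5 * (s2 * s4) + c2 * c4 ∧
      sinh x * T = c2 * s4 * c5 + s2 * c1 * c4 := by
  obtain ⟨x, hx, hc, hs⟩ := exists_cosh_sinh (c := (c1 * c5 * (s2 * s4) + c2 * c4) / T)
    (s := (c2 * s4 * c5 + s2 * c1 * c4) / T) (by positivity) (by positivity) (by
      rw [div_pow, div_pow, ← sub_div, div_eq_one_iff_eq (by positivity)]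
      have e1 : s2 ^ 2 * c1 ^ 2 - c2 ^ 2 = T := by rw [q1, q2, hT]; ring
      have e2 : s4 ^ 2 * c5 ^ 2 - c4 ^ 2 = T := by rw [q4, q5, hT, h]; ring
      linear_combination (s4 ^ 2 * c5 ^ 2 - c4 ^ 2) * e1 + T * e2)
  exact ⟨x, hx, by rw [hc]; field_simp, by rw [hs]; field_simp⟩

/-- Two pentagons with a common side make up a hexagon. -/
lemma exists_isHex_of_pairs {l1 l2 l4 l5 : ℝ} (h1 : 0 < l1) (h2 : 0 < l2) (h4 : 0 < l4)
    (h5 : 0 < l5) (h : sinh l1 * sinh l2 = sinh l4 * sinh l5) (hC : 1 < sinh l1 * sinh l2) :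
    ∃ l0 l3, IsHex ![l0, l1, l2, l3, l4, l5] := by
  have p1 := sinh_pos_iff.2 h1
  have p2 := sinh_pos_iff.2 h2
  have p4 := sinh_pos_iff.2 h4
  have p5 := sinh_pos_iff.2 h5
  have hT0 : 0 < (sinh l1 * sinh l2) ^ 2 - 1 := sub_pos.2 (one_lt_pow₀ hC two_ne_zero)
  have hT' : (sinh l1 * sinh l2) ^ 2 - 1 = (sinh l2 * sinh l1) ^ 2 - 1 := by ring
  have hT'' : (sinh l1 * sinh l2) ^ 2 - 1 = (sinh l5 * sinh l4) ^ 2 - 1 := by rw [h]; ring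
  have hT3 : (sinh l1 * sinh l2) ^ 2 - 1 = (sinh l4 * sinh l5) ^ 2 - 1 := by rw [h]
  obtain ⟨l0, p0, hc0, hs0⟩ := pentagon_exists p2 p4 (cosh_pos l1) (cosh_pos l2)
    (cosh_pos l4) (cosh_pos l5) (cosh_sq _) (cosh_sq _) (cosh_sq _) (cosh_sq _) rfl hT0 h
  obtain ⟨l3, p3, hc3, hs3⟩ := pentagon_exists p1 p5 (cosh_pos l2) (cosh_pos l1)
    (cosh_pos l5) (cosh_pos l4) (cosh_sq _) (cosh_sq _) (cosh_sq _) (cosh_sq _) hT' hT0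
    (by linarith)
  have a := pentagon_aux (c3 := cosh l3) (cosh_sq l1) (cosh_sq l2) rfl hT0.ne' h hc0 hs0
    hc3
  have b := pentagon_aux (c3 := cosh l0) (cosh_sq l2) (cosh_sq l1) hT' hT0.ne' (by linarith)
    hc3 hs3 hc0
  have c := pentagon_aux (c0 := cosh l0) (s0 := sinh l0) (c3 := cosh l3) (c4 := cosh l2)
    (s4 := sinh l2) (c5 := cosh l1) (s5 := sinh l1)
    (cosh_sq l5) (cosh_sq l4) hT'' hT0.ne' (by linarith) (by rw [hc0]; ring) (by rw [hs0]; ring)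
    (by rw [hc3]; ring)
  have d := pentagon_aux (c0 := cosh l3) (s0 := sinh l3) (c3 := cosh l0) (c4 := cosh l1)
    (s4 := sinh l1) (c5 := cosh l2) (s5 := sinh l2)
    (cosh_sq l4) (cosh_sq l5) hT3 hT0.ne' (by linarith) (by rw [hc3]; ring) (by rw [hs3]; ring)
    (by rw [hc0]; ring)
  refine ⟨l0, l3, isHex_iff.2 ⟨⟨p0, h1, h2, p3, h4, h5⟩, a.1, ?_, a.2, ?_, ?_, ?_⟩⟩
  · linarith [b.1]
  · linarith [d.1]
  · linarith [c.1]
  · linarith [d.2]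

/-- If three sides are defined by the law of cosines from the alternate ones, their hyperbolic sines
have the common numerator `E`; substituting it gives the dual laws. -/
lemma triangle_aux {c0 s0 c1 s1 c2 s2 c4 s4 c5 s5 E : ℝ}
    (p0 : 0 < s0) (p2 : 0 < s2) (p4 : 0 < s4)
    (q0 : c0 ^ 2 = s0 ^ 2 + 1) (hE : E ^ 2 = c0 ^ 2 + c2 ^ 2 + c4 ^ 2 + 2 * c0 * c2 * c4 - 1)
    (hc1 : c1 * (s0 * s2) = c0 * c2 + c4) (hs1 : s1 * (s0 * s2) = E)
    (hc5 : c5 * (s4 * s0) = c4 * c0 + c2) (hs5 : s5 * (s4 * s0) = E) {c3 : ℝ}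
    (hc3 : c3 * (s2 * s4) = c2 * c4 + c0) : c0 * (s5 * s1) = c5 * c1 + c3 := by
  have hne : (s0 * s2) * (s4 * s0) ≠ 0 := by positivity
  refine mul_right_cancel₀ hne ?_
  have e1 : c0 * (s5 * s1) * (s0 * s2 * (s4 * s0)) = c0 * E ^ 2 := by
    rw [sq]; nth_rewrite 1 [← hs1]; rw [← hs5]; ring
  have e2 : (c5 * c1 + c3) * (s0 * s2 * (s4 * s0)) =
      (c0 * c2 + c4) * (c4 * c0 + c2) + (c0 ^ 2 - 1) * (c2 * c4 + c0) := by
    rw [← hc1, ← hc5, ← hc3, q0]; ring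
  rw [e1, e2, hE]; ring

/-- There are hexagons with any given alternate sides. -/
lemma exists_isHex_of_alternate {l0 l2 l4 : ℝ} (h0 : 0 < l0) (h2 : 0 < l2) (h4 : 0 < l4) :
    ∃ l1 l3 l5, IsHex ![l0, l1, l2, l3, l4, l5] := by
  have p0 := sinh_pos_iff.2 h0
  have p2 := sinh_pos_iff.2 h2
  have p4 := sinh_pos_iff.2 h4
  set D := cosh l0 ^ 2 + cosh l2 ^ 2 + cosh l4 ^ 2 + 2 * cosh l0 * cosh l2 * cosh l4 - 1 with hD
  have c0 := one_le_cosh l0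
  have c2 := one_le_cosh l2
  have c4 := one_le_cosh l4
  have hDpos : 0 < D := by
    have : 0 < 2 * cosh l0 * cosh l2 * cosh l4 := by positivity
    nlinarith
  have hE := sqrt_pos.2 hDpos
  have hE2 : √D ^ 2 = D := sq_sqrt hDpos.le
  -- The square of `cosh x * cosh y + cosh z` exceeds that of `sinh x * sinh y` by `D`, which is
  -- symmetric in the three sides.
  have key : ∀ x y z : ℝ, 0 < sinh x → 0 < sinh y →
      D = cosh x ^ 2 + cosh y ^ 2 + cosh z ^ 2 + 2 * cosh x * cosh y * cosh z - 1 →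
      ∃ w, 0 < w ∧ cosh w * (sinh x * sinh y) = cosh x * cosh y + cosh z ∧
        sinh w * (sinh x * sinh y) = √D := by
    intro x y z hx hy hxyz
    have := cosh_pos x
    have := cosh_pos y
    have := cosh_pos z
    obtain ⟨w, hw, hc, hs⟩ := exists_cosh_sinh
      (c := (cosh x * cosh y + cosh z) / (sinh x * sinh y)) (s := √D / (sinh x * sinh y))
      (by positivity) (by positivity) (by
        rw [div_pow, div_pow, ← sub_div, div_eq_one_iff_eq (by positivity), hE2, hxyz]
        rw [mul_pow, sinh_sq, sinh_sq]; ring)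
    exact ⟨w, hw, by rw [hc]; field_simp, by rw [hs]; field_simp⟩
  obtain ⟨l1, p1, hc1, hs1⟩ := key l0 l2 l4 p0 p2 (by rw [hD])
  obtain ⟨l3, p3, hc3, hs3⟩ := key l2 l4 l0 p2 p4 (by rw [hD]; ring)
  obtain ⟨l5, p5, hc5, hs5⟩ := key l4 l0 l2 p4 p0 (by rw [hD]; ring)
  refine ⟨l1, l3, l5, isHex_iff.2 ⟨⟨h0, p1, h2, p3, h4, p5⟩, hc1, ?_, hc3, ?_, hc5, ?_⟩⟩
  · exact triangle_aux p2 p4 p0 (cosh_sq _) (by rw [hE2, hD]; ring) hc3 hs3 hc1 hs1 hc5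
  · exact triangle_aux p4 p0 p2 (cosh_sq _) (by rw [hE2, hD]; ring) hc5 hs5 hc3 hs3 hc1
  · exact triangle_aux p0 p2 p4 (cosh_sq _) (by rw [hE2, hD]) hc1 hs1 hc5 hs5 hc3

/-- Both products are half sums of hyperbolic sines, of `x ± c * z` and of `c * x ± z`; the
arguments are compared termwise. It follows that `cosh z / sinh x` decreases strictly under scaling
by `c`. -/
lemma cosh_mul_sinh_lt {x z c : ℝ} (hc : 1 < c) (hx : 0 < x) (hz : 0 < z) (hzx : z ≤ x) :
    cosh (c * z) * sinh x < cosh z * sinh (c * x) := by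
  have h1 : sinh (x + c * z) ≤ sinh (c * x + z) := sinh_le_sinh.2 (by nlinarith)
  have h2 : sinh (x - c * z) < sinh (c * x - z) := sinh_lt_sinh.2 (by nlinarith)
  rw [sinh_add, sinh_add] at h1
  rw [sinh_sub, sinh_sub] at h2
  linarith

/-- Two hexagons with proportional sides are equal. -/
lemma IsHex.eq_one_of_smul {l : Fin 6 → ℝ} {c : ℝ} (h : IsHex l) (h' : IsHex (c • l)) :
    c = 1 := by
  have main : ∀ {l : Fin 6 → ℝ} {c : ℝ}, 1 < c → IsHex l → IsHex (c • l) → False := by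
    intro l c hc h h'
    -- Take `k + 4` to be the shortest of three alternate sides, so that `cosh_mul_sinh_lt` applies
    -- to `cosh (l (k + 4)) / sinh (l k)`.
    obtain ⟨k, hk0, hk2⟩ : ∃ k, l (k + 4) ≤ l k ∧ l (k + 4) ≤ l (k + 2) := by
      rcases le_total (l 0) (l 2) with h1 | h1 <;> rcases le_total (l 0) (l 4) with h2 | h2 <;>
        rcases le_total (l 2) (l 4) with h3 | h3
      · exact ⟨2, h1, h2⟩
      · exact ⟨2, h1, h2⟩
      · exact ⟨0, by simpa using h2, h1.trans' (by simpa using h2)⟩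
      · exact ⟨0, by simpa using h2, h3⟩
      · exact ⟨4, h3, h1⟩
      · exact ⟨0, by simpa using h3.trans h1, h3⟩
      · exact ⟨4, h3, h1⟩
      · exact ⟨0, by simpa using h2, h3⟩
    have a := h.law k
    have b := h'.law k
    simp only [Pi.smul_apply, smul_eq_mul] at b
    have p0 := h.pos k
    have p2 := h.pos (k + 2)
    have p1 := h.pos (k + 1)
    have p4 := h.pos (k + 4)
    -- The law expresses `cosh (l (k + 1))` by two quotients. Scaling up by `c` increases the left
    -- side and decreases the quotients.
    have i1 : cosh (l (k + 1)) < cosh (c * l (k + 1)) := by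
      rw [cosh_lt_cosh, abs_of_pos p1, abs_of_pos (by positivity)]
      nlinarith
    have i2 := cosh_mul_sinh_lt hc p0 p0 le_rfl
    have i3 := cosh_mul_sinh_lt hc p2 p2 le_rfl
    have i4 := cosh_mul_sinh_lt hc p0 p4 hk0
    have s0 := sinh_pos_iff.2 p0
    have s2 := sinh_pos_iff.2 p2
    have S0 : 0 < sinh (c * l k) := sinh_pos_iff.2 (by positivity)
    have S2 : 0 < sinh (c * l (k + 2)) := sinh_pos_iff.2 (by positivity)
    have i5 : sinh (l (k + 2)) < sinh (c * l (k + 2)) := sinh_lt_sinh.2 (by nlinarith)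
    have j1 : (cosh (c * l k) * sinh (l k)) * (cosh (c * l (k + 2)) * sinh (l (k + 2))) ≤
        (cosh (l k) * sinh (c * l k)) * (cosh (l (k + 2)) * sinh (c * l (k + 2))) :=
      mul_le_mul i2.le i3.le (mul_pos (cosh_pos _) s2).le (mul_pos (cosh_pos _) S0).le
    have j2 : (cosh (c * l (k + 4)) * sinh (l k)) * sinh (l (k + 2)) ≤
        (cosh (l (k + 4)) * sinh (c * l k)) * sinh (c * l (k + 2)) :=
      mul_le_mul i4.le i5.le s2.le (mul_pos (cosh_pos _) S0).le
    have j3 : cosh (l (k + 1)) * ((sinh (l k) * sinh (l (k + 2))) *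
        (sinh (c * l k) * sinh (c * l (k + 2)))) < cosh (c * l (k + 1)) *
        ((sinh (l k) * sinh (l (k + 2))) * (sinh (c * l k) * sinh (c * l (k + 2)))) :=
      mul_lt_mul_of_pos_right i1 (by positivity)
    have j4 : cosh (c * l (k + 1)) * ((sinh (l k) * sinh (l (k + 2))) *
        (sinh (c * l k) * sinh (c * l (k + 2)))) =
        (cosh (c * l k) * cosh (c * l (k + 2)) + cosh (c * l (k + 4))) *
          (sinh (l k) * sinh (l (k + 2))) := by rw [← b]; ring
    have j5 : cosh (l (k + 1)) * ((sinh (l k) * sinh (l (k + 2))) *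
        (sinh (c * l k) * sinh (c * l (k + 2)))) =
        (cosh (l k) * cosh (l (k + 2)) + cosh (l (k + 4))) *
          (sinh (c * l k) * sinh (c * l (k + 2))) := by rw [← a]; ring
    rw [j4, j5] at j3
    linarith
  have hc : 0 < c := by
    have := h'.pos 0
    exact pos_of_mul_pos_left this (h.pos 0).le
  rcases lt_trichotomy c 1 with h1 | h1 | h1
  · refine (main (c := c⁻¹) ((one_lt_inv₀ hc).2 h1) h' ?_).elim
    rwa [smul_smul, inv_mul_cancel₀ hc.ne', one_smul]
  · exact h1
  · exact (main h1 h h').elim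

end Hexagon
end

noncomputable section
namespace Hexagon

open Real

/-! ### The hyperboloid model -/

/-- The Lorentz form on `ℝ³`. -/
def lor (u v : ℝ × ℝ × ℝ) : ℝ := u.1 * v.1 + u.2.1 * v.2.1 - u.2.2 * v.2.2

/-- The vector product for the Lorentz form. -/
def lcross (u v : ℝ × ℝ × ℝ) : ℝ × ℝ × ℝ :=
  (u.2.1 * v.2.2 - u.2.2 * v.2.1, u.2.2 * v.1 - u.1 * v.2.2, u.2.1 * v.1 - u.1 * v.2.1)

lemma lor_comm (u v : ℝ × ℝ × ℝ) : lor u v = lor v u := by unfold lor; ring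

lemma lor_add_left (u v w : ℝ × ℝ × ℝ) : lor (u + v) w = lor u w + lor v w := by
  simp only [lor, Prod.fst_add, Prod.snd_add]; ring

lemma lor_smul_left (c : ℝ) (u v : ℝ × ℝ × ℝ) : lor (c • u) v = c * lor u v := by
  simp only [lor, Prod.smul_fst, Prod.smul_snd, smul_eq_mul]; ring

lemma lor_neg_left (u v : ℝ × ℝ × ℝ) : lor (-u) v = -lor u v := by
  simp only [lor, Prod.fst_neg, Prod.snd_neg]; ring

lemma lor_sub_left (u v w : ℝ × ℝ × ℝ) : lor (u - v) w = lor u w - lor v w := by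
  simp only [lor, Prod.fst_sub, Prod.snd_sub]; ring

lemma lor_add_right (u v w : ℝ × ℝ × ℝ) : lor w (u + v) = lor w u + lor w v := by
  simp only [lor, Prod.fst_add, Prod.snd_add]; ring

lemma lor_smul_right (c : ℝ) (u v : ℝ × ℝ × ℝ) : lor u (c • v) = c * lor u v := by
  simp only [lor, Prod.smul_fst, Prod.smul_snd, smul_eq_mul]; ring

lemma lor_neg_right (u v : ℝ × ℝ × ℝ) : lor u (-v) = -lor u v := by
  simp only [lor, Prod.fst_neg, Prod.snd_neg]; ring

lemma lor_sub_right (u v w : ℝ × ℝ × ℝ) : lor w (u - v) = lor w u - lor w v := by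
  simp only [lor, Prod.fst_sub, Prod.snd_sub]; ring

/-- The point of the hyperboloid. -/
def vec (z : UpperHalfPlane) : ℝ × ℝ × ℝ :=
  (z.re / z.im, (z.re ^ 2 + z.im ^ 2 - 1) / (2 * z.im), (z.re ^ 2 + z.im ^ 2 + 1) / (2 * z.im))

lemma lor_vec (z w : UpperHalfPlane) : lor (vec z) (vec w) = -cosh (dist z w) := by
  have hz := z.im_pos
  have hw := w.im_pos
  rw [UpperHalfPlane.cosh_dist, Complex.dist_eq, Complex.sq_norm, Complex.normSq_apply]
  simp only [Complex.sub_re, Complex.sub_im, UpperHalfPlane.coe_re, UpperHalfPlane.coe_im,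
    lor, vec]
  field_simp
  ring

lemma lor_vec_self (z : UpperHalfPlane) : lor (vec z) (vec z) = -1 := by
  rw [lor_vec, dist_self, cosh_zero]

lemma vec_pos (z : UpperHalfPlane) : 0 < (vec z).2.2 := by
  have hz := z.im_pos
  unfold vec
  positivity

lemma exists_vec {X : ℝ × ℝ × ℝ} (h : lor X X = -1) (h0 : 0 < X.2.2) : ∃ z, vec z = X := by
  obtain ⟨a, b, c⟩ := X
  simp only [lor] at h h0
  have hbc : 0 < c - b := by nlinarith
  refine ⟨⟨⟨a / (c - b), 1 / (c - b)⟩, by simpa using hbc⟩, ?_⟩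
  unfold vec
  have e1 : (UpperHalfPlane.mk ⟨a / (c - b), 1 / (c - b)⟩ (by simpa using hbc)).re =
    a / (c - b) := rfl
  have e2 : (UpperHalfPlane.mk ⟨a / (c - b), 1 / (c - b)⟩ (by simpa using hbc)).im =
    1 / (c - b) := rfl
  rw [e1, e2]
  refine Prod.ext ?_ (Prod.ext ?_ ?_)
  · simp only; field_simp
  · simp only; field_simp; linear_combination h
  · simp only; field_simp; linear_combination h

/-- The inner product of the tangent vectors at `z` directed to `w` and `w'`. -/
lemma re_dir_mul (z w w' : UpperHalfPlane) : ∃ r : ℝ, 0 < r ∧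
    ((starRingEnd ℂ) (dir z w) * dir z w').re =
      r * (lor (vec w) (vec w') + lor (vec z) (vec w) * lor (vec z) (vec w')) ∧
    ((starRingEnd ℂ) (dir z w) * dir z w').im =
      r * lor (lcross (vec z) (vec w)) (vec w') := by
  have hz := z.im_pos
  have hw := w.im_pos
  have hw' := w'.im_pos
  have key : ∀ w : UpperHalfPlane, ∃ r : ℝ, 0 < r ∧ dir z w =
      (r : ℂ) * ⟨(w.re - z.re) ^ 2 + w.im ^ 2 - z.im ^ 2, 2 * z.im * (z.re - w.re)⟩ := by
    intro w
    have hw := w.im_pos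
    have hD : 0 < (w.re - z.re) ^ 2 + (w.im + z.im) ^ 2 := by positivity
    obtain ⟨r, hr⟩ : ∃ r : ℝ, r * ((w.re - z.re) ^ 2 + (w.im + z.im) ^ 2) = 1 :=
      ⟨_, inv_mul_cancel₀ hD.ne'⟩
    refine ⟨r, pos_of_mul_pos_left (hr ▸ one_pos) hD.le, ?_⟩
    have hne : (w : ℂ) - (starRingEnd ℂ) (z : ℂ) ≠ 0 := by
      intro h
      have := congrArg Complex.im h
      simp at this
      linarith
    unfold dir
    rw [div_eq_iff hne]
    apply Complex.ext
    · simp only [Complex.sub_re, Complex.mul_re, Complex.ofReal_re, Complex.ofReal_im,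
        Complex.mul_im, Complex.sub_im, Complex.conj_re, Complex.conj_im, UpperHalfPlane.coe_re,
        UpperHalfPlane.coe_im]
      linear_combination (z.re - w.re) * hr
    · simp only [Complex.sub_re, Complex.mul_re, Complex.ofReal_re, Complex.ofReal_im,
        Complex.mul_im, Complex.sub_im, Complex.conj_re, Complex.conj_im, UpperHalfPlane.coe_re,
        UpperHalfPlane.coe_im]
      linear_combination (z.im - w.im) * hr
  obtain ⟨r, hr, hd⟩ := key w
  obtain ⟨r', hr', hd'⟩ := key w'
  refine ⟨r * r' * (4 * z.im ^ 2 * w.im * w'.im), by positivity, ?_, ?_⟩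
  · rw [hd, hd']
    simp only [map_mul, Complex.conj_ofReal, Complex.mul_re, Complex.mul_im, Complex.ofReal_re,
      Complex.ofReal_im, Complex.conj_re, Complex.conj_im, lor, vec]
    field_simp
    ring
  · rw [hd, hd']
    simp only [map_mul, Complex.conj_ofReal, Complex.mul_re, Complex.mul_im, Complex.ofReal_re,
      Complex.ofReal_im, Complex.conj_re, Complex.conj_im, lor, vec, lcross]
    field_simp
    ring

/-- The Lorentz form is positive definite on the orthogonal complement of a timelike vector. The
lemma serves to prove equality of vectors from their products. -/
lemma eq_zero_of_lor {Z U : ℝ × ℝ × ℝ} (hZ : lor Z Z = -1) (h1 : lor U Z = 0) (h2 : lor U U = 0) :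
    U = 0 := by
  obtain ⟨a, b, c⟩ := Z
  obtain ⟨x, y, z⟩ := U
  simp only [lor] at hZ h1 h2
  have h3 : z ^ 2 + (x * b - y * a) ^ 2 = 0 := by
    linear_combination (x ^ 2 + y ^ 2) * hZ - (x * a + y * b + z * c) * h1 + (c ^ 2 - 1) * h2
  have hz : z = 0 := by nlinarith [sq_nonneg z, sq_nonneg (x * b - y * a)]
  subst hz
  have hx : x = 0 := by nlinarith [sq_nonneg x, sq_nonneg y]
  have hy : y = 0 := by nlinarith [sq_nonneg x, sq_nonneg y]
  rw [hx, hy]; rfl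

/-- The points of a geodesic segment. -/
lemma vec_of_between {z w x : UpperHalfPlane} {d : ℝ} (hd : 0 < d) {T : ℝ × ℝ × ℝ}
    (hw : vec w = cosh d • vec z + sinh d • T) (hT : lor T T = 1) (hzT : lor (vec z) T = 0)
    (h : dist z x + dist x w = d) :
    vec x = cosh (dist z x) • vec z + sinh (dist z x) • T := by
  have e1 : dist x w = d - dist z x := by linarith
  have hxz : lor (vec x) (vec z) = -cosh (dist z x) := by rw [lor_vec, dist_comm]
  have hxT : lor (vec x) T = sinh (dist z x) := by
    have h1 : lor (vec x) (vec w) = -cosh (d - dist z x) := by rw [lor_vec, e1]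
    rw [hw, lor_add_right, lor_smul_right, lor_smul_right, hxz, cosh_sub] at h1
    have hs := sinh_pos_iff.2 hd
    refine mul_left_cancel₀ hs.ne' ?_
    linarith
  -- The products of `vec x` with `vec z` and `T` are those of the expected point, so the difference
  -- is null and orthogonal to `vec z`.
  have hU : vec x - (cosh (dist z x) • vec z + sinh (dist z x) • T) = 0 := by
    refine eq_zero_of_lor (lor_vec_self z) ?_ ?_
    · rw [lor_sub_left, lor_add_left, lor_smul_left, lor_smul_left, hxz, lor_vec_self,
        lor_comm T, hzT]
      ring
    · simp only [lor_sub_left, lor_sub_right, lor_add_left, lor_add_right, lor_smul_left,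
        lor_smul_right, lor_comm _ (vec x), hxz, hxT, hzT, hT, lor_vec_self, lor_comm T (vec z)]
      linear_combination cosh_sq (dist z x)
  exact sub_eq_zero.1 hU

lemma dist_eq_of_lor {z w : UpperHalfPlane} {d : ℝ} (hd : 0 ≤ d)
    (h : lor (vec z) (vec w) = -cosh d) : dist z w = d := by
  rw [lor_vec, neg_inj] at h
  exact cosh_strictMonoOn.injOn dist_nonneg hd h

lemma exists_between {z w : UpperHalfPlane} {d τ : ℝ} (h0 : 0 ≤ τ) (h1 : τ ≤ d) {T : ℝ × ℝ × ℝ}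
    (hw : vec w = cosh d • vec z + sinh d • T) (hT : lor T T = 1) (hzT : lor (vec z) T = 0) :
    ∃ x, dist z x + dist x w = dist z w ∧ vec x = cosh τ • vec z + sinh τ • T := by
  have hX : lor (cosh τ • vec z + sinh τ • T) (cosh τ • vec z + sinh τ • T) = -1 := by
    simp only [lor_add_left, lor_add_right, lor_smul_left, lor_smul_right, lor_vec_self, hzT, hT,
      lor_comm T (vec z)]
    linear_combination -cosh_sq_sub_sinh_sq τ
  have hpos : 0 < (cosh τ • vec z + sinh τ • T).2.2 := by
    -- The point is a combination of the two ends with nonnegative coefficients, so it stays on the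
    -- upper sheet.
    have e : sinh d * (cosh τ • vec z + sinh τ • T).2.2 =
        sinh (d - τ) * (vec z).2.2 + sinh τ * (vec w).2.2 := by
      rw [hw, sinh_sub]; simp; ring
    rcases h0.eq_or_lt with rfl | h0
    · simpa using vec_pos z
    · have s1 : 0 < sinh d := sinh_pos_iff.2 (h0.trans_le h1)
      have s2 : 0 ≤ sinh (d - τ) := sinh_nonneg_iff.2 (sub_nonneg.2 h1)
      have s3 : 0 < sinh τ := sinh_pos_iff.2 h0
      refine pos_of_mul_pos_right (b := _) (a := sinh d) ?_ s1.le
      rw [e]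
      have := mul_nonneg s2 (vec_pos z).le
      have := mul_pos s3 (vec_pos w)
      linarith
  obtain ⟨x, hx⟩ := exists_vec hX hpos
  refine ⟨x, ?_, hx⟩
  have d1 : dist z x = τ := dist_eq_of_lor h0 (by
    rw [hx, lor_add_right, lor_smul_right, lor_smul_right, lor_vec_self, hzT]; ring)
  have d2 : dist x w = d - τ := dist_eq_of_lor (sub_nonneg.2 h1) (by
    rw [hx, hw]
    simp only [lor_add_left, lor_add_right, lor_smul_left, lor_smul_right, lor_vec_self, hzT, hT,
      lor_comm T (vec z)]
    rw [cosh_sub]; ring)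
  have d3 : dist z w = d := dist_eq_of_lor (h0.trans h1) (by
    rw [hw, lor_add_right, lor_smul_right, lor_smul_right, lor_vec_self, hzT]; ring)
  rw [d1, d2, d3]; ring

/-- The right side is `(C - 1) * (cosh A * cosh B) + cosh (A - B)`. With `C` the hyperbolic cosine
of a common perpendicular, it is that of the distance of two points at signed distances `A`, `B`
from the feet. -/
lemma le_cosh_mul_cosh {C : ℝ} (hC : 1 ≤ C) (A B : ℝ) :
    C ≤ C * (cosh A * cosh B) - sinh A * sinh B := by
  have h1 : 1 ≤ cosh (A - B) := one_le_cosh _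
  have h2 : 1 ≤ cosh A * cosh B := one_le_mul_of_one_le_of_one_le (one_le_cosh A) (one_le_cosh B)
  rw [cosh_sub] at h1
  nlinarith

end Hexagon
end

/-! ### Vertices and normals of right hexagons, and the lengths of the sides. -/

noncomputable section
namespace Hexagon

open Real

lemma lcross_add_left (u v w : ℝ × ℝ × ℝ) : lcross (u + v) w = lcross u w + lcross v w := by
  simp only [lcross, Prod.fst_add, Prod.snd_add, Prod.mk_add_mk]
  refine Prod.ext ?_ (Prod.ext ?_ ?_) <;> simp only <;> ring

lemma lcross_smul_left (c : ℝ) (u v : ℝ × ℝ × ℝ) : lcross (c • u) v = c • lcross u v := by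
  simp only [lcross, Prod.smul_fst, Prod.smul_snd, smul_eq_mul, Prod.smul_mk]
  refine Prod.ext ?_ (Prod.ext ?_ ?_) <;> simp only <;> ring

lemma lcross_anticomm (u v : ℝ × ℝ × ℝ) : lcross u v = -lcross v u := by
  simp only [lcross, Prod.neg_mk]
  refine Prod.ext ?_ (Prod.ext ?_ ?_) <;> simp only <;> ring

lemma lcross_self (u : ℝ × ℝ × ℝ) : lcross u u = 0 := by
  simp only [lcross]
  refine Prod.ext ?_ (Prod.ext ?_ ?_) <;> simp <;> ring

lemma lcross_add_right (u v w : ℝ × ℝ × ℝ) : lcross w (u + v) = lcross w u + lcross w v := by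
  rw [lcross_anticomm, lcross_add_left, lcross_anticomm u, lcross_anticomm v]; abel

lemma lcross_smul_right (c : ℝ) (u v : ℝ × ℝ × ℝ) : lcross u (c • v) = c • lcross u v := by
  rw [lcross_anticomm, lcross_smul_left, lcross_anticomm v, smul_neg, neg_neg]

lemma lcross_neg_right (u v : ℝ × ℝ × ℝ) : lcross u (-v) = -lcross u v := by
  rw [← neg_one_smul ℝ v, lcross_smul_right, neg_one_smul]

lemma lor_lcross_left (u v : ℝ × ℝ × ℝ) : lor u (lcross u v) = 0 := by
  simp only [lor, lcross]; ring

lemma lor_lcross_right (u v : ℝ × ℝ × ℝ) : lor v (lcross u v) = 0 := by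
  simp only [lor, lcross]; ring

lemma lor_lcross_self (u v : ℝ × ℝ × ℝ) :
    lor (lcross u v) (lcross u v) = lor u v ^ 2 - lor u u * lor v v := by
  simp only [lor, lcross]; ring

lemma lcross_lcross (u v w : ℝ × ℝ × ℝ) :
    lcross u (lcross v w) = lor u v • w - lor u w • v := by
  simp only [lor, lcross]
  refine Prod.ext ?_ (Prod.ext ?_ ?_) <;> simp <;> ring

lemma lor_lcross_sq (u v w : ℝ × ℝ × ℝ) : lor (lcross u v) w ^ 2 =
    -(lor u u * lor v v * lor w w + 2 * lor u v * lor v w * lor u w - lor u u * lor v w ^ 2 -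
      lor v v * lor u w ^ 2 - lor w w * lor u v ^ 2) := by
  simp only [lor, lcross]; ring

/-- The vertices `X` of a right hexagon in the hyperboloid, and the inward unit normals `N` of its
sides. -/
structure IsFrame (l : Fin 6 → ℝ) (X N : Fin 6 → ℝ × ℝ × ℝ) : Prop where
  pos : ∀ i, 0 < l i
  step_X : ∀ i, X (i + 2) = cosh (l (i + 1)) • X (i + 1) + sinh (l (i + 1)) • N i
  step_N : ∀ i, N (i + 2) = -(sinh (l (i + 1)) • X (i + 1) + cosh (l (i + 1)) • N i)
  XX : ∀ i, lor (X i) (X i) = -1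
  NN : ∀ i, lor (N i) (N i) = 1
  XN : ∀ i, lor (X i) (N i) = 0
  X_succ_N : ∀ i, lor (X (i + 1)) (N i) = 0
  NN_succ : ∀ i, lor (N i) (N (i + 1)) = 0

namespace IsFrame

variable {l : Fin 6 → ℝ} {X N : Fin 6 → ℝ × ℝ × ℝ}

lemma back_X (h : IsFrame l X N) (i : Fin 6) :
    X (i + 1) = cosh (l (i + 1)) • X (i + 2) + sinh (l (i + 1)) • N (i + 2) := by
  have e : cosh (l (i + 1)) • X (i + 2) + sinh (l (i + 1)) • N (i + 2) =
      (cosh (l (i + 1)) ^ 2 - sinh (l (i + 1)) ^ 2) • X (i + 1) := by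
    rw [h.step_X, h.step_N]; module
  rw [e, cosh_sq_sub_sinh_sq, one_smul]

lemma N_X_two (h : IsFrame l X N) (i : Fin 6) : lor (N i) (X (i + 2)) = sinh (l (i + 1)) := by
  rw [h.step_X, lor_add_right, lor_smul_right, lor_smul_right, lor_comm, h.X_succ_N, h.NN]; ring

lemma step_X' (h : IsFrame l X N) (i : Fin 6) :
    X (i + 3) = cosh (l (i + 2)) • X (i + 2) + sinh (l (i + 2)) • N (i + 1) := by
  have := h.step_X (i + 1)
  simpa only [add_assoc, Fin.reduceAdd] using this

lemma N_X_three (h : IsFrame l X N) (i : Fin 6) :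
    lor (N i) (X (i + 3)) = sinh (l (i + 1)) * cosh (l (i + 2)) := by
  rw [h.step_X', lor_add_right, lor_smul_right, lor_smul_right, h.N_X_two, h.NN_succ]; ring

lemma N_two_X_one (h : IsFrame l X N) (i : Fin 6) :
    lor (N (i + 2)) (X (i + 1)) = sinh (l (i + 1)) := by
  have := h.X_succ_N
  rw [h.back_X, lor_add_right, lor_smul_right, lor_smul_right, lor_comm, h.XN, h.NN]; ring

lemma N_two_X (h : IsFrame l X N) (i : Fin 6) :
    lor (N (i + 2)) (X i) = sinh (l (i + 1)) * cosh (l i) := by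
  have h1 := h.back_X (i + 5)
  have h2 := h.NN_succ (i + 1)
  simp only [add_assoc, Fin.reduceAdd, add_zero] at h1 h2
  rw [h1, lor_add_right, lor_smul_right, lor_smul_right, h.N_two_X_one, lor_comm, h2]; ring

lemma NN_two (h : IsFrame l X N) (i : Fin 6) : lor (N i) (N (i + 2)) = -cosh (l (i + 1)) := by
  rw [h.step_N, lor_neg_right, lor_add_right, lor_smul_right, lor_smul_right, h.NN, lor_comm,
    h.X_succ_N]; ring

lemma NN_three (h : IsFrame l X N) (i : Fin 6) :
    lor (N i) (N (i + 3)) = -(sinh (l (i + 1)) * sinh (l (i + 2))) := by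
  have h1 := h.step_N (i + 1)
  simp only [add_assoc, Fin.reduceAdd] at h1
  rw [h1, lor_neg_right, lor_add_right, lor_smul_right, lor_smul_right, h.N_X_two, h.NN_succ]; ring

lemma NN_four (h : IsFrame l X N) (i : Fin 6) : lor (N i) (N (i + 4)) =
    cosh (l (i + 1)) * cosh (l (i + 3)) -
      cosh (l (i + 2)) * (sinh (l (i + 1)) * sinh (l (i + 3))) := by
  have h1 := h.step_N (i + 2)
  simp only [add_assoc, Fin.reduceAdd] at h1
  rw [h1, lor_neg_right, lor_add_right, lor_smul_right, lor_smul_right, h.N_X_three, h.NN_two]; ring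

lemma XX_one (h : IsFrame l X N) (i : Fin 6) : lor (X i) (X (i + 1)) = -cosh (l i) := by
  have h1 := h.step_X (i + 5)
  have h2 := h.X_succ_N (i + 5)
  simp only [add_assoc, Fin.reduceAdd, add_zero] at h1 h2
  rw [h1, lor_add_right, lor_smul_right, lor_smul_right, h.XX, h2]; ring

lemma XX_two (h : IsFrame l X N) (i : Fin 6) :
    lor (X i) (X (i + 2)) = -(cosh (l i) * cosh (l (i + 1))) := by
  rw [h.step_X, lor_add_right, lor_smul_right, lor_smul_right, h.XX_one, h.XN]; ring

lemma XX_three (h : IsFrame l X N) (i : Fin 6) : lor (X i) (X (i + 3)) =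
    -(cosh (l i) * cosh (l (i + 1)) * cosh (l (i + 2)) - sinh (l i) * sinh (l (i + 2))) := by
  have h1 := h.N_two_X_one (i + 5)
  simp only [add_assoc, Fin.reduceAdd, add_zero] at h1
  rw [h.step_X', lor_add_right, lor_smul_right, lor_smul_right, h.XX_two, lor_comm _ (N (i + 1)),
    h1]
  ring

/-- The law of cosines. -/
lemma isHex (h : IsFrame l X N) : IsHex l where
  pos := h.pos
  law k := by
    -- The product of the normals of the sides `k + 5` and `k + 3` is computed along the two ways
    -- around the boundary.
    have h1 := h.NN_four (k + 5)
    have h2 := h.NN_two (k + 3)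
    simp only [add_assoc, Fin.reduceAdd, add_zero] at h1 h2
    rw [lor_comm, h1] at h2
    linarith

end IsFrame

/-- The hypothesis on `lor P R` is the right angle at `Q`. It makes the side `Q R` start in the
direction of the normal of `P Q`, while the normal of `Q R` points back to `P`. -/
lemma normal_aux {P Q R : ℝ × ℝ × ℝ} {a b : ℝ} (ha : 0 < a) (hb : 0 < b)
    (hP : lor P P = -1) (hQ : lor Q Q = -1) (hR : lor R R = -1)
    (hPQ : lor P Q = -cosh a) (hQR : lor Q R = -cosh b) (hPR : lor P R = -(cosh a * cosh b))
    (hdet : 0 < lor (lcross P Q) R) :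
    R = cosh b • Q + sinh b • ((sinh a)⁻¹ • lcross P Q) ∧
    (sinh b)⁻¹ • lcross Q R = (sinh a)⁻¹ • (P - cosh a • Q) := by
  have sa := sinh_pos_iff.2 ha
  have sb := sinh_pos_iff.2 hb
  set M := (sinh a)⁻¹ • lcross P Q with hM
  -- The Gram matrix gives the determinant up to sign, and the orientation gives the sign.
  have hd : lor (lcross P Q) R = sinh a * sinh b := by
    rw [← sq_eq_sq₀ hdet.le (by positivity), lor_lcross_sq, hP, hQ, hR, hPQ, hQR, hPR, mul_pow,
      sinh_sq, sinh_sq]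
    ring
  have hMR : lor M R = sinh b := by rw [hM, lor_smul_left, hd]; field_simp
  have hMQ : lor M Q = 0 := by rw [hM, lor_smul_left, lor_comm, lor_lcross_right, mul_zero]
  have hMM : lor M M = 1 := by
    rw [hM, lor_smul_left, lor_smul_right, lor_lcross_self, hP, hQ, hPQ]
    field_simp
    linarith [cosh_sq a]
  have h1 : R = cosh b • Q + sinh b • M := by
    refine sub_eq_zero.1 (eq_zero_of_lor hQ ?_ ?_)
    · rw [lor_sub_left, lor_add_left, lor_smul_left, lor_smul_left, lor_comm R, hQR, hQ, hMQ]; ring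
    · simp only [lor_sub_left, lor_sub_right, lor_add_left, lor_add_right, lor_smul_left,
        lor_smul_right, lor_comm R, hQR, hMR, hQ, hMQ, hMM, lor_comm Q M, hR]
      linear_combination cosh_sq b
  refine ⟨h1, ?_⟩
  nth_rewrite 1 [h1]
  rw [lcross_add_right, lcross_smul_right, lcross_self, lcross_smul_right, smul_zero, zero_add,
    smul_smul, inv_mul_cancel₀ sb.ne', one_smul, hM, lcross_smul_right, lcross_lcross, hQ,
    lor_comm Q P, hPQ]
  congr 1
  module

namespace RightHexagon

/-- The lengths of the sides. -/
def sideLen (h : RightHexagon) (k : Fin 6) : ℝ := dist (h.v k) (h.v (k + 1))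

lemma det_pos (h : RightHexagon) {i j : Fin 6} (h1 : j ≠ i) (h2 : j ≠ i + 1) :
    0 < lor (lcross (vec (h.v i)) (vec (h.v (i + 1)))) (vec (h.v j)) := by
  obtain ⟨r, hr, -, him⟩ := re_dir_mul (h.v i) (h.v (i + 1)) (h.v j)
  have := h.convex i j h1 h2
  rw [him] at this
  exact pos_of_mul_pos_right this hr.le

/-- If two consecutive vertices coincided, the determinant in the convexity condition would vanish.
-/
lemma sideLen_pos (h : RightHexagon) (k : Fin 6) : 0 < h.sideLen k := by
  refine dist_pos.2 fun he => ?_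
  have := h.det_pos (i := k) (j := k + 2) (by clear * -; revert k; decide) (by clear * -; revert k; decide)
  rw [← he, lcross_self] at this
  simp [lor] at this

/-- The hyperbolic theorem of Pythagoras at the vertex `i + 1`. -/
lemma lor_vertices (h : RightHexagon) (i : Fin 6) :
    lor (vec (h.v i)) (vec (h.v (i + 2))) = -(cosh (h.sideLen i) * cosh (h.sideLen (i + 1))) := by
  have ha := h.right_angle (i + 1)
  rw [← InnerProductGeometry.inner_eq_zero_iff_angle_eq_pi_div_two] at ha
  obtain ⟨r, hr, hre, -⟩ := re_dir_mul (h.v (i + 1)) (h.v (i + 1 - 1)) (h.v (i + 1 + 1))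
  have hz : ((starRingEnd ℂ) (dir (h.v (i + 1)) (h.v (i + 1 - 1))) *
      dir (h.v (i + 1)) (h.v (i + 1 + 1))).re = 0 := by
    rw [← ha, Complex.inner, mul_comm]
  rw [hz, eq_comm, mul_eq_zero, or_iff_right hr.ne'] at hre
  have e : i + 1 - 1 = i ∧ i + 1 + 1 = i + 2 := by clear * -; revert i; decide
  rw [e.1, e.2, lor_comm (vec (h.v (i + 1))) (vec (h.v i)), lor_vec (h.v i) (h.v (i + 1)),
    lor_vec (h.v (i + 1))] at hre
  have e2 : h.sideLen (i + 1) = dist (h.v (i + 1)) (h.v (i + 2)) := by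
    unfold sideLen; rw [e.2]
  rw [e2]
  unfold sideLen
  linarith

/-- The inward unit normals of the sides. -/
def normal (h : RightHexagon) (i : Fin 6) : ℝ × ℝ × ℝ :=
  (sinh (h.sideLen i))⁻¹ • lcross (vec (h.v i)) (vec (h.v (i + 1)))

lemma isFrame (h : RightHexagon) : IsFrame h.sideLen (fun i => vec (h.v i)) h.normal := by
  have e : ∀ i : Fin 6, i + 1 + 1 = i + 2 ∧ i + 1 + 2 = i + 3 ∧ i + 2 + 1 = i + 3 := by decide
  have key := fun i => normal_aux (h.sideLen_pos i) (h.sideLen_pos (i + 1)) (lor_vec_self (h.v i))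
    (lor_vec_self (h.v (i + 1))) (lor_vec_self (h.v (i + 2))) (lor_vec _ _)
    (by rw [lor_vec, ← (e i).1]; rfl) (h.lor_vertices i)
    (h.det_pos (by clear * -; revert i; decide) (by clear * -; revert i; decide))
  have hN : ∀ i, h.normal (i + 1) = (sinh (h.sideLen i))⁻¹ •
      (vec (h.v i) - cosh (h.sideLen i) • vec (h.v (i + 1))) := by
    intro i
    rw [← (key i).2, ← (e i).1]; rfl
  have hs : ∀ i, sinh (h.sideLen i) ≠ 0 := fun i => (sinh_pos_iff.2 (h.sideLen_pos i)).ne'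
  refine ⟨h.sideLen_pos, fun i => (key i).1, fun i => ?_, fun i => lor_vec_self _, fun i => ?_,
    fun i => ?_, fun i => ?_, fun i => ?_⟩
  · have h1 : vec (h.v (i + 2)) = cosh (h.sideLen (i + 1)) • vec (h.v (i + 1)) +
      sinh (h.sideLen (i + 1)) • h.normal i := (key i).1
    have h2 := hN (i + 1)
    simp only [(e i).1] at h2
    rw [h2, h1]
    have : (sinh (h.sideLen (i + 1)))⁻¹ • (vec (h.v (i + 1)) - cosh (h.sideLen (i + 1)) •
        (cosh (h.sideLen (i + 1)) • vec (h.v (i + 1)) + sinh (h.sideLen (i + 1)) • h.normal i)) =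
        ((sinh (h.sideLen (i + 1)))⁻¹ * (1 - cosh (h.sideLen (i + 1)) ^ 2)) • vec (h.v (i + 1)) -
        ((sinh (h.sideLen (i + 1)))⁻¹ * sinh (h.sideLen (i + 1))) •
          (cosh (h.sideLen (i + 1)) • h.normal i) := by module
    rw [this, inv_mul_cancel₀ (hs _), cosh_sq, one_smul]
    have h3 : (sinh (h.sideLen (i + 1)))⁻¹ * (1 - (sinh (h.sideLen (i + 1)) ^ 2 + 1)) =
        -sinh (h.sideLen (i + 1)) := by
      have := hs (i + 1)
      field_simp; ring
    rw [h3]; module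
  · unfold normal
    rw [lor_smul_left, lor_smul_right, lor_lcross_self, lor_vec_self, lor_vec_self, lor_vec]
    have := hs i
    have e1 := cosh_sq (h.sideLen i)
    unfold sideLen at *
    field_simp
    linarith
  · unfold normal
    rw [lor_smul_right, lor_lcross_left, mul_zero]
  · unfold normal
    rw [lor_smul_right, lor_lcross_right, mul_zero]
  · rw [hN, lor_smul_right, lor_sub_right, lor_smul_right]
    unfold normal
    rw [lor_smul_left, lor_smul_left, lor_comm _ (vec (h.v i)), lor_comm _ (vec (h.v (i + 1))),
      lor_lcross_left, lor_lcross_right]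
    ring

lemma isHex_sideLen (h : RightHexagon) : IsHex h.sideLen := h.isFrame.isHex

lemma exists_vec_eq_of_mem_side (h : RightHexagon) {k : Fin 6} {x : UpperHalfPlane}
    (hx : x ∈ h.side (k + 1)) :
    ∃ τ, 0 ≤ τ ∧ vec x = cosh τ • vec (h.v (k + 1)) + sinh τ • h.normal k := by
  have e : k + 1 + 1 = k + 2 := by clear * -; revert k; decide
  refine ⟨_, dist_nonneg, vec_of_between (h.sideLen_pos (k + 1)) ?_ (h.isFrame.NN k)
    (h.isFrame.X_succ_N k) hx⟩
  rw [e]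
  exact h.isFrame.step_X k

/-- The same side is also needed parametrized backwards from its end, where the initial direction is
the normal of the next side. -/
lemma exists_vec_eq_of_mem_side' (h : RightHexagon) {k : Fin 6} {x : UpperHalfPlane}
    (hx : x ∈ h.side (k + 1)) :
    ∃ τ, 0 ≤ τ ∧ vec x = cosh τ • vec (h.v (k + 2)) + sinh τ • h.normal (k + 2) := by
  have e : k + 1 + 1 = k + 2 := by clear * -; revert k; decide
  have hx : dist (h.v (k + 1)) x + dist x (h.v (k + 1 + 1)) = h.sideLen (k + 1) := hx
  rw [e] at hx
  refine ⟨_, dist_nonneg, vec_of_between (h.sideLen_pos (k + 1)) (h.isFrame.back_X k)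
    (h.isFrame.NN _) (h.isFrame.XN _) (by rw [dist_comm, add_comm, dist_comm x]; exact hx)⟩

lemma left_mem_side (h : RightHexagon) (k : Fin 6) : h.v k ∈ h.side k := by
  change dist _ _ + dist _ _ = _
  simp

lemma right_mem_side (h : RightHexagon) (k : Fin 6) : h.v (k + 1) ∈ h.side k := by
  change dist _ _ + dist _ _ = _
  simp

lemma length_eq (h : RightHexagon) {e : ArcClass} {L : ℝ} (hL : 0 ≤ L)
    (hmem : ∃ x ∈ h.side e.s, ∃ y ∈ h.side e.t, L = dist x y)
    (hle : ∀ x ∈ h.side e.s, ∀ y ∈ h.side e.t, cosh L ≤ -lor (vec x) (vec y)) :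
    h.length e = L := by
  refine IsLeast.csInf_eq ⟨hmem, ?_⟩
  rintro _ ⟨x, hx, y, hy, rfl⟩
  have := hle x hx y hy
  rw [lor_vec, neg_neg, cosh_le_cosh, abs_of_nonneg hL, abs_of_nonneg dist_nonneg] at this
  exact this

/-- The side is the common perpendicular of its neighbours. With both neighbours parametrized from
its ends, `le_cosh_mul_cosh` is the minimality. -/
lemma length_side (h : RightHexagon) (k : Fin 6) : h.length (ArcClass.side k) = h.sideLen k := by
  obtain ⟨j, rfl⟩ : ∃ j, k = j + 2 := ⟨k - 2, (sub_add_cancel k 2).symm⟩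
  have e : j + 2 - 1 = j + 1 ∧ j + 1 + 1 = j + 2 ∧ j + 2 + 1 = j + 3 := by revert j; decide
  refine h.length_eq dist_nonneg ⟨h.v (j + 2), ?_, h.v (j + 2 + 1), h.left_mem_side _, rfl⟩ ?_
  · have := h.right_mem_side (j + 1)
    rw [e.2.1] at this
    change _ ∈ h.side (j + 2 - 1)
    rw [e.1]
    exact this
  · intro x hx y hy
    change x ∈ h.side (j + 2 - 1) at hx
    change y ∈ h.side (j + 2 + 1) at hy
    rw [e.1] at hx
    obtain ⟨τ, -, hx⟩ := h.exists_vec_eq_of_mem_side' hx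
    obtain ⟨σ, -, hy⟩ := h.exists_vec_eq_of_mem_side hy
    have h1 : lor (vec (h.v (j + 2))) (vec (h.v (j + 2 + 1))) = -cosh (h.sideLen (j + 2)) :=
      h.isFrame.XX_one (j + 2)
    have h2 : lor (vec (h.v (j + 2))) (h.normal (j + 2)) = 0 := h.isFrame.XN (j + 2)
    have h3 : lor (vec (h.v (j + 2 + 1))) (h.normal (j + 2)) = 0 := h.isFrame.X_succ_N (j + 2)
    have h4 := h.isFrame.NN (j + 2)
    have := le_cosh_mul_cosh (one_le_cosh (h.sideLen (j + 2))) τ σ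
    rw [hx, hy]
    simp only [lor_add_left, lor_add_right, lor_smul_left, lor_smul_right, h1, h2, h4,
      lor_comm (h.normal (j + 2)), h3]
    linarith

end RightHexagon
end Hexagon
end

/-! ### The distance of opposite sides of a right hexagon. -/

noncomputable section
namespace Hexagon

open Real

namespace IsHex

variable {l : Fin 6 → ℝ}

/-- Together with `side_eq`, these are the addition formulas for the two segments into which the
foot of the common perpendicular divides the side `k`. -/
lemma sinh_side_eq (h : IsHex l) (k : Fin 6) :
    sinh (l k) * ((sinh (l (k + 1)) * sinh (l (k + 2))) ^ 2 - 1) =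
      cosh (l (k + 2)) * sinh (l (k + 4)) * cosh (l (k + 5)) +
      sinh (l (k + 2)) * cosh (l (k + 1)) * cosh (l (k + 4)) := by
  have h1 := h.side_eq k
  have h2 := h.law k
  have hne : cosh (l (k + 1)) * sinh (l (k + 2)) ≠ 0 :=
    (mul_pos (cosh_pos _) (h.sinh_pos _)).ne'
  refine mul_right_cancel₀ hne ?_
  linear_combination ((sinh (l (k + 1)) * sinh (l (k + 2))) ^ 2 - 1) * h2 +
    cosh (l (k + 2)) * h1 - sinh (l (k + 2)) ^ 2 * cosh (l (k + 4)) * cosh_sq (l (k + 1)) +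
    cosh (l (k + 4)) * cosh_sq (l (k + 2))

/-- The foot on the side `k` of the common perpendicular with the opposite side. -/
lemma exists_foot (h : IsHex l) (k : Fin 6) : ∃ t, 0 ≤ t ∧ t ≤ l k ∧
    sinh t * sinh (longLen l k) = cosh (l (k + 4)) ∧
    cosh t * sinh (longLen l k) = sinh (l (k + 4)) * cosh (l (k + 5)) := by
  have hS := sinh_pos_iff.2 (h.longLen_pos k)
  have hS2 : sinh (longLen l k) ^ 2 = (sinh (l (k + 1)) * sinh (l (k + 2))) ^ 2 - 1 := by
    rw [sinh_sq, h.cosh_longLen]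
  have p1 := cosh_pos (l (k + 1))
  have p2 := cosh_pos (l (k + 2))
  have p4 := cosh_pos (l (k + 4))
  have p5 := cosh_pos (l (k + 5))
  have s2 := h.sinh_pos (k + 2)
  have s4 := h.sinh_pos (k + 4)
  obtain ⟨t, ht, hc, hs⟩ := exists_cosh_sinh
    (c := sinh (l (k + 4)) * cosh (l (k + 5)) / sinh (longLen l k))
    (s := cosh (l (k + 4)) / sinh (longLen l k)) (by positivity) (by positivity) (by
      rw [div_pow, div_pow, ← sub_div, div_eq_one_iff_eq (by positivity), hS2, mul_pow, cosh_sq,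
        cosh_sq, h.sine' k]
      ring)
  refine ⟨t, ht.le, ?_, by rw [hs]; field_simp, by rw [hc]; field_simp⟩
  rw [← sinh_le_sinh, hs, div_le_iff₀ hS]
  refine le_of_mul_le_mul_right ?_ hS
  have h1 := h.sinh_side_eq k
  rw [← hS2] at h1
  -- This estimate of one term of `sinh_side_eq` shows that the foot does not lie beyond the end of
  -- the side.
  have h2 : sinh (longLen l k) ≤ sinh (l (k + 2)) * cosh (l (k + 1)) := by
    refine le_of_sq_le_sq ?_ (by positivity)
    rw [hS2, mul_pow, mul_pow, cosh_sq]
    nlinarith [sq_nonneg (sinh (l (k + 2)))]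
  have h3 : cosh (l (k + 4)) * sinh (longLen l k) ≤
      cosh (l (k + 4)) * (sinh (l (k + 2)) * cosh (l (k + 1))) := by gcongr
  have h4 : 0 < cosh (l (k + 2)) * sinh (l (k + 4)) * cosh (l (k + 5)) := by positivity
  nlinarith

end IsHex

/-- These are the four coefficients in the change of origin from the vertices to the feet `t`, `u`
of the common perpendicular. Multiplying by `S ^ 2` clears the denominators. -/
lemma long_form_aux {c0 s0 c1 s1 c2 s2 c3 c4 s4 c5 s5 S C ct st cu su : ℝ} (hS : 0 < S)
    (q1 : c1 ^ 2 = s1 ^ 2 + 1) (q2 : c2 ^ 2 = s2 ^ 2 + 1)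
    (hC : C = s1 * s2) (hC' : C = s4 * s5) (hT : S ^ 2 = (s1 * s2) ^ 2 - 1)
    (hc0 : c0 * ((s1 * s2) ^ 2 - 1) = c1 * c5 * (s2 * s4) + c2 * c4)
    (hs0 : s0 * ((s1 * s2) ^ 2 - 1) = c2 * s4 * c5 + s2 * c1 * c4)
    (hc3 : c3 * ((s4 * s5) ^ 2 - 1) = c4 * c2 * (s5 * s1) + c5 * c1)
    (ht : st * S = c4) (ht' : ct * S = s4 * c5) (hu : su * S = c1) (hu' : cu * S = s1 * c2) :
    C * (ct * cu) + st * su = c0 * c1 * c2 - s0 * s2 ∧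
    C * (st * cu) + ct * su = s4 * c3 ∧
    C * (ct * su) + st * cu = s1 * c0 ∧
    C * (st * su) + ct * cu = s0 * s1 := by
  have hne : S ^ 2 ≠ 0 := by positivity
  rw [← hC'] at hc3
  rw [← hC] at hT hc0 hs0
  rw [← hT] at hc0 hs0 hc3
  have e1 : (ct * cu) * S ^ 2 = s4 * c5 * (s1 * c2) := by rw [← ht', ← hu']; ring
  have e2 : (st * su) * S ^ 2 = c4 * c1 := by rw [← ht, ← hu]; ring
  have e3 : (st * cu) * S ^ 2 = c4 * (s1 * c2) := by rw [← ht, ← hu']; ring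
  have e4 : (ct * su) * S ^ 2 = s4 * c5 * c1 := by rw [← ht', ← hu]; ring
  refine ⟨?_, ?_, ?_, ?_⟩ <;> refine mul_right_cancel₀ hne ?_
  · linear_combination C * e1 + e2 - c1 * c2 * hc0 + s2 * hs0 - c2 * c5 * s2 * s4 * q1
      - c1 * c4 * q2 + s4 * c5 * s1 * c2 * hC
  · linear_combination C * e3 + e4 - s4 * hc3 + c4 * c2 * s1 * hC'
  · linear_combination C * e4 + e3 - s1 * hc0 + s4 * c5 * c1 * hC
  · linear_combination C * e2 + e1 - s1 * hs0 + c4 * c1 * hC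

namespace RightHexagon

lemma length_long (h : RightHexagon) (k : Fin 6) :
    h.length (ArcClass.long k) = longLen h.sideLen k := by
  obtain ⟨j, rfl⟩ : ∃ j, k = j + 1 := ⟨k - 1, (sub_add_cancel k 1).symm⟩
  set l := h.sideLen with hl
  have hx := h.isHex_sideLen
  rw [← hl] at hx
  obtain ⟨t, t0, t1, ht, ht'⟩ := hx.exists_foot (j + 1)
  obtain ⟨u, u0, u1, hu, hu'⟩ := hx.exists_foot (j + 1 + 3)
  rw [hx.longLen_add_three] at hu hu'
  have hS := sinh_pos_iff.2 (hx.longLen_pos (j + 1))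
  have hC := hx.cosh_longLen (j + 1)
  have hC' := hx.sine' (j + 1)
  have hc0 := hx.side_eq (j + 1)
  have hs0 := hx.sinh_side_eq (j + 1)
  have hc3 := hx.side_eq (j + 1 + 3)
  have hT : sinh (longLen l (j + 1)) ^ 2 =
    (sinh (l (j + 1 + 1)) * sinh (l (j + 1 + 2))) ^ 2 - 1 := by rw [sinh_sq, hC]
  simp only [add_assoc, Fin.reduceAdd, add_zero] at t1 ht ht' u1 hu hu' hC hC' hc0 hs0 hc3 hT
  obtain ⟨m1, m2, m3, m4⟩ := long_form_aux hS (cosh_sq (l (j + 2))) (cosh_sq (l (j + 3)))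
    hC (hC.trans hC') hT hc0 hs0 hc3 ht ht' hu hu'
  -- For moving points on the two opposite sides, the form takes the shape of `le_cosh_mul_cosh`
  -- centred at the feet. The minimum is therefore attained there, and the feet lie on the sides.
  have hf : ∀ τ σ, -lor (cosh τ • vec (h.v (j + 1)) + sinh τ • h.normal j)
      (cosh σ • vec (h.v (j + 3 + 1)) + sinh σ • h.normal (j + 3)) =
      cosh (longLen l (j + 1)) * (cosh (τ - t) * cosh (u - σ)) - sinh (τ - t) * sinh (u - σ) := by
    intro τ σ
    have hF := h.isFrame
    have f1 := hF.XX_three (j + 1)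
    have f2 := hF.NN_three j
    have f3 := hF.N_X_three (j + 1 + 3 + 2)
    have f4 := hF.N_two_X (j + 1)
    have f5 := hF.N_two_X (j + 4)
    simp only [add_assoc, Fin.reduceAdd, add_zero, ← hl] at f1 f2 f4 f5
    have f4' : lor (vec (h.v (j + 1))) (h.normal (j + 3)) = sinh (l (j + 2)) * cosh (l (j + 1)) :=
      by rw [lor_comm]; exact f4
    simp only [add_assoc, Fin.reduceAdd, lor_add_left, lor_add_right, lor_smul_left,
      lor_smul_right, f1, f2, f4', f5, cosh_sub, sinh_sub]
    linear_combination (-cosh τ * cosh σ) * m1 + sinh τ * cosh σ * m2 + cosh τ * sinh σ * m3 -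
      sinh τ * sinh σ * m4
  have hCle : 1 ≤ cosh (longLen l (j + 1)) := one_le_cosh _
  have e : ∀ j : Fin 6, j + 1 + 3 = j + 3 + 1 ∧ j + 1 + 1 = j + 2 ∧ j + 3 + 2 = j + 3 + 1 + 1 ∧
    j + 4 = j + 3 + 1 := by decide
  refine h.length_eq (hx.longLen_pos _).le ?_ ?_
  · obtain ⟨x, hx1, hx2⟩ := exists_between (z := h.v (j + 1)) (w := h.v (j + 2)) t0 t1
      (h.isFrame.step_X j) (h.isFrame.NN j) (h.isFrame.X_succ_N j)
    have u1' : u ≤ l (j + 3 + 1) := by rw [← (e j).2.2.2]; exact u1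
    obtain ⟨y, hy1, hy2⟩ := exists_between (z := h.v (j + 3 + 1)) (w := h.v (j + 3 + 2)) u0 u1'
      (h.isFrame.step_X (j + 3)) (h.isFrame.NN _) (h.isFrame.X_succ_N _)
    refine ⟨x, ?_, y, ?_, ?_⟩
    · change dist (h.v (j + 1)) x + dist x (h.v (j + 1 + 1)) = dist (h.v (j + 1)) (h.v (j + 1 + 1))
      rw [(e j).2.1]; exact hx1
    · change y ∈ h.side (j + 1 + 3)
      rw [(e j).1]
      change dist _ y + dist y (h.v (j + 3 + 1 + 1)) = dist _ (h.v (j + 3 + 1 + 1))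
      rw [← (e j).2.2.1]; exact hy1
    · refine (dist_eq_of_lor (hx.longLen_pos _).le ?_).symm
      have := hf t u
      rw [hx2, hy2]
      simp only [sub_self, cosh_zero, sinh_zero] at this
      linarith
  · intro x hx y hy
    change y ∈ h.side (j + 1 + 3) at hy
    rw [(e j).1] at hy
    obtain ⟨τ, -, hx⟩ := h.exists_vec_eq_of_mem_side hx
    obtain ⟨σ, -, hy⟩ := h.exists_vec_eq_of_mem_side hy
    rw [hx, hy, hf]
    exact le_cosh_mul_cosh hCle _ _

lemma length_congr (h : RightHexagon) {e f : ArcClass} (hef : e.Same f) :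
    h.length e = h.length f := by
  unfold length
  rcases hef with ⟨h1, h2⟩ | ⟨h1, h2⟩ <;> rw [h1, h2]
  congr 1
  ext r
  constructor <;> rintro ⟨x, hx, y, hy, rfl⟩ <;> exact ⟨y, hy, x, hx, dist_comm _ _⟩

lemma lengthVec_eq (h : RightHexagon) : h.lengthVec = h.sideLen := funext h.length_side

lemma isHex (h : RightHexagon) : IsHex h.lengthVec := by
  rw [lengthVec_eq]; exact h.isHex_sideLen

/-- All lengths are given by those of the sides. -/
theorem length_eq_hexLen (h : RightHexagon) (e : ArcClass) : h.length e = hexLen h.lengthVec e := by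
  rw [lengthVec_eq]
  unfold hexLen
  rcases e.ev_cases with ⟨k, hk, hev⟩ | ⟨k, hk, hev⟩ <;> rw [hev, h.length_congr hk]
  · exact h.length_side k
  · exact h.length_long k

end RightHexagon

/-! ### Realization of the side lengths -/

namespace IsHex

variable {l : Fin 6 → ℝ}

/-- With `diag'` and `diag_cosh`, these closing relations match the coordinates obtained by walking
from one vertex around the boundary in the two directions. -/
lemma diag (h : IsHex l) (k : Fin 6) :
    cosh (l (k + 2)) * cosh (l (k + 1)) * sinh (l k) - sinh (l (k + 2)) * cosh (l k) =
      cosh (l (k + 3)) * sinh (l (k + 4)) := by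
  have h1 := h.law k
  have h2 := h.law_odd k
  refine mul_right_cancel₀ (h.sinh_pos (k + 2)).ne' ?_
  linear_combination cosh (l (k + 2)) * h1 - h2 + cosh (l k) * cosh_sq (l (k + 2))

lemma diag' (h : IsHex l) (k : Fin 6) :
    sinh (l (k + 2)) * cosh (l (k + 1)) * cosh (l k) - cosh (l (k + 2)) * sinh (l k) =
      sinh (l (k + 4)) * cosh (l (k + 5)) := by
  have h1 := h.law k
  have h2 := h.law (k + 4)
  simp only [add_assoc, Fin.reduceAdd, add_zero] at h2
  refine mul_right_cancel₀ (h.sinh_pos k).ne' ?_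
  linear_combination cosh (l k) * h1 - h2 + cosh (l (k + 2)) * cosh_sq (l k)

lemma diag_cosh (h : IsHex l) :
    cosh (l 0) * cosh (l 1) * cosh (l 2) - sinh (l 0) * sinh (l 2) =
      cosh (l 3) * cosh (l 4) * cosh (l 5) - sinh (l 3) * sinh (l 5) := by
  have h1 : cosh (l 2) * cosh (l 1) * sinh (l 0) - sinh (l 2) * cosh (l 0) =
    cosh (l 3) * sinh (l 4) := h.diag 0
  have h2 : sinh (l 2) * cosh (l 1) * cosh (l 0) - cosh (l 2) * sinh (l 0) =
    sinh (l 4) * cosh (l 5) := h.diag' 0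
  have h3 : sinh (l 0) * sinh (l 1) = sinh (l 3) * sinh (l 4) := h.sine 0
  have h4 : sinh (l 1) * sinh (l 2) = sinh (l 4) * sinh (l 5) := h.sine' 0
  have h5 : cosh (l 1) * (sinh (l 0) * sinh (l 2)) = cosh (l 0) * cosh (l 2) + cosh (l 4) :=
    h.law 0
  have q0 := cosh_sq (l 0)
  have q1 := cosh_sq (l 1)
  have q2 := cosh_sq (l 2)
  have q4 := cosh_sq (l 4)
  have s4 := h.sinh_pos 4
  -- After multiplication by this square, the sides 3, 4 and 5 can be eliminated, leaving a
  -- polynomial identity in the sides 0, 1, 2.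
  refine mul_right_cancel₀ (pow_pos s4 2).ne' ?_
  have e1 : (cosh (l 3) * cosh (l 4) * cosh (l 5) - sinh (l 3) * sinh (l 5)) * sinh (l 4) ^ 2 =
      cosh (l 4) * (cosh (l 3) * sinh (l 4)) * (sinh (l 4) * cosh (l 5)) -
        (sinh (l 3) * sinh (l 4)) * (sinh (l 4) * sinh (l 5)) := by ring
  have e4 : cosh (l 4) =
      cosh (l 1) * (sinh (l 0) * sinh (l 2)) - cosh (l 0) * cosh (l 2) := by linarith
  have e5 : sinh (l 4) ^ 2 = cosh (l 4) ^ 2 - 1 := by linarith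
  rw [e1, ← h1, ← h2, ← h3, ← h4, e5, e4]
  generalize cosh (l 0) = c0 at *
  generalize sinh (l 0) = s0 at *
  generalize cosh (l 1) = c1 at *
  generalize sinh (l 1) = s1 at *
  generalize cosh (l 2) = c2 at *
  generalize sinh (l 2) = s2 at *
  have q1' : s1 ^ 2 = c1 ^ 2 - 1 := by linarith
  have q0' : s0 ^ 2 = c0 ^ 2 - 1 := by linarith
  have q2' : s2 ^ 2 = c2 ^ 2 - 1 := by linarith
  have e6 : (s0 * s1) * (s1 * s2) = s0 * s2 * (c1 ^ 2 - 1) := by rw [← q1']; ring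
  have e7 : s2 ^ 2 * c0 ^ 2 + c2 ^ 2 * s0 ^ 2 = (s0 * s2) ^ 2 + (c0 * c2) ^ 2 - 1 := by
    rw [mul_pow, q0', q2']; ring
  rw [e6]
  linear_combination (c1 * (s0 * s2) - c0 * c2) * c1 * e7

end IsHex

/-- The vertices of the right hexagon with side lengths `l`. -/
def frameX (l : Fin 6 → ℝ) : Fin 6 → ℝ × ℝ × ℝ :=
  ![(0, 0, 1), (sinh (l 0), 0, cosh (l 0)),
    (cosh (l 1) * sinh (l 0), sinh (l 1), cosh (l 1) * cosh (l 0)),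
    (cosh (l 2) * cosh (l 1) * sinh (l 0) - sinh (l 2) * cosh (l 0), cosh (l 2) * sinh (l 1),
      cosh (l 0) * cosh (l 1) * cosh (l 2) - sinh (l 0) * sinh (l 2)),
    (sinh (l 4), cosh (l 4) * sinh (l 5), cosh (l 4) * cosh (l 5)),
    (0, sinh (l 5), cosh (l 5))]

/-- The normals of the right hexagon with side lengths `l`. -/
def frameN (l : Fin 6 → ℝ) : Fin 6 → ℝ × ℝ × ℝ :=
  ![(0, 1, 0), (-cosh (l 0), 0, -sinh (l 0)),
    (-(sinh (l 1) * sinh (l 0)), -cosh (l 1), -(sinh (l 1) * cosh (l 0))),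
    (-cosh (l 4), -(sinh (l 4) * sinh (l 5)), -(sinh (l 4) * cosh (l 5))),
    (0, -cosh (l 5), -sinh (l 5)), (1, 0, 0)]

lemma IsHex.frame_step {l : Fin 6 → ℝ} (h : IsHex l) :
    (∀ i, frameX l (i + 2) =
      cosh (l (i + 1)) • frameX l (i + 1) + sinh (l (i + 1)) • frameN l i) ∧
    (∀ i, frameN l (i + 2) =
      -(sinh (l (i + 1)) • frameX l (i + 1) + cosh (l (i + 1)) • frameN l i)) := by
  have a0 : cosh (l 2) * cosh (l 1) * sinh (l 0) - sinh (l 2) * cosh (l 0) =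
    cosh (l 3) * sinh (l 4) := h.diag 0
  have a3 : cosh (l 5) * cosh (l 4) * sinh (l 3) - sinh (l 5) * cosh (l 3) =
    cosh (l 0) * sinh (l 1) := h.diag 3
  have b0 : sinh (l 2) * cosh (l 1) * cosh (l 0) - cosh (l 2) * sinh (l 0) =
    sinh (l 4) * cosh (l 5) := h.diag' 0
  have b3 : sinh (l 5) * cosh (l 4) * cosh (l 3) - cosh (l 5) * sinh (l 3) =
    sinh (l 1) * cosh (l 2) := h.diag' 3
  have c0 := h.diag_cosh
  have d0 : sinh (l 0) * sinh (l 1) = sinh (l 3) * sinh (l 4) := h.sine 0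
  have d1 : sinh (l 1) * sinh (l 2) = sinh (l 4) * sinh (l 5) := h.sine' 0
  have e0 : cosh (l 1) * (sinh (l 0) * sinh (l 2)) = cosh (l 0) * cosh (l 2) + cosh (l 4) :=
    h.law 0
  have e3 : cosh (l 4) * (sinh (l 3) * sinh (l 5)) = cosh (l 3) * cosh (l 5) + cosh (l 1) :=
    h.law 3
  have q0 := cosh_sq (l 0)
  have q3 := cosh_sq (l 3)
  have q4 := cosh_sq (l 4)
  have q5 := cosh_sq (l 5)
  constructor
  · intro i
    fin_cases i <;> simp [frameX, frameN, Prod.ext_iff]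
    · exact ⟨by ring, by ring⟩
    · refine ⟨?_, ?_, ?_⟩
      · linear_combination -cosh (l 3) * a0 + sinh (l 3) * d0 - sinh (l 4) * q3
      · linear_combination cosh (l 3) * b3 - sinh (l 3) * e3 - cosh (l 4) * sinh (l 5) * q3
      · linear_combination -cosh (l 3) * c0 - sinh (l 3) * a3 - cosh (l 4) * cosh (l 5) * q3
    · refine ⟨by ring, ?_, ?_⟩
      · linear_combination -sinh (l 5) * q4
      · linear_combination -cosh (l 5) * q4
    · exact ⟨by ring, by linear_combination -q5⟩
  · intro i
    fin_cases i <;> simp [frameX, frameN, Prod.ext_iff]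
    · refine ⟨?_, ?_, ?_⟩
      · linear_combination e0
      · linear_combination -d1
      · linear_combination b0
    · refine ⟨?_, ?_, ?_⟩
      · linear_combination sinh (l 3) * a0 - cosh (l 3) * d0
      · linear_combination -sinh (l 3) * b3 + cosh (l 3) * e3 + cosh (l 5) * q3
      · linear_combination sinh (l 3) * c0 + cosh (l 3) * a3 + sinh (l 5) * q3
    · exact ⟨by linear_combination -q4, by ring, by ring⟩
    · exact ⟨by linear_combination -q5, by ring⟩

/-- The relations at a vertex that are preserved along the boundary. -/
structure IsFrameAt (X M N : ℝ × ℝ × ℝ) : Prop where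
  XX : lor X X = -1
  MM : lor M M = 1
  NN : lor N N = 1
  XM : lor X M = 0
  XN : lor X N = 0
  MN : lor M N = 0
  cross_XM : lcross X M = N
  cross_NX : lcross N X = M
  cross_MN : lcross M N = -X

/-- Passing to the next vertex is a boost by `a` in the plane of `X` and `M`, followed by a quarter
turn; both preserve the form and the orientation. -/
lemma IsFrameAt.step {X M N : ℝ × ℝ × ℝ} (h : IsFrameAt X M N) (a : ℝ) :
    IsFrameAt (cosh a • X + sinh a • M) N (-(sinh a • X + cosh a • M)) := by
  have q := cosh_sq a
  have hMX : lor M X = 0 := by rw [lor_comm, h.XM]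
  have hNX : lor N X = 0 := by rw [lor_comm, h.XN]
  have hNM : lor N M = 0 := by rw [lor_comm, h.MN]
  refine ⟨?_, h.NN, ?_, ?_, ?_, ?_, ?_, ?_, ?_⟩
  · simp only [lor_add_left, lor_add_right, lor_smul_left, lor_smul_right, h.XX, h.MM, h.XM, hMX]
    linear_combination -q
  · simp only [lor_add_left, lor_add_right, lor_smul_left, lor_smul_right, lor_neg_left,
      lor_neg_right, h.XX, h.MM, h.XM, hMX]
    linear_combination q
  · simp only [lor_add_left, lor_smul_left, h.XN, h.MN]; ring
  · simp only [lor_add_left, lor_add_right, lor_smul_left, lor_smul_right,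
      lor_neg_right, h.XX, h.MM, h.XM, hMX]
    ring
  · simp only [lor_add_right, lor_smul_right, lor_neg_right, hNX, hNM]; ring
  · rw [lcross_add_left, lcross_smul_left, lcross_smul_left, h.cross_MN, lcross_anticomm X,
      h.cross_NX]
    module
  · have e : -(sinh a • X + cosh a • M) = (-sinh a) • X + (-cosh a) • M := by module
    rw [e]
    simp only [lcross_add_left, lcross_add_right, lcross_smul_left, lcross_smul_right, lcross_self,
      lcross_anticomm M X, h.cross_XM]
    have : (cosh a * cosh a - sinh a * sinh a) • N = N := by
      rw [show cosh a * cosh a - sinh a * sinh a = 1 by linear_combination q, one_smul]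
    refine Eq.trans ?_ this
    module
  · rw [lcross_neg_right, lcross_add_right, lcross_smul_right, lcross_smul_right, h.cross_NX,
      lcross_anticomm N M, h.cross_MN]
    module

lemma IsHex.isFrameAt {l : Fin 6 → ℝ} (h : IsHex l) (i : Fin 6) :
    IsFrameAt (frameX l (i + 1)) (frameN l i) (frameN l (i + 1)) := by
  -- The induction starts at the vertex 0, where the frame is the standard basis.
  have h0 : IsFrameAt (frameX l (5 + 1)) (frameN l 5) (frameN l (5 + 1)) := by
    constructor <;> simp [frameX, frameN, lor, lcross]
  have hs : ∀ i, IsFrameAt (frameX l (i + 1)) (frameN l i) (frameN l (i + 1)) →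
      IsFrameAt (frameX l (i + 1 + 1)) (frameN l (i + 1)) (frameN l (i + 1 + 1)) := by
    intro i hi
    have e : i + 1 + 1 = i + 2 := by clear * -; revert i; decide
    rw [e, h.frame_step.1, h.frame_step.2]
    exact hi.step _
  have h1 := hs _ h0
  have h2 := hs _ h1
  have h3 := hs _ h2
  have h4 := hs _ h3
  have h5 := hs _ h4
  fin_cases i
  exacts [h1, h2, h3, h4, h5, h0]

lemma IsHex.isFrame {l : Fin 6 → ℝ} (h : IsHex l) : IsFrame l (frameX l) (frameN l) where
  pos := h.pos
  step_X := h.frame_step.1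
  step_N := h.frame_step.2
  XX i := by
    have := (h.isFrameAt (i + 5)).XX
    simpa only [add_assoc, Fin.reduceAdd, add_zero] using this
  NN i := (h.isFrameAt i).MM
  XN i := by
    have := (h.isFrameAt (i + 5)).XN
    simpa only [add_assoc, Fin.reduceAdd, add_zero] using this
  X_succ_N i := (h.isFrameAt i).XM
  NN_succ i := (h.isFrameAt i).MN

lemma frameX_pos (l : Fin 6 → ℝ) (i : Fin 6) : 0 < (frameX l i).2.2 := by
  have h3 : 0 < cosh (l 0) * cosh (l 1) * cosh (l 2) - sinh (l 0) * sinh (l 2) := by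
    have := cosh_pos (l 0 - l 2)
    rw [cosh_sub] at this
    have h1 := one_le_cosh (l 1)
    have := mul_pos (cosh_pos (l 0)) (cosh_pos (l 2))
    nlinarith
  fin_cases i
  · exact one_pos
  · exact cosh_pos _
  · exact mul_pos (cosh_pos _) (cosh_pos _)
  · exact h3
  · exact mul_pos (cosh_pos _) (cosh_pos _)
  · exact cosh_pos _

lemma IsHex.lcross_frameX {l : Fin 6 → ℝ} (h : IsHex l) (i : Fin 6) :
    lcross (frameX l i) (frameX l (i + 1)) = sinh (l i) • frameN l i := by
  obtain ⟨j, rfl⟩ : ∃ j, i = j + 1 := ⟨i - 1, (sub_add_cancel i 1).symm⟩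
  have e : j + 1 + 1 = j + 2 := by clear * -; revert j; decide
  rw [e, h.frame_step.1, lcross_add_right, lcross_smul_right, lcross_smul_right, lcross_self,
    (h.isFrameAt j).cross_XM, smul_zero, zero_add]

/-- There are right hexagons with the side lengths satisfying the law of cosines. -/
theorem IsHex.exists_rightHexagon {l : Fin 6 → ℝ} (h : IsHex l) :
    ∃ H : RightHexagon, H.lengthVec = l := by
  have hF := h.isFrame
  choose v hv using fun i => exists_vec (hF.XX i) (frameX_pos l i)
  have hNX : ∀ i j, j ≠ i → j ≠ i + 1 → 0 < lor (frameN l i) (frameX l j) := by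
    intro i j h1 h2
    have : j = i + 2 ∨ j = i + 3 ∨ j = i + 4 ∨ j = i + 5 := by
      clear * - h1 h2; revert i j; decide
    have t3 := hF.N_two_X (i + 4)
    have t4 := hF.N_two_X_one (i + 4)
    simp only [add_assoc, Fin.reduceAdd, add_zero] at t3 t4
    rcases this with rfl | rfl | rfl | rfl
    · rw [hF.N_X_two]; exact h.sinh_pos _
    · rw [hF.N_X_three]; exact mul_pos (h.sinh_pos _) (cosh_pos _)
    · rw [t3]; exact mul_pos (h.sinh_pos _) (cosh_pos _)
    · rw [t4]; exact h.sinh_pos _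
  let H : RightHexagon :=
    { v := v
      convex := by
        intro i j h1 h2
        obtain ⟨r, hr, -, him⟩ := re_dir_mul (v i) (v (i + 1)) (v j)
        rw [him, hv, hv, hv, h.lcross_frameX, lor_smul_left]
        exact mul_pos hr (mul_pos (h.sinh_pos _) (hNX i j h1 h2))
      right_angle := by
        intro i
        rw [← InnerProductGeometry.inner_eq_zero_iff_angle_eq_pi_div_two]
        obtain ⟨j, rfl⟩ : ∃ j, i = j + 1 := ⟨i - 1, (sub_add_cancel i 1).symm⟩
        have e : j + 1 + 1 = j + 2 ∧ j + 1 - 1 = j := by clear * -; revert j; decide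
        obtain ⟨r, hr, hre, -⟩ := re_dir_mul (v (j + 1)) (v j) (v (j + 2))
        have h1 := hF.XX_one (j + 1)
        rw [e.1] at h1
        rw [e.1, e.2, Complex.inner, mul_comm, hre, hv, hv, hv, hF.XX_two, h1,
          lor_comm (frameX l (j + 1)), hF.XX_one]
        ring }
  refine ⟨H, ?_⟩
  rw [RightHexagon.lengthVec_eq]
  funext k
  exact dist_eq_of_lor (h.pos k).le (by
    change lor (vec (v k)) (vec (v (k + 1))) = _
    rw [hv, hv, hF.XX_one])

end Hexagon
end

noncomputable section
namespace Hexagon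

open Real Filter

/-! ### Degeneration of right hexagons -/

variable {ι : Type*} {𝒰 : Ultrafilter ι}

lemma exists_tendsto_of_bounds {f : ι → ℝ} {a b : ℝ} (h : ∀ᶠ n in 𝒰, f n ∈ Set.Icc a b) :
    ∃ x, Tendsto f 𝒰 (𝓝 x) := by
  obtain ⟨x, -, hx⟩ := isCompact_Icc.ultrafilter_le_nhds (𝒰.map f) (le_principal_iff.2 h)
  exact ⟨x, hx⟩

/-- Up to `log 2`, the length, `log cosh` and the positive part of `log sinh` agree, so they have
the same rescaled limit. Only `log sinh` can be very negative, and it then records how fast the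
length shrinks. -/
lemma log_cosh_bounds {x : ℝ} (hx : 0 < x) :
    max 0 (log (sinh x)) ≤ log (cosh x) ∧ log (cosh x) ≤ log 2 + max 0 (log (sinh x)) ∧
      log (cosh x) ≤ x ∧ x ≤ log 2 + log (cosh x) := by
  have hs : 0 < sinh x := sinh_pos_iff.2 hx
  have hc := cosh_pos x
  have h1 : cosh x ≤ 1 + sinh x := by
    have := cosh_sq x
    nlinarith
  refine ⟨max_le (log_nonneg (one_le_cosh x)) (log_le_log hs (sinh_lt_cosh x).le), ?_, ?_, ?_⟩
  · rcases le_total (sinh x) 1 with h | h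
    · have : log (cosh x) ≤ log 2 := log_le_log hc (by linarith)
      linarith [le_max_left 0 (log (sinh x))]
    · have : log (cosh x) ≤ log (2 * sinh x) := log_le_log hc (by linarith)
      rw [log_mul two_ne_zero hs.ne'] at this
      linarith [le_max_right 0 (log (sinh x))]
  · rw [log_le_iff_le_exp hc, ← cosh_add_sinh]
    linarith
  · rw [← log_mul two_ne_zero hc.ne', le_log_iff_exp_le (by positivity), ← cosh_add_sinh]
    linarith [sinh_lt_cosh x]

section
variable {s x : ι → ℝ} {A : ℝ} (hs : Tendsto s 𝒰 atTop) (hx : ∀ᶠ n in 𝒰, 0 < x n)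
  (hA : Tendsto (fun n => log (sinh (x n)) / s n) 𝒰 (𝓝 A))
include hs

lemma tendsto_const_div (c : ℝ) : Tendsto (fun n => c / s n) 𝒰 (𝓝 0) :=
  Tendsto.div_atTop tendsto_const_nhds hs

include hx hA

lemma tendsto_log_cosh_div : Tendsto (fun n => log (cosh (x n)) / s n) 𝒰 (𝓝 (max 0 A)) := by
  have h1 : Tendsto (fun n => max 0 (log (sinh (x n)) / s n)) 𝒰 (𝓝 (max 0 A)) :=
    tendsto_const_nhds.max hA
  have h2 := (tendsto_const_div hs (log 2)).add h1
  rw [zero_add] at h2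
  refine tendsto_of_tendsto_of_tendsto_of_le_of_le' h1 h2 ?_ ?_
  · filter_upwards [hx, hs.eventually_gt_atTop 0] with n h h0
    rw [le_div_iff₀ h0, max_mul_of_nonneg _ _ h0.le, zero_mul, div_mul_cancel₀ _ h0.ne']
    exact (log_cosh_bounds h).1
  · filter_upwards [hx, hs.eventually_gt_atTop 0] with n h h0
    rw [div_le_iff₀ h0, add_mul, max_mul_of_nonneg _ _ h0.le, zero_mul, div_mul_cancel₀ _ h0.ne',
      div_mul_cancel₀ _ h0.ne']
    exact (log_cosh_bounds h).2.1

lemma tendsto_div_of_log_sinh : Tendsto (fun n => x n / s n) 𝒰 (𝓝 (max 0 A)) := by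
  have h1 := tendsto_log_cosh_div hs hx hA
  have h2 := (tendsto_const_div hs (log 2)).add h1
  rw [zero_add] at h2
  refine tendsto_of_tendsto_of_tendsto_of_le_of_le' h1 h2 ?_ ?_
  · filter_upwards [hx, hs.eventually_gt_atTop 0] with n h h0
    exact div_le_div_of_nonneg_right (log_cosh_bounds h).2.2.1 h0.le
  · filter_upwards [hx, hs.eventually_gt_atTop 0] with n h h0
    rw [← add_div]
    exact div_le_div_of_nonneg_right (log_cosh_bounds h).2.2.2 h0.le

/-- A negative rescaled limit forces `log (sinh x)` to minus infinity, and `x ≤ sinh x`. -/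
lemma tendsto_zero_of_log_sinh (hneg : A < 0) : Tendsto x 𝒰 (𝓝 0) := by
  have h1 : Tendsto (fun n => log (sinh (x n)) / s n * s n) 𝒰 atBot := hA.neg_mul_atTop hneg hs
  refine tendsto_of_tendsto_of_tendsto_of_le_of_le' tendsto_const_nhds
    (tendsto_exp_atBot.comp h1) (hx.mono fun n h => h.le) ?_
  filter_upwards [hx, hs.eventually_gt_atTop 0] with n h h0
  rw [Function.comp_apply, div_mul_cancel₀ _ h0.ne', exp_log (sinh_pos_iff.2 h)]
  exact self_le_sinh_iff.2 h.le

end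

/-- The rescaled lengths of degenerating right hexagons converge to the intersection numbers of a
foliation, whose leaves are parallel to arcs which shrink to points. -/
theorem exists_weight_of_tendsto {l : ι → Fin 6 → ℝ} {s : ι → ℝ} {v : Fin 6 → ℝ}
    (hl : ∀ᶠ n in 𝒰, IsHex (l n)) (hs : Tendsto s 𝒰 atTop)
    (hv : ∀ k, Tendsto (fun n => l n k / s n) 𝒰 (𝓝 (v k))) :
    ∃ W : Weight, (∀ k, v k = W.deg k) ∧
      (∀ k, Tendsto (fun n => longLen (l n) k / s n) 𝒰 (𝓝 (W.crossLong k))) ∧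
      (∀ k, 0 < W.a k → Tendsto (fun n => l n k) 𝒰 (𝓝 0)) ∧
      (∀ k, 0 < W.b k → Tendsto (fun n => longLen (l n) k) 𝒰 (𝓝 0)) := by
  have hpos : ∀ k, ∀ᶠ n in 𝒰, 0 < l n k := fun k => hl.mono fun n h => h.pos k
  have hLpos : ∀ k, ∀ᶠ n in 𝒰, 0 < longLen (l n) k := fun k => hl.mono fun n h => h.longLen_pos k
  have hlt : ∀ k, ∀ᶠ n in 𝒰, l n k / s n < v k + 1 := fun k =>
    (hv k).eventually_lt_const (by linarith)
  have hup : ∀ k, ∀ᶠ n in 𝒰, log (sinh (l n k)) / s n < v k + 1 := by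
    intro k
    filter_upwards [hpos k, hlt k, hs.eventually_gt_atTop 0] with n h1 h2 h3
    refine lt_of_le_of_lt (div_le_div_of_nonneg_right ?_ h3.le) h2
    have := log_cosh_bounds h1
    exact (le_max_right _ _).trans (this.1.trans this.2.2.1)
  -- The lower bound comes from `one_lt_long`: a side cannot shrink faster than its neighbour grows
  -- exponentially.
  have hf : ∀ k, ∃ A, Tendsto (fun n => log (sinh (l n k)) / s n) 𝒰 (𝓝 A) := by
    intro k
    refine exists_tendsto_of_bounds (a := -(v (k + 1) + 1)) (b := v k + 1) ?_
    filter_upwards [hl, hup k, hup (k + 1), hs.eventually_gt_atTop 0] with n h h1 h2 h3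
    refine ⟨?_, h1.le⟩
    have h4 := h.one_lt_long (k + 5)
    have e : k + 5 + 1 = k ∧ k + 5 + 2 = k + 1 := by clear * -; revert k; decide
    rw [e.1, e.2] at h4
    have h5 := log_pos h4
    rw [log_mul (h.sinh_pos _).ne' (h.sinh_pos _).ne'] at h5
    have h6 := div_pos h5 h3
    rw [add_div] at h6
    linarith
  choose A hA using hf
  have hcosh : ∀ k, Tendsto (fun n => log (cosh (l n k)) / s n) 𝒰 (𝓝 (max 0 (A k))) := fun k =>
    tendsto_log_cosh_div hs (hpos k) (hA k)
  have hvA : ∀ k, v k = max 0 (A k) := fun k =>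
    tendsto_nhds_unique (hv k) (tendsto_div_of_log_sinh hs (hpos k) (hA k))
  have hL : ∀ k, ∀ᶠ n in 𝒰, log (cosh (longLen (l n) k)) / s n =
      log (sinh (l n (k + 1))) / s n + log (sinh (l n (k + 2))) / s n := by
    intro k
    filter_upwards [hl] with n h
    rw [h.cosh_longLen, log_mul (h.sinh_pos _).ne' (h.sinh_pos _).ne', add_div]
  -- The rescaled logarithms of the two inequalities in `side_bounds`.
  have hlow : ∀ k, ∀ᶠ n in 𝒰,
      2 * (log (cosh (longLen (l n) k)) / s n) + log (cosh (l n (k + 1))) / s n +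
        log (cosh (l n (k + 5))) / s n ≤
      log (cosh (l n k)) / s n + 2 * (log (sinh (longLen (l n) k)) / s n) +
        log (sinh (l n (k + 1))) / s n + log (sinh (l n (k + 5))) / s n ∧
      log (cosh (l n k)) / s n + 2 * (log (sinh (longLen (l n) k)) / s n) +
        log (sinh (l n (k + 1))) / s n + log (sinh (l n (k + 5))) / s n ≤
      log 2 / s n + (2 * (log (cosh (longLen (l n) k)) / s n) + log (cosh (l n (k + 1))) / s n +
        log (cosh (l n (k + 5))) / s n) := by
    intro k
    filter_upwards [hl, hs.eventually_gt_atTop 0] with n h h0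
    have hb := h.side_bounds k
    have p0 := cosh_pos (l n k)
    have p1 := cosh_pos (l n (k + 1))
    have p5 := cosh_pos (l n (k + 5))
    have q1 := h.sinh_pos (k + 1)
    have q5 := h.sinh_pos (k + 5)
    have pL := cosh_pos (longLen (l n) k)
    have qL := sinh_pos_iff.2 (h.longLen_pos k)
    have e1 : log (cosh (longLen (l n) k) ^ 2 * cosh (l n (k + 1)) * cosh (l n (k + 5))) =
        2 * log (cosh (longLen (l n) k)) + log (cosh (l n (k + 1))) + log (cosh (l n (k + 5))) := by
      rw [log_mul (by positivity) p5.ne', log_mul (by positivity) p1.ne', log_pow]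
      norm_num
    have e2 : log (cosh (l n k) * (sinh (longLen (l n) k) ^ 2 * sinh (l n (k + 1)) *
        sinh (l n (k + 5)))) = log (cosh (l n k)) + (2 * log (sinh (longLen (l n) k)) +
          log (sinh (l n (k + 1))) + log (sinh (l n (k + 5)))) := by
      rw [log_mul p0.ne' (by positivity), log_mul (by positivity) q5.ne',
        log_mul (by positivity) q1.ne', log_pow]
      norm_num
    have h1 := log_le_log (by positivity) hb.1
    have h2 := log_le_log (by positivity) hb.2
    rw [log_mul two_ne_zero (by positivity)] at h2
    rw [e1, e2] at h1
    rw [e1, e2] at h2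
    have h1' := div_le_div_of_nonneg_right h1 h0.le
    have h2' := div_le_div_of_nonneg_right h2 h0.le
    simp only [add_div, mul_div_assoc] at h1' h2'
    constructor <;> linarith
  have hg : ∀ k, ∃ G, Tendsto (fun n => log (sinh (longLen (l n) k)) / s n) 𝒰 (𝓝 G) := by
    intro k
    refine exists_tendsto_of_bounds (a := -(v k + 1) / 2) (b := v (k + 1) + 1 + (v (k + 2) + 1)) ?_
    filter_upwards [hl, hL k, hlow k, hup (k + 1), hup (k + 2), hlt k, hs.eventually_gt_atTop 0]
      with n h h1 h2 h3 h4 h5 h6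
    have bL := log_cosh_bounds (h.longLen_pos k)
    have b0 := log_cosh_bounds (h.pos k)
    have b1 := log_cosh_bounds (h.pos (k + 1))
    have b5 := log_cosh_bounds (h.pos (k + 5))
    have cL := div_le_div_of_nonneg_right ((le_max_right _ _).trans bL.1) h6.le
    have cL' := div_nonneg ((le_max_left _ _).trans bL.1) h6.le
    have c0 := div_le_div_of_nonneg_right b0.2.2.1 h6.le
    have c1 := div_le_div_of_nonneg_right ((le_max_right _ _).trans b1.1) h6.le
    have c5 := div_le_div_of_nonneg_right ((le_max_right _ _).trans b5.1) h6.le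
    have h2 := h2.1
    constructor <;> linarith
  choose G hG using hg
  have hLcosh : ∀ k, Tendsto (fun n => log (cosh (longLen (l n) k)) / s n) 𝒰 (𝓝 (max 0 (G k))) :=
    fun k => tendsto_log_cosh_div hs (hLpos k) (hG k)
  -- The limit of the formula for `cosh (longLen l k)`.
  have R2 : ∀ k, max 0 (G k) = A (k + 1) + A (k + 2) := fun k =>
    tendsto_nhds_unique ((tendsto_congr' (hL k)).1 (hLcosh k)) ((hA (k + 1)).add (hA (k + 2)))
  -- The limit of `side_bounds`; its factor 2 contributes only `log 2 / s`, which vanishes.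
  have R1 : ∀ k, 2 * max 0 (G k) + max 0 (A (k + 1)) + max 0 (A (k + 5)) =
      max 0 (A k) + 2 * G k + A (k + 1) + A (k + 5) := by
    intro k
    have t1 := (((hLcosh k).const_mul 2).add (hcosh (k + 1))).add (hcosh (k + 5))
    have t2 := (((hcosh k).add ((hG k).const_mul 2)).add (hA (k + 1))).add (hA (k + 5))
    refine le_antisymm (le_of_tendsto_of_tendsto t1 t2 ((hlow k).mono fun n h => h.1)) ?_
    have t3 := (tendsto_const_div hs (log 2)).add t1
    rw [zero_add] at t3
    exact le_of_tendsto_of_tendsto t2 t3 ((hlow k).mono fun n h => h.2)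
  have hG3 : ∀ k, G (k + 3) = G k := by
    intro k
    refine tendsto_nhds_unique (hG (k + 3)) ((tendsto_congr' ?_).1 (hG k))
    filter_upwards [hl] with n h
    rw [h.longLen_add_three]
  have am : ∀ x : ℝ, max 0 (-x) = max 0 x - x := fun x => by
    rcases le_total 0 x with h | h
    · rw [max_eq_left (by linarith), max_eq_right h]; ring
    · rw [max_eq_right (by linarith), max_eq_left h]; ring
  have hneg : ∀ x : ℝ, max 0 (-x) ≠ 0 → x < 0 := fun x h => by
    by_contra h'
    exact h (max_eq_left (by linarith))
  -- Rewriting differences of positive parts and values as negative parts turns `R1` into the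
  -- formula for `deg`, with weights the negative parts of `A` and twice those of `G`.
  have D : ∀ k, max 0 (A k) =
      max 0 (-A (k + 1)) + max 0 (-A (k - 1)) + 2 * max 0 (-G k) := by
    intro k
    have e : k - 1 = k + 5 := by clear * -; revert k; decide
    rw [e]
    simp only [am]
    linarith [R1 k]
  -- Inserting `D` at `k + 1` and `k + 2` into `R2` gives the formula for `crossLong`.
  have C : ∀ k, max 0 (G k) = max 0 (-A k) + max 0 (-A (k + 3)) + 2 * max 0 (-G (k + 1)) +
      2 * max 0 (-G (k + 2)) := by
    intro k
    have d1 := D (k + 1)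
    have d2 := D (k + 2)
    have e : k + 1 + 1 = k + 2 ∧ k + 1 - 1 = k ∧ k + 2 + 1 = k + 3 ∧ k + 2 - 1 = k + 1 := by
      clear * -; revert k; decide
    rw [e.1, e.2.1] at d1
    rw [e.2.2.1, e.2.2.2] at d2
    linarith [R2 k, am (A (k + 1)), am (A (k + 2))]
  have na : ∀ x : ℝ, 0 ≤ max 0 (-x) := fun x => le_max_left _ _
  refine ⟨⟨fun k => max 0 (-A k), fun k => 2 * max 0 (-G k), ?_, fun k => na _,
    fun k => mul_nonneg zero_le_two (na _), ?_, ?_, ?_⟩, fun k => (hvA k).trans (D k), fun k => ?_,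
    fun k hk => ?_, fun k hk => ?_⟩
  · intro k
    rw [hG3]
  · intro k
    -- A positive negative part of `A k` makes the left side of `D` zero, so all crossing weights in
    -- its nonnegative right side vanish. The products with `G` are treated likewise, using `C` for
    -- two long arcs.
    by_cases h : max 0 (-A k) = 0
    · rw [h, zero_mul]
    · have d := D k
      rw [max_eq_left (hneg _ h).le] at d
      rw [show max 0 (-A (k + 1)) = 0 by linarith [na (A (k + 1)), na (A (k - 1)), na (G k)],
        mul_zero]
  · intro k
    by_cases h : max 0 (-A k) = 0
    · rw [h, zero_mul]
    · have d := D k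
      rw [max_eq_left (hneg _ h).le] at d
      rw [show max 0 (-G k) = 0 by linarith [na (A (k + 1)), na (A (k - 1)), na (G k)], mul_zero,
        mul_zero]
  · intro k
    by_cases h : max 0 (-G k) = 0
    · rw [h, mul_zero, zero_mul]
    · have d := C k
      rw [max_eq_left (hneg _ h).le] at d
      rw [show max 0 (-G (k + 1)) = 0 by
        linarith [na (A k), na (A (k + 3)), na (G (k + 1)), na (G (k + 2))], mul_zero, mul_zero]
  · have := tendsto_div_of_log_sinh hs (hLpos k) (hG k)
    rw [C k] at this
    exact this
  · exact tendsto_zero_of_log_sinh hs (hpos k) (hA k) (hneg _ hk.ne')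
  · refine tendsto_zero_of_log_sinh hs (hLpos k) (hG k) (hneg _ ?_)
    intro h
    apply hk.ne'
    dsimp only
    rw [h, mul_zero]

/-- A limit of right hexagons is a right hexagon. -/
theorem IsHex.of_tendsto {l : ι → Fin 6 → ℝ} {v : Fin 6 → ℝ} (hl : ∀ᶠ n in 𝒰, IsHex (l n))
    (hv : ∀ k, Tendsto (fun n => l n k) 𝒰 (𝓝 (v k))) : IsHex v := by
  have hc : ∀ k, Tendsto (fun n => cosh (l n k)) 𝒰 (𝓝 (cosh (v k))) := fun k =>
    (continuous_cosh.tendsto _).comp (hv k)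
  have hs : ∀ k, Tendsto (fun n => sinh (l n k)) 𝒰 (𝓝 (sinh (v k))) := fun k =>
    (continuous_sinh.tendsto _).comp (hv k)
  have law : ∀ k, cosh (v (k + 1)) * (sinh (v k) * sinh (v (k + 2))) =
      cosh (v k) * cosh (v (k + 2)) + cosh (v (k + 4)) := fun k =>
    tendsto_nhds_unique_of_eventuallyEq ((hc (k + 1)).mul ((hs k).mul (hs (k + 2))))
      (((hc k).mul (hc (k + 2))).add (hc (k + 4))) (hl.mono fun n h => h.law k)
  refine ⟨fun k => ?_, law⟩
  have h0 : 0 ≤ v k := ge_of_tendsto (hv k) (hl.mono fun n h => (h.pos k).le)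
  refine h0.lt_of_ne fun h => ?_
  have := law k
  -- A side of length zero in the limit would make a positive right side of the law of cosines
  -- vanish.
  rw [← h, sinh_zero, zero_mul, mul_zero] at this
  have p1 := cosh_pos (v (k + 2))
  have p2 := cosh_pos (v (k + 4))
  rw [cosh_zero] at this
  linarith


/-! ### The combinatorics of weights -/

namespace Weight

/-- The weights with the sides renumbered. -/
def rotate (W : Weight) (j : Fin 6) : Weight where
  a k := W.a (k + j)
  b k := W.b (k + j)
  b_add_three k := by rw [add_right_comm]; exact W.b_add_three _
  a_nonneg k := W.a_nonneg _
  b_nonneg k := W.b_nonneg _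
  a_mul_a k := by rw [add_right_comm]; exact W.a_mul_a _
  a_mul_b k := W.a_mul_b _
  b_mul_b k := by rw [add_right_comm]; exact W.b_mul_b _

lemma deg_rotate (W : Weight) (j k : Fin 6) : (W.rotate j).deg k = W.deg (k + j) := by
  simp only [deg, rotate, add_right_comm k _ j, sub_add_eq_add_sub]

lemma crossLong_rotate (W : Weight) (j k : Fin 6) :
    (W.rotate j).crossLong k = W.crossLong (k + j) := by
  simp only [crossLong, rotate, add_right_comm k _ j]

lemma eq_of_rotate_eq {W W' : Weight} (j : Fin 6) (h : W.rotate j = W'.rotate j) : W = W' := by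
  have ha : ∀ k, W.a (k + j) = W'.a (k + j) := fun k => congrFun (congrArg Weight.a h) k
  have hb : ∀ k, W.b (k + j) = W'.b (k + j) := fun k => congrFun (congrArg Weight.b h) k
  ext k
  · simpa only [sub_add_cancel] using ha (k - j)
  · simpa only [sub_add_cancel] using hb (k - j)

lemma deg_eqs (W : Weight) : W.deg 0 = W.a 1 + W.a 5 + W.b 0 ∧ W.deg 1 = W.a 2 + W.a 0 + W.b 1 ∧
    W.deg 2 = W.a 3 + W.a 1 + W.b 2 ∧ W.deg 3 = W.a 4 + W.a 2 + W.b 0 ∧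
    W.deg 4 = W.a 5 + W.a 3 + W.b 1 ∧ W.deg 5 = W.a 0 + W.a 4 + W.b 2 := by
  have h3 := W.b_add_three 0
  have h4 := W.b_add_three 1
  have h5 := W.b_add_three 2
  rw [← h3, ← h4, ← h5]
  exact ⟨by rw [h3]; rfl, by rw [h4]; rfl, by rw [h5]; rfl, rfl, rfl, rfl⟩

lemma ext_of_eqs {W W' : Weight} (a0 : W.a 0 = W'.a 0) (a1 : W.a 1 = W'.a 1) (a2 : W.a 2 = W'.a 2)
    (a3 : W.a 3 = W'.a 3) (a4 : W.a 4 = W'.a 4) (a5 : W.a 5 = W'.a 5) (b0 : W.b 0 = W'.b 0)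
    (b1 : W.b 1 = W'.b 1) (b2 : W.b 2 = W'.b 2) : W = W' := by
  ext k
  · fin_cases k
    exacts [a0, a1, a2, a3, a4, a5]
  · fin_cases k
    · exact b0
    · exact b1
    · exact b2
    · exact (W.b_add_three 0).trans (b0.trans (W'.b_add_three 0).symm)
    · exact (W.b_add_three 1).trans (b1.trans (W'.b_add_three 1).symm)
    · exact (W.b_add_three 2).trans (b2.trans (W'.b_add_three 2).symm)

lemma a_mul_a_eqs (W : Weight) : (W.a 0 = 0 ∨ W.a 1 = 0) ∧ (W.a 1 = 0 ∨ W.a 2 = 0) ∧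
    (W.a 2 = 0 ∨ W.a 3 = 0) ∧ (W.a 3 = 0 ∨ W.a 4 = 0) ∧ (W.a 4 = 0 ∨ W.a 5 = 0) ∧
    (W.a 5 = 0 ∨ W.a 0 = 0) :=
  ⟨mul_eq_zero.1 (W.a_mul_a 0), mul_eq_zero.1 (W.a_mul_a 1), mul_eq_zero.1 (W.a_mul_a 2),
    mul_eq_zero.1 (W.a_mul_a 3), mul_eq_zero.1 (W.a_mul_a 4), mul_eq_zero.1 (W.a_mul_a 5)⟩

lemma a_mul_b_eqs (W : Weight) : (W.b 0 = 0 ∨ W.a 0 = 0 ∧ W.a 3 = 0) ∧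
    (W.b 1 = 0 ∨ W.a 1 = 0 ∧ W.a 4 = 0) ∧ (W.b 2 = 0 ∨ W.a 2 = 0 ∧ W.a 5 = 0) := by
  have key : ∀ k, W.b k = 0 ∨ W.a k = 0 ∧ W.a (k + 3) = 0 := by
    intro k
    have h1 := W.a_mul_b k
    have h2 := W.a_mul_b (k + 3)
    rw [W.b_add_three] at h2
    rw [mul_eq_zero] at h1 h2
    tauto
  exact ⟨key 0, key 1, key 2⟩

lemma b_mul_b_eqs (W : Weight) : (W.b 0 = 0 ∨ W.b 1 = 0) ∧ (W.b 1 = 0 ∨ W.b 2 = 0) ∧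
    (W.b 2 = 0 ∨ W.b 0 = 0) := by
  have h2 := W.b_mul_b 2
  have h3 := W.b_add_three 0
  rw [show (2 : Fin 6) + 1 = 0 + 3 from rfl, h3] at h2
  exact ⟨mul_eq_zero.1 (W.b_mul_b 0), mul_eq_zero.1 (W.b_mul_b 1), mul_eq_zero.1 h2⟩

/-- A leaf joining the opposite sides 0 and 3 excludes the classes `a 0`, `a 3`, `b 1`, `b 2`. What
remains is a choice between `a 1` and `a 2` on one side of it and between `a 4` and `a 5` on the
other. -/
lemma exists_deg_eq_zero_aux (W : Weight) (h : W.b 0 ≠ 0) :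
    ∃ k, W.deg k = 0 ∧ (W.deg (k + 2) = 0 ∨ W.deg (k + 3) = 0) := by
  obtain ⟨d0, d1, d2, d3, d4, d5⟩ := W.deg_eqs
  obtain ⟨p0, p1, p2, p3, p4, p5⟩ := W.a_mul_a_eqs
  obtain ⟨q0, q1, q2⟩ := W.a_mul_b_eqs
  obtain ⟨r0, r1, r2⟩ := W.b_mul_b_eqs
  have a03 := q0.resolve_left h
  have b1 := r0.resolve_left h
  have b2 := r2.resolve_right h
  rcases p1 with p1 | p1 <;> rcases p4 with p4 | p4
  · exact ⟨2, by linarith, Or.inr (show W.deg 5 = 0 by linarith)⟩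
  · exact ⟨2, by linarith, Or.inl (show W.deg 4 = 0 by linarith)⟩
  · exact ⟨5, by linarith, Or.inl (show W.deg 1 = 0 by linarith)⟩
  · exact ⟨1, by linarith, Or.inr (show W.deg 4 = 0 by linarith)⟩

/-- Two of the sides, not adjacent, meet no leaf. -/
lemma exists_deg_eq_zero (W : Weight) :
    ∃ k, W.deg k = 0 ∧ (W.deg (k + 2) = 0 ∨ W.deg (k + 3) = 0) := by
  have key : ∀ j, W.b j ≠ 0 → ∃ k, W.deg k = 0 ∧ (W.deg (k + 2) = 0 ∨ W.deg (k + 3) = 0) := by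
    intro j hj
    obtain ⟨k, hk⟩ := (W.rotate j).exists_deg_eq_zero_aux (by simpa only [rotate, zero_add] using hj)
    simp only [deg_rotate, add_right_comm k _ j] at hk
    exact ⟨_, hk⟩
  by_cases b0 : W.b 0 = 0
  swap; exact key 0 b0
  by_cases b1 : W.b 1 = 0
  swap; exact key 1 b1
  by_cases b2 : W.b 2 = 0
  swap; exact key 2 b2
  obtain ⟨d0, d1, d2, d3, d4, d5⟩ := W.deg_eqs
  obtain ⟨p0, p1, p2, p3, p4, p5⟩ := W.a_mul_a_eqs
  have h02 : W.a 1 = 0 → W.a 3 = 0 → W.a 5 = 0 →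
      ∃ k, W.deg k = 0 ∧ (W.deg (k + 2) = 0 ∨ W.deg (k + 3) = 0) := fun h1 h3 h5 =>
    ⟨0, by linarith, Or.inl (show W.deg 2 = 0 by linarith)⟩
  have h13 : W.a 0 = 0 → W.a 2 = 0 → W.a 4 = 0 →
      ∃ k, W.deg k = 0 ∧ (W.deg (k + 2) = 0 ∨ W.deg (k + 3) = 0) := fun h1 h3 h5 =>
    ⟨1, by linarith, Or.inl (show W.deg 3 = 0 by linarith)⟩
  have h03 : W.a 1 = 0 → W.a 2 = 0 → W.a 4 = 0 → W.a 5 = 0 →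
      ∃ k, W.deg k = 0 ∧ (W.deg (k + 2) = 0 ∨ W.deg (k + 3) = 0) := fun h1 h3 h4 h5 =>
    ⟨0, by linarith, Or.inr (show W.deg 3 = 0 by linarith)⟩
  have h14 : W.a 2 = 0 → W.a 3 = 0 → W.a 5 = 0 → W.a 0 = 0 →
      ∃ k, W.deg k = 0 ∧ (W.deg (k + 2) = 0 ∨ W.deg (k + 3) = 0) := fun h1 h3 h4 h5 =>
    ⟨1, by linarith, Or.inr (show W.deg 4 = 0 by linarith)⟩
  have h25 : W.a 3 = 0 → W.a 4 = 0 → W.a 0 = 0 → W.a 1 = 0 →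
      ∃ k, W.deg k = 0 ∧ (W.deg (k + 2) = 0 ∨ W.deg (k + 3) = 0) := fun h1 h3 h4 h5 =>
    ⟨2, by linarith, Or.inr (show W.deg 5 = 0 by linarith)⟩
  -- Without long leaves, the sides whose parallel arcs carry weight are pairwise non-adjacent; in
  -- each case one of the five patterns above misses two suitable sides.
  rcases p0 with p0 | p0 <;> rcases p1 with p1 | p1 <;> rcases p2 with p2 | p2 <;>
    rcases p3 with p3 | p3 <;> rcases p4 with p4 | p4 <;> rcases p5 with p5 | p5 <;>
    first
    | exact h02 (by assumption) (by assumption) (by assumption)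
    | exact h13 (by assumption) (by assumption) (by assumption)
    | exact h03 (by assumption) (by assumption) (by assumption) (by assumption)
    | exact h14 (by assumption) (by assumption) (by assumption) (by assumption)
    | exact h25 (by assumption) (by assumption) (by assumption) (by assumption)

/-- The intersection numbers with the arcs parallel to the sides determine the weights. -/
theorem deg_injective : Function.Injective deg := by
  -- Both weights vanish on all classes ending on the two missed sides. The few remaining ones are
  -- determined by linear equations and, for opposite missed sides, by the exclusion of `b 1` and `b
  -- 2`.
  have key : ∀ W W' : Weight, W.deg = W'.deg → W.deg 0 = 0 → (W.deg 2 = 0 ∨ W.deg 3 = 0) →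
      W = W' := by
    intro W W' h h0 h23
    have e := fun k => congrFun h k
    have e0 := e 0; have e1 := e 1; have e2 := e 2; have e3 := e 3; have e4 := e 4; have e5 := e 5
    obtain ⟨d0, d1, d2, d3, d4, d5⟩ := W.deg_eqs
    obtain ⟨d0', d1', d2', d3', d4', d5'⟩ := W'.deg_eqs
    have n := W.a_nonneg
    have n' := W'.a_nonneg
    have m := W.b_nonneg
    have m' := W'.b_nonneg
    have z1 : W.a 1 = 0 := by linarith [n 1, n 5, m 0]
    have z5 : W.a 5 = 0 := by linarith [n 1, n 5, m 0]
    have y0 : W.b 0 = 0 := by linarith [n 1, n 5, m 0]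
    have z1' : W'.a 1 = 0 := by linarith [n' 1, n' 5, m' 0]
    have z5' : W'.a 5 = 0 := by linarith [n' 1, n' 5, m' 0]
    have y0' : W'.b 0 = 0 := by linarith [n' 1, n' 5, m' 0]
    rcases h23 with h2 | h3
    · have z3 : W.a 3 = 0 := by linarith [n 1, n 3, m 2]
      have y2 : W.b 2 = 0 := by linarith [n 1, n 3, m 2]
      have z3' : W'.a 3 = 0 := by linarith [n' 1, n' 3, m' 2]
      have y2' : W'.b 2 = 0 := by linarith [n' 1, n' 3, m' 2]
      apply ext_of_eqs <;> linarith
    · have z2 : W.a 2 = 0 := by linarith [n 2, n 4, m 0]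
      have z4 : W.a 4 = 0 := by linarith [n 2, n 4, m 0]
      have z2' : W'.a 2 = 0 := by linarith [n' 2, n' 4, m' 0]
      have z4' : W'.a 4 = 0 := by linarith [n' 2, n' 4, m' 0]
      rcases W.b_mul_b_eqs.2.1 with r | r <;> rcases W'.b_mul_b_eqs.2.1 with r' | r' <;>
        apply ext_of_eqs <;> linarith [m 1, m 2, m' 1, m' 2]
  intro W W' h
  obtain ⟨k, h0, h1⟩ := W.exists_deg_eq_zero
  refine eq_of_rotate_eq k (key _ _ ?_ ?_ ?_)
  · funext i
    rw [deg_rotate, deg_rotate, h]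
  · rwa [deg_rotate, zero_add]
  · rwa [deg_rotate, deg_rotate, add_comm 2, add_comm 3]

/-- A foliation with leaves parallel to an arc has none crossing it. In particular, meeting all arcs
of a triple implies having no leaf parallel to them. -/
lemma wt_mul_cross (W : Weight) (e : ArcClass) : W.wt e * W.cross e = 0 := by
  have hb : ∀ k, W.b (k + 2) = W.b (k + 5) := fun k => by
    rw [← W.b_add_three, add_assoc]; rfl
  rcases e.ev_cases with ⟨k, -, h⟩ | ⟨k, -, h⟩
  · have h1 := W.a_mul_a k
    have h2 := W.a_mul_a (k - 1)
    have h3 := W.a_mul_b k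
    rw [sub_add_cancel] at h2
    rw [wt, cross, h, h, deg]
    linear_combination h1 + h2 + h3
  · have h1 := W.a_mul_b k
    have h2 := W.a_mul_b (k + 3)
    have h3 := W.b_mul_b k
    have h4 := W.b_mul_b (k + 5)
    have e : k + 5 + 1 = k := by clear * -; revert k; decide
    rw [W.b_add_three] at h2
    rw [e, ← hb] at h4
    rw [wt, cross, h, h, crossLong]
    linear_combination h1 + h2 + h3 + h4

end Weight


/-! ### The types of arc triples -/

lemma crosses_congr {e e' f f' : ArcClass} (h : e.Same e') (h' : f.Same f') :
    e.Crosses f ↔ e'.Crosses f' := by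
  change Alternate e.s e.t f.s f.t ↔ Alternate e'.s e'.t f'.s f'.t
  rcases h with ⟨h1, h2⟩ | ⟨h1, h2⟩ <;> rcases h' with ⟨h3, h4⟩ | ⟨h3, h4⟩ <;>
    rw [h1, h2, h3, h4]
  · exact alternate_swap_right
  · exact alternate_swap_left
  · rw [alternate_swap_left]
    exact alternate_swap_right

/-- The number of the opposite pair of sides, as a side. -/
def toSide (k : Fin 3) : Fin 6 := k.castLE (by norm_num)

/-- The value at a class, given by its number among the nine classes. -/
def codeEv (f g : Fin 6 → ℝ) (c : Fin 6 ⊕ Fin 3) : ℝ := Sum.elim f (fun k => g (toSide k)) c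

lemma ArcClass.exists_code (e : ArcClass) : ∃ c, e.Same (classOf c) ∧
    ∀ f g : Fin 6 → ℝ, (∀ k, g (k + 3) = g k) → e.ev f g = codeEv f g c := by
  rcases e.ev_cases with ⟨k, hk, h⟩ | ⟨k, hk, h⟩
  · exact ⟨Sum.inl k, hk, fun f g _ => h f g⟩
  · obtain ⟨c, hc⟩ : ∃ c : Fin 3, k = toSide c ∨ k = toSide c + 3 := by
      clear * -; revert k; decide
    refine ⟨Sum.inr c, ?_, fun f g hg => ?_⟩
    · rcases hc with rfl | rfl
      · exact hk
      · rcases hk with ⟨h1, h2⟩ | ⟨h1, h2⟩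
        · exact Or.inr ⟨h1, h2.trans ((by decide : ∀ k : Fin 6, k + 3 + 3 = k) _)⟩
        · exact Or.inl ⟨h1.trans ((by decide : ∀ k : Fin 6, k + 3 + 3 = k) _), h2⟩
    · rw [h]
      rcases hc with rfl | rfl
      · rfl
      · exact hg _

-- The fourteen triples: two formed by arcs parallel to alternate sides, and twelve formed by one of
-- three long arcs with a choice of two short arcs on each side of it.
set_option synthInstance.maxSize 1000 in
lemma code_cases : ∀ c₀ c₁ : Fin 6 ⊕ Fin 3, c₀ ≠ c₁ → ¬ (classOf c₀).Crosses (classOf c₁) →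
    ∀ c₂, c₀ ≠ c₂ → c₁ ≠ c₂ → ¬ (classOf c₀).Crosses (classOf c₂) →
    ¬ (classOf c₁).Crosses (classOf c₂) →
    (∃ k : Fin 6, (Sum.inl k = c₀ ∨ Sum.inl k = c₁ ∨ Sum.inl k = c₂) ∧ (Sum.inl (2 + k) = c₀ ∨ Sum.inl (2 + k) = c₁ ∨ Sum.inl (2 + k) = c₂) ∧
      (Sum.inl (4 + k) = c₀ ∨ Sum.inl (4 + k) = c₁ ∨ Sum.inl (4 + k) = c₂)) ∨
    (∃ k : Fin 3, (Sum.inr k = c₀ ∨ Sum.inr k = c₁ ∨ Sum.inr k = c₂) ∧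
      (∃ i : Fin 6, (i = 1 ∨ i = 2) ∧ (Sum.inl (i + toSide k) = c₀ ∨ Sum.inl (i + toSide k) = c₁ ∨ Sum.inl (i + toSide k) = c₂)) ∧
      (∃ j : Fin 6, (j = 4 ∨ j = 5) ∧ (Sum.inl (j + toSide k) = c₀ ∨ Sum.inl (j + toSide k) = c₁ ∨ Sum.inl (j + toSide k) = c₂))) := by
  decide +kernel

/-- The three arcs are parallel to alternate sides. -/
structure ArcTriple.Tripod (d : ArcTriple) (j₀ j₁ j₂ : Fin 3) (k : Fin 6) : Prop where
  cover : ∀ j, j = j₀ ∨ j = j₁ ∨ j = j₂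
  ev₀ : ∀ f g : Fin 6 → ℝ, (∀ k, g (k + 3) = g k) → (d.arc j₀).ev f g = f k
  ev₁ : ∀ f g : Fin 6 → ℝ, (∀ k, g (k + 3) = g k) → (d.arc j₁).ev f g = f (2 + k)
  ev₂ : ∀ f g : Fin 6 → ℝ, (∀ k, g (k + 3) = g k) → (d.arc j₂).ev f g = f (4 + k)

/-- One of the three arcs joins opposite sides; the others are on its two sides. -/
structure ArcTriple.Zigzag (d : ArcTriple) (j₀ j₁ j₂ : Fin 3) (k p q : Fin 6) : Prop where
  cover : ∀ j, j = j₀ ∨ j = j₁ ∨ j = j₂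
  hp : p = 1 ∨ p = 2
  hq : q = 4 ∨ q = 5
  ev₀ : ∀ f g : Fin 6 → ℝ, (∀ k, g (k + 3) = g k) → (d.arc j₀).ev f g = g k
  ev₁ : ∀ f g : Fin 6 → ℝ, (∀ k, g (k + 3) = g k) → (d.arc j₁).ev f g = f (p + k)
  ev₂ : ∀ f g : Fin 6 → ℝ, (∀ k, g (k + 3) = g k) → (d.arc j₂).ev f g = f (q + k)

lemma ArcTriple.exists_type (d : ArcTriple) :
    (∃ j₀ j₁ j₂ k, d.Tripod j₀ j₁ j₂ k) ∨ (∃ j₀ j₁ j₂ k p q, d.Zigzag j₀ j₁ j₂ k p q) := by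
  choose c hc hev using fun j => (d.arc j).exists_code
  have hne : ∀ i j, i ≠ j → c i ≠ c j := by
    intro i j hij h
    have h1 := hc i
    have h2 := hc j
    rw [h] at h1
    refine d.not_same i j hij ?_
    rcases h1 with ⟨a, b⟩ | ⟨a, b⟩ <;> rcases h2 with ⟨a', b'⟩ | ⟨a', b'⟩
    · exact Or.inl ⟨a.trans a'.symm, b.trans b'.symm⟩
    · exact Or.inr ⟨a.trans b'.symm, b.trans a'.symm⟩
    · exact Or.inr ⟨a.trans b'.symm, b.trans a'.symm⟩
    · exact Or.inl ⟨a.trans a'.symm, b.trans b'.symm⟩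
  have hcr : ∀ i j, i ≠ j → ¬ (classOf (c i)).Crosses (classOf (c j)) := by
    intro i j hij
    rw [← crosses_congr (hc i) (hc j)]
    exact d.disjoint i j hij
  have hX : ∀ x, (x = c 0 ∨ x = c 1 ∨ x = c 2) → ∃ j, c j = x := by
    rintro x (h | h | h)
    exacts [⟨0, h.symm⟩, ⟨1, h.symm⟩, ⟨2, h.symm⟩]
  have hcov : ∀ j₀ j₁ j₂ : Fin 3, j₀ ≠ j₁ → j₀ ≠ j₂ → j₁ ≠ j₂ → ∀ j, j = j₀ ∨ j = j₁ ∨ j = j₂ := by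
    clear * -; decide
  have hev' : ∀ {j x}, c j = x → ∀ f g : Fin 6 → ℝ, (∀ k, g (k + 3) = g k) →
      (d.arc j).ev f g = codeEv f g x := fun h f g hg => by rw [hev _ f g hg, h]
  rcases code_cases (c 0) (c 1) (hne _ _ (by decide)) (hcr _ _ (by decide)) (c 2)
    (hne _ _ (by decide)) (hne _ _ (by decide)) (hcr _ _ (by decide)) (hcr _ _ (by decide)) with
    ⟨k, h0, h1, h2⟩ | ⟨k, h0, ⟨p, hp, h1⟩, q, hq, h2⟩
  · obtain ⟨j₀, e0⟩ := hX _ h0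
    obtain ⟨j₁, e1⟩ := hX _ h1
    obtain ⟨j₂, e2⟩ := hX _ h2
    refine Or.inl ⟨j₀, j₁, j₂, k, hcov _ _ _ ?_ ?_ ?_, hev' e0, hev' e1, hev' e2⟩
    · rintro rfl
      have := Sum.inl_injective (e0.symm.trans e1)
      clear * - this; revert k; decide
    · rintro rfl
      have := Sum.inl_injective (e0.symm.trans e2)
      clear * - this; revert k; decide
    · rintro rfl
      have := Sum.inl_injective (e1.symm.trans e2)
      clear * - this; revert k; decide
  · obtain ⟨j₀, e0⟩ := hX _ h0
    obtain ⟨j₁, e1⟩ := hX _ h1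
    obtain ⟨j₂, e2⟩ := hX _ h2
    refine Or.inr ⟨j₀, j₁, j₂, toSide k, p, q, hcov _ _ _ ?_ ?_ ?_, hp, hq, hev' e0, hev' e1,
      hev' e2⟩
    · rintro rfl
      exact Sum.inl_ne_inr (e1.symm.trans e0)
    · rintro rfl
      exact Sum.inl_ne_inr (e2.symm.trans e0)
    · rintro rfl
      have := add_right_cancel (Sum.inl_injective (e1.symm.trans e2))
      rcases hp with rfl | rfl <;> rcases hq with rfl | rfl <;> exact absurd this (by decide)

/-! ### Weights without leaves parallel to the arcs of a triple -/

/-- Nonnegative numbers with product zero are the positive and negative parts of their difference.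
-/
lemma eq_and_eq_of_sub_eq {x y x' y' : ℝ} (hx : 0 ≤ x) (hy : 0 ≤ y) (hx' : 0 ≤ x') (hy' : 0 ≤ y')
    (h : x * y = 0) (h' : x' * y' = 0) (e : x - y = x' - y') : x = x' ∧ y = y' := by
  rcases mul_eq_zero.1 h with h | h <;> rcases mul_eq_zero.1 h' with h' | h' <;>
    constructor <;> linarith

namespace Weight

lemma crossLong_add_three (W : Weight) (k : Fin 6) : W.crossLong (k + 3) = W.crossLong k := by
  have h1 := W.b_add_three (k + 1)
  have h2 := W.b_add_three (k + 2)
  have e : k + 3 + 3 = k := by clear * -; revert k; decide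
  rw [crossLong, crossLong, e, add_right_comm k 3 1, add_right_comm k 3 2, h1, h2]
  ring

lemma crossLong_zero (W : Weight) : W.crossLong 0 = W.a 0 + W.a 3 + W.b 1 + W.b 2 := rfl

lemma mul_eqs (W : Weight) : (W.a 0 * W.a 1 = 0 ∧ W.a 1 * W.a 2 = 0 ∧ W.a 2 * W.a 3 = 0 ∧
    W.a 3 * W.a 4 = 0 ∧ W.a 4 * W.a 5 = 0 ∧ W.a 5 * W.a 0 = 0) ∧
    (W.a 0 * W.b 0 = 0 ∧ W.a 1 * W.b 1 = 0 ∧ W.a 2 * W.b 2 = 0 ∧ W.a 3 * W.b 0 = 0 ∧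
    W.a 4 * W.b 1 = 0 ∧ W.a 5 * W.b 2 = 0) ∧
    (W.b 0 * W.b 1 = 0 ∧ W.b 1 * W.b 2 = 0 ∧ W.b 2 * W.b 0 = 0) := by
  have h3 := W.a_mul_b 3
  have h4 := W.a_mul_b 4
  have h5 := W.a_mul_b 5
  have h2 := W.b_mul_b 2
  rw [show W.b 3 = W.b 0 from W.b_add_three 0] at h3
  rw [show W.b 4 = W.b 1 from W.b_add_three 1] at h4
  rw [show W.b 5 = W.b 2 from W.b_add_three 2] at h5
  rw [show W.b (2 + 1) = W.b 0 from W.b_add_three 0] at h2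
  exact ⟨⟨W.a_mul_a 0, W.a_mul_a 1, W.a_mul_a 2, W.a_mul_a 3, W.a_mul_a 4, W.a_mul_a 5⟩,
    ⟨W.a_mul_b 0, W.a_mul_b 1, W.a_mul_b 2, h3, h4, h5⟩, W.b_mul_b 0, W.b_mul_b 1, h2⟩

/-- The defect `deg 0 + deg 2 - deg 4` in the triangle inequality equals `2 * a 1 + b 0 + b 2 - b
1`, and `b 1` excludes the other three classes, so `b 1` is its negative part. The cyclic analogues
give all `b`, and then the `a` follow linearly. -/
lemma eq_of_tripod {W W' : Weight} (h0 : W.a 0 = 0) (h2 : W.a 2 = 0) (h4 : W.a 4 = 0)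
    (h0' : W'.a 0 = 0) (h2' : W'.a 2 = 0) (h4' : W'.a 4 = 0) (e0 : W.deg 0 = W'.deg 0)
    (e2 : W.deg 2 = W'.deg 2) (e4 : W.deg 4 = W'.deg 4) : W = W' := by
  obtain ⟨d0, -, d2, -, d4, -⟩ := W.deg_eqs
  obtain ⟨d0', -, d2', -, d4', -⟩ := W'.deg_eqs
  obtain ⟨-, ⟨-, q1, -, q3, -, q5⟩, r0, r1, r2⟩ := W.mul_eqs
  obtain ⟨-, ⟨-, q1', -, q3', -, q5'⟩, r0', r1', r2'⟩ := W'.mul_eqs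
  have n := W.a_nonneg
  have n' := W'.a_nonneg
  have m := W.b_nonneg
  have m' := W'.b_nonneg
  have y1 := eq_and_eq_of_sub_eq (x := 2 * W.a 1 + W.b 0 + W.b 2) (y := W.b 1)
    (x' := 2 * W'.a 1 + W'.b 0 + W'.b 2) (y' := W'.b 1)
    (by linarith [n 1, m 0, m 2]) (m 1) (by linarith [n' 1, m' 0, m' 2]) (m' 1)
    (by linear_combination 2 * q1 + r0 + r1) (by linear_combination 2 * q1' + r0' + r1')
    (by linarith)
  have y0 := eq_and_eq_of_sub_eq (x := 2 * W.a 3 + W.b 1 + W.b 2) (y := W.b 0)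
    (x' := 2 * W'.a 3 + W'.b 1 + W'.b 2) (y' := W'.b 0)
    (by linarith [n 3, m 1, m 2]) (m 0) (by linarith [n' 3, m' 1, m' 2]) (m' 0)
    (by linear_combination 2 * q3 + r0 + r2) (by linear_combination 2 * q3' + r0' + r2')
    (by linarith)
  have y2 := eq_and_eq_of_sub_eq (x := 2 * W.a 5 + W.b 0 + W.b 1) (y := W.b 2)
    (x' := 2 * W'.a 5 + W'.b 0 + W'.b 1) (y' := W'.b 2)
    (by linarith [n 5, m 0, m 1]) (m 2) (by linarith [n' 5, m' 0, m' 1]) (m' 2)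
    (by linear_combination 2 * q5 + r1 + r2) (by linear_combination 2 * q5' + r1' + r2')
    (by linarith)
  exact ext_of_eqs (by linarith) (by linarith) (by linarith) (by linarith) (by linarith)
    (by linarith) y0.2 y1.2 y2.2

/-- The difference of `crossLong 0` and `deg p` is a difference of two mutually exclusive weights,
and similarly for `q`. The parts found then give `b 1 - b 2`, again with exclusive terms, and
everything else is linear. -/
lemma eq_of_zigzag {W W' : Weight} {p q : Fin 6} (hp : p = 1 ∨ p = 2) (hq : q = 4 ∨ q = 5)
    (z0 : W.b 0 = 0) (zp : W.a p = 0) (zq : W.a q = 0)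
    (z0' : W'.b 0 = 0) (zp' : W'.a p = 0) (zq' : W'.a q = 0)
    (e0 : W.crossLong 0 = W'.crossLong 0) (ep : W.deg p = W'.deg p)
    (eq : W.deg q = W'.deg q) : W = W' := by
  obtain ⟨-, d1, d2, -, d4, d5⟩ := W.deg_eqs
  obtain ⟨-, d1', d2', -, d4', d5'⟩ := W'.deg_eqs
  obtain ⟨⟨p0, p1, p2, p3, p4, p5⟩, ⟨-, q1, q2, -, q4, q5⟩, -, r1, -⟩ := W.mul_eqs
  obtain ⟨⟨p0', p1', p2', p3', p4', p5'⟩, ⟨-, q1', q2', -, q4', q5'⟩, -, r1', -⟩ := W'.mul_eqs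
  have n := W.a_nonneg
  have n' := W'.a_nonneg
  have m := W.b_nonneg
  have m' := W'.b_nonneg
  have x := W.crossLong_zero
  have x' := W'.crossLong_zero
  have B : W.b 1 - W.b 2 = W'.b 1 - W'.b 2 → W.b 1 = W'.b 1 ∧ W.b 2 = W'.b 2 :=
    eq_and_eq_of_sub_eq (m 1) (m 2) (m' 1) (m' 2) r1 r1'
  rcases hp with rfl | rfl
  · have P := eq_and_eq_of_sub_eq (n 2) (add_nonneg (n 3) (m 2)) (n' 2)
      (add_nonneg (n' 3) (m' 2)) (by linear_combination p2 + q2)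
      (by linear_combination p2' + q2') (by linarith : W.a 2 - (W.a 3 + W.b 2) = W'.a 2 - (W'.a 3 + W'.b 2))
    rcases hq with rfl | rfl
    · have Q := eq_and_eq_of_sub_eq (n 5) (add_nonneg (n 0) (m 2)) (n' 5)
        (add_nonneg (n' 0) (m' 2)) (by linear_combination p5 + q5)
        (by linear_combination p5' + q5') (by linarith : W.a 5 - (W.a 0 + W.b 2) = W'.a 5 - (W'.a 0 + W'.b 2))
      obtain ⟨B1, B2⟩ := B (by linarith)
      apply ext_of_eqs <;> linarith
    · have Q := eq_and_eq_of_sub_eq (n 4) (add_nonneg (n 3) (m 1)) (n' 4)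
        (add_nonneg (n' 3) (m' 1)) (by linear_combination p3 + q4)
        (by linear_combination p3' + q4') (by linarith : W.a 4 - (W.a 3 + W.b 1) = W'.a 4 - (W'.a 3 + W'.b 1))
      obtain ⟨B1, B2⟩ := B (by linarith)
      apply ext_of_eqs <;> linarith
  · have P := eq_and_eq_of_sub_eq (n 1) (add_nonneg (n 0) (m 1)) (n' 1)
      (add_nonneg (n' 0) (m' 1)) (by linear_combination p0 + q1)
      (by linear_combination p0' + q1') (by linarith : W.a 1 - (W.a 0 + W.b 1) = W'.a 1 - (W'.a 0 + W'.b 1))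
    rcases hq with rfl | rfl
    · have Q := eq_and_eq_of_sub_eq (n 5) (add_nonneg (n 0) (m 2)) (n' 5)
        (add_nonneg (n' 0) (m' 2)) (by linear_combination p5 + q5)
        (by linear_combination p5' + q5') (by linarith : W.a 5 - (W.a 0 + W.b 2) = W'.a 5 - (W'.a 0 + W'.b 2))
      obtain ⟨B1, B2⟩ := B (by linarith)
      apply ext_of_eqs <;> linarith
    · have Q := eq_and_eq_of_sub_eq (n 4) (add_nonneg (n 3) (m 1)) (n' 4)
        (add_nonneg (n' 3) (m' 1)) (by linear_combination p3 + q4)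
        (by linear_combination p3' + q4') (by linarith : W.a 4 - (W.a 3 + W.b 1) = W'.a 4 - (W'.a 3 + W'.b 1))
      obtain ⟨B1, B2⟩ := B (by linarith)
      apply ext_of_eqs <;> linarith

end Weight


namespace Weight

lemma le_of_eqs {W : Weight} {C : ℝ} (a0 : W.a 0 ≤ C) (a1 : W.a 1 ≤ C) (a2 : W.a 2 ≤ C)
    (a3 : W.a 3 ≤ C) (a4 : W.a 4 ≤ C) (a5 : W.a 5 ≤ C) (b0 : W.b 0 ≤ C) (b1 : W.b 1 ≤ C)
    (b2 : W.b 2 ≤ C) (k : Fin 6) : W.a k ≤ C ∧ W.b k ≤ C := by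
  have h3 := W.b_add_three 0
  have h4 := W.b_add_three 1
  have h5 := W.b_add_three 2
  rw [← h3] at b0
  rw [← h4] at b1
  rw [← h5] at b2
  fin_cases k
  exacts [⟨a0, h3 ▸ b0⟩, ⟨a1, h4 ▸ b1⟩, ⟨a2, h5 ▸ b2⟩, ⟨a3, b0⟩, ⟨a4, b1⟩, ⟨a5, b2⟩]

lemma le_of_tripod {W : Weight} {C : ℝ} (h0 : W.a 0 = 0) (h2 : W.a 2 = 0) (h4 : W.a 4 = 0)
    (e0 : W.deg 0 ≤ C) (e2 : W.deg 2 ≤ C) (e4 : W.deg 4 ≤ C) (k : Fin 6) :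
    W.a k ≤ C ∧ W.b k ≤ C := by
  obtain ⟨d0, -, d2, -, d4, -⟩ := W.deg_eqs
  have n := W.a_nonneg
  have m := W.b_nonneg
  have n1 := n 1; have n3 := n 3; have n5 := n 5; have m0 := m 0; have m1 := m 1; have m2 := m 2
  apply le_of_eqs <;> linarith

lemma le_of_zigzag {W : Weight} {C : ℝ} {p q : Fin 6} (hp : p = 1 ∨ p = 2) (hq : q = 4 ∨ q = 5)
    (z0 : W.b 0 = 0) (zp : W.a p = 0) (zq : W.a q = 0) (e0 : W.crossLong 0 ≤ C)
    (ep : W.deg p ≤ C) (eq : W.deg q ≤ C) (k : Fin 6) : W.a k ≤ C ∧ W.b k ≤ C := by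
  obtain ⟨-, d1, d2, -, d4, d5⟩ := W.deg_eqs
  have x := W.crossLong_zero
  have n := W.a_nonneg
  have m := W.b_nonneg
  have n0 := n 0; have n1 := n 1; have n2 := n 2; have n3 := n 3; have n4 := n 4; have n5 := n 5
  have m0 := m 0; have m1 := m 1; have m2 := m 2
  rcases hp with rfl | rfl <;> rcases hq with rfl | rfl <;> apply le_of_eqs <;> linarith

variable {d : ArcTriple} {W W' : Weight}

/-- A foliation without leaves parallel to the arcs of a triple is determined by its intersection
numbers with these arcs. -/
theorem eq_of_cross_eq (h : ∀ j, W.wt (d.arc j) = 0) (h' : ∀ j, W'.wt (d.arc j) = 0)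
    (e : ∀ j, W.cross (d.arc j) = W'.cross (d.arc j)) : W = W' := by
  simp only [wt, cross] at h h' e
  rcases d.exists_type with ⟨j₀, j₁, j₂, k, T⟩ | ⟨j₀, j₁, j₂, k, p, q, T⟩
  · have h0 := h j₀; have h1 := h j₁; have h2 := h j₂
    have h0' := h' j₀; have h1' := h' j₁; have h2' := h' j₂
    have e0 := e j₀; have e1 := e j₁; have e2 := e j₂
    rw [T.ev₀ _ _ W.b_add_three] at h0
    rw [T.ev₁ _ _ W.b_add_three] at h1
    rw [T.ev₂ _ _ W.b_add_three] at h2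
    rw [T.ev₀ _ _ W'.b_add_three] at h0'
    rw [T.ev₁ _ _ W'.b_add_three] at h1'
    rw [T.ev₂ _ _ W'.b_add_three] at h2'
    rw [T.ev₀ _ _ W.crossLong_add_three, T.ev₀ _ _ W'.crossLong_add_three] at e0
    rw [T.ev₁ _ _ W.crossLong_add_three, T.ev₁ _ _ W'.crossLong_add_three] at e1
    rw [T.ev₂ _ _ W.crossLong_add_three, T.ev₂ _ _ W'.crossLong_add_three] at e2
    refine eq_of_rotate_eq k (eq_of_tripod ?_ h1 h2 ?_ h1' h2' ?_ ?_ ?_)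
    · simpa only [rotate, zero_add] using h0
    · simpa only [rotate, zero_add] using h0'
    · simpa only [deg_rotate, zero_add] using e0
    · simpa only [deg_rotate] using e1
    · simpa only [deg_rotate] using e2
  · have h0 := h j₀; have h1 := h j₁; have h2 := h j₂
    have h0' := h' j₀; have h1' := h' j₁; have h2' := h' j₂
    have e0 := e j₀; have e1 := e j₁; have e2 := e j₂
    rw [T.ev₀ _ _ W.b_add_three] at h0
    rw [T.ev₁ _ _ W.b_add_three] at h1
    rw [T.ev₂ _ _ W.b_add_three] at h2
    rw [T.ev₀ _ _ W'.b_add_three] at h0'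
    rw [T.ev₁ _ _ W'.b_add_three] at h1'
    rw [T.ev₂ _ _ W'.b_add_three] at h2'
    rw [T.ev₀ _ _ W.crossLong_add_three, T.ev₀ _ _ W'.crossLong_add_three] at e0
    rw [T.ev₁ _ _ W.crossLong_add_three, T.ev₁ _ _ W'.crossLong_add_three] at e1
    rw [T.ev₂ _ _ W.crossLong_add_three, T.ev₂ _ _ W'.crossLong_add_three] at e2
    refine eq_of_rotate_eq k (eq_of_zigzag T.hp T.hq ?_ h1 h2 ?_ h1' h2' ?_ ?_ ?_)
    · simpa only [rotate, zero_add] using h0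
    · simpa only [rotate, zero_add] using h0'
    · simpa only [crossLong_rotate, zero_add] using e0
    · simpa only [deg_rotate] using e1
    · simpa only [deg_rotate] using e2

/-- Away from the classes of the triple, every class crosses an arc of it. This gives compactness,
and with `C = 0` it shows that a weight disjoint from the triple and not parallel to it is zero. -/
lemma le_of_cross_le {C : ℝ} (h : ∀ j, W.wt (d.arc j) = 0) (e : ∀ j, W.cross (d.arc j) ≤ C)
    (i : Fin 6) : W.a i ≤ C ∧ W.b i ≤ C := by
  simp only [wt, cross] at h e
  rcases d.exists_type with ⟨j₀, j₁, j₂, k, T⟩ | ⟨j₀, j₁, j₂, k, p, q, T⟩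
  · have h0 := h j₀; have h1 := h j₁; have h2 := h j₂
    have e0 := e j₀; have e1 := e j₁; have e2 := e j₂
    rw [T.ev₀ _ _ W.b_add_three] at h0
    rw [T.ev₁ _ _ W.b_add_three] at h1
    rw [T.ev₂ _ _ W.b_add_three] at h2
    rw [T.ev₀ _ _ W.crossLong_add_three] at e0
    rw [T.ev₁ _ _ W.crossLong_add_three] at e1
    rw [T.ev₂ _ _ W.crossLong_add_three] at e2
    have := le_of_tripod (W := W.rotate k) (C := C) (by simpa only [rotate, zero_add] using h0) h1
      h2 (by simpa only [deg_rotate, zero_add] using e0) (by simpa only [deg_rotate] using e1)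
      (by simpa only [deg_rotate] using e2) (i - k)
    simpa only [rotate, sub_add_cancel] using this
  · have h0 := h j₀; have h1 := h j₁; have h2 := h j₂
    have e0 := e j₀; have e1 := e j₁; have e2 := e j₂
    rw [T.ev₀ _ _ W.b_add_three] at h0
    rw [T.ev₁ _ _ W.b_add_three] at h1
    rw [T.ev₂ _ _ W.b_add_three] at h2
    rw [T.ev₀ _ _ W.crossLong_add_three] at e0
    rw [T.ev₁ _ _ W.crossLong_add_three] at e1
    rw [T.ev₂ _ _ W.crossLong_add_three] at e2
    have := le_of_zigzag (W := W.rotate k) (C := C) T.hp T.hq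
      (by simpa only [rotate, zero_add] using h0) h1
      h2 (by simpa only [crossLong_rotate, zero_add] using e0)
      (by simpa only [deg_rotate] using e1) (by simpa only [deg_rotate] using e2) (i - k)
    simpa only [rotate, sub_add_cancel] using this

end Weight

/-! ### Hexagons with given lengths of the arcs of a triple -/

lemma exists_isHex_add {f : Fin 6 → ℝ} (h : IsHex f) (k : Fin 6) :
    ∃ l, IsHex l ∧ ∀ i, l (i + k) = f i :=
  ⟨fun i => f (i + -k), h.rotate (-k), fun i => congrArg f (add_neg_cancel_right i k)⟩

/-- A right hexagon is determined by the lengths of the arcs of a triple. -/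
theorem IsHex.eq_of_hexLen_eq {d : ArcTriple} {l l' : Fin 6 → ℝ} (h : IsHex l) (h' : IsHex l')
    (e : ∀ j, hexLen l (d.arc j) = hexLen l' (d.arc j)) : l = l' := by
  simp only [hexLen] at e
  rcases d.exists_type with ⟨j₀, j₁, j₂, k, T⟩ | ⟨j₀, j₁, j₂, k, p, q, T⟩
  · have e0 := e j₀; have e1 := e j₁; have e2 := e j₂
    rw [T.ev₀ _ _ h.longLen_add_three, T.ev₀ _ _ h'.longLen_add_three] at e0
    rw [T.ev₁ _ _ h.longLen_add_three, T.ev₁ _ _ h'.longLen_add_three, add_comm] at e1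
    rw [T.ev₂ _ _ h.longLen_add_three, T.ev₂ _ _ h'.longLen_add_three, add_comm] at e2
    exact h.eq_of_alternate h' e0 e1 e2
  · have e0 := e j₀; have e1 := e j₁; have e2 := e j₂
    rw [T.ev₀ _ _ h.longLen_add_three, T.ev₀ _ _ h'.longLen_add_three] at e0
    rw [T.ev₁ _ _ h.longLen_add_three, T.ev₁ _ _ h'.longLen_add_three, add_comm] at e1
    rw [T.ev₂ _ _ h.longLen_add_three, T.ev₂ _ _ h'.longLen_add_three, add_comm] at e2
    -- The long arc fixes the product of hyperbolic sines in both pentagons, so in each of them the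
    -- known side determines its partner.
    have c := congrArg cosh e0
    rw [h.cosh_longLen, h'.cosh_longLen] at c
    have c' := c
    rw [h.sine', h'.sine'] at c'
    have inj : ∀ {x y}, sinh (l x) * sinh (l y) = sinh (l' x) * sinh (l' y) → l x = l' x →
        l y = l' y := by
      intro x y hxy hx
      rw [hx] at hxy
      exact sinh_injective (mul_left_cancel₀ (h'.sinh_pos x).ne' hxy)
    have inj' : ∀ {x y}, sinh (l x) * sinh (l y) = sinh (l' x) * sinh (l' y) → l y = l' y →
        l x = l' x := by
      intro x y hxy hy
      rw [hy] at hxy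
      exact sinh_injective (mul_right_cancel₀ (h'.sinh_pos y).ne' hxy)
    have A : l (k + 1) = l' (k + 1) ∧ l (k + 2) = l' (k + 2) := by
      rcases T.hp with rfl | rfl
      · exact ⟨e1, inj c e1⟩
      · exact ⟨inj' c e1, e1⟩
    have B : l (k + 4) = l' (k + 4) ∧ l (k + 5) = l' (k + 5) := by
      rcases T.hq with rfl | rfl
      · exact ⟨e2, inj c' e2⟩
      · exact ⟨inj' c' e2, e2⟩
    exact h.eq_of_pairs h' A.1 A.2 B.1 B.2

/-- The two sides of a pentagon have a prescribed product of hyperbolic sines. The comparison of `p`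
with `c` says which of them is given; the other is solved for. -/
lemma exists_pair {p : Fin 6} {C x : ℝ} (hC : 0 < C) (hx : 0 < x) (c : Fin 6) :
    ∃ u v, 0 < u ∧ 0 < v ∧ sinh u * sinh v = C ∧ (p = c → u = x) ∧ (p ≠ c → v = x) := by
  have hs := sinh_pos_iff.2 hx
  have hy : 0 < arsinh (C / sinh x) := arsinh_pos_iff.2 (by positivity)
  have e : sinh (arsinh (C / sinh x)) = C / sinh x := sinh_arsinh _
  by_cases h : p = c
  · exact ⟨x, _, hx, hy, by rw [e]; field_simp, fun _ => rfl, fun h' => absurd h h'⟩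
  · exact ⟨_, x, hy, hx, by rw [e]; field_simp, fun h' => absurd h' h, fun _ => rfl⟩

/-- The lengths of the arcs of a triple may be given arbitrarily. -/
theorem exists_isHex_hexLen (d : ArcTriple) {y : Fin 3 → ℝ} (hy : ∀ j, 0 < y j) :
    ∃ l, IsHex l ∧ ∀ j, hexLen l (d.arc j) = y j := by
  rcases d.exists_type with ⟨j₀, j₁, j₂, k, T⟩ | ⟨j₀, j₁, j₂, k, p, q, T⟩
  · obtain ⟨l1, l3, l5, h⟩ := exists_isHex_of_alternate (hy j₀) (hy j₁) (hy j₂)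
    obtain ⟨l, hl, hk⟩ := exists_isHex_add h k
    refine ⟨l, hl, fun j => ?_⟩
    rcases T.cover j with rfl | rfl | rfl
    · rw [hexLen, T.ev₀ _ _ hl.longLen_add_three, ← zero_add k, hk]; rfl
    · rw [hexLen, T.ev₁ _ _ hl.longLen_add_three, hk]; rfl
    · rw [hexLen, T.ev₂ _ _ hl.longLen_add_three, hk]; rfl
  · have hC := cosh_pos (y j₀)
    obtain ⟨l1, l2, h1, h2, e12, ep, ep'⟩ := exists_pair (p := p) hC (hy j₁) 1
    obtain ⟨l4, l5, h4, h5, e45, eq, eq'⟩ := exists_pair (p := q) hC (hy j₂) 4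
    obtain ⟨l0, l3, h⟩ := exists_isHex_of_pairs h1 h2 h4 h5 (e12.trans e45.symm)
      (by rw [e12]; exact one_lt_cosh.2 (hy j₀).ne')
    obtain ⟨l, hl, hk⟩ := exists_isHex_add h k
    refine ⟨l, hl, fun j => ?_⟩
    rcases T.cover j with rfl | rfl | rfl
    · rw [hexLen, T.ev₀ _ _ hl.longLen_add_three]
      refine cosh_inj_of_pos (hl.longLen_pos k) (hy _) ?_
      rw [hl.cosh_longLen, add_comm k 1, add_comm k 2, hk, hk]
      exact e12
    · rw [hexLen, T.ev₁ _ _ hl.longLen_add_three, hk]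
      rcases T.hp with rfl | rfl
      · exact ep rfl
      · exact ep' (by decide)
    · rw [hexLen, T.ev₂ _ _ hl.longLen_add_three, hk]
      rcases T.hq with rfl | rfl
      · exact eq rfl
      · exact eq' (by decide)

/-! ### Limits of weights -/

section
variable {ι : Type*} {𝒰 : Ultrafilter ι}

lemma tendsto_ev {f g : ι → Fin 6 → ℝ} {f' g' : Fin 6 → ℝ}
    (hf : ∀ k, Tendsto (fun n => f n k) 𝒰 (𝓝 (f' k)))
    (hg : ∀ k, Tendsto (fun n => g n k) 𝒰 (𝓝 (g' k))) (e : ArcClass) :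
    Tendsto (fun n => e.ev (f n) (g n)) 𝒰 (𝓝 (e.ev f' g')) := by
  rcases e.ev_cases with ⟨k, -, h⟩ | ⟨k, -, h⟩
  · simp only [h]; exact hf k
  · simp only [h]; exact hg k

/-- Convergence of weights. -/
def Weight.ConvergesTo (𝒰 : Ultrafilter ι) (W : ι → Weight) (W' : Weight) : Prop :=
  (∀ k, Tendsto (fun n => (W n).a k) 𝒰 (𝓝 (W'.a k))) ∧
    ∀ k, Tendsto (fun n => (W n).b k) 𝒰 (𝓝 (W'.b k))

namespace Weight

variable {W : ι → Weight} {W' : Weight}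

lemma ConvergesTo.deg (h : ConvergesTo 𝒰 W W') (k : Fin 6) :
    Tendsto (fun n => (W n).deg k) 𝒰 (𝓝 (W'.deg k)) :=
  ((h.1 _).add (h.1 _)).add (h.2 _)

lemma ConvergesTo.crossLong (h : ConvergesTo 𝒰 W W') (k : Fin 6) :
    Tendsto (fun n => (W n).crossLong k) 𝒰 (𝓝 (W'.crossLong k)) :=
  (((h.1 _).add (h.1 _)).add (h.2 _)).add (h.2 _)

lemma ConvergesTo.wt (h : ConvergesTo 𝒰 W W') (e : ArcClass) :
    Tendsto (fun n => (W n).wt e) 𝒰 (𝓝 (W'.wt e)) := tendsto_ev h.1 h.2 e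

lemma ConvergesTo.cross (h : ConvergesTo 𝒰 W W') (e : ArcClass) :
    Tendsto (fun n => (W n).cross e) 𝒰 (𝓝 (W'.cross e)) := tendsto_ev h.deg h.crossLong e

/-- Bounded weights have a limit. -/
lemma exists_convergesTo {C : ℝ} (h : ∀ᶠ n in 𝒰, ∀ k, (W n).a k ≤ C ∧ (W n).b k ≤ C) :
    ∃ W', ConvergesTo 𝒰 W W' := by
  have ha : ∀ k, ∃ x, Tendsto (fun n => (W n).a k) 𝒰 (𝓝 x) := fun k =>
    exists_tendsto_of_bounds (a := 0) (h.mono fun n hn => ⟨(W n).a_nonneg k, (hn k).1⟩)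
  have hb : ∀ k, ∃ x, Tendsto (fun n => (W n).b k) 𝒰 (𝓝 x) := fun k =>
    exists_tendsto_of_bounds (a := 0) (h.mono fun n hn => ⟨(W n).b_nonneg k, (hn k).2⟩)
  choose a ha using ha
  choose b hb using hb
  refine ⟨⟨a, b, fun k => ?_, fun k => ?_, fun k => ?_, fun k => ?_, fun k => ?_, fun k => ?_⟩,
    ha, hb⟩
  · exact tendsto_nhds_unique (hb (k + 3)) (by simpa only [b_add_three] using hb k)
  · exact ge_of_tendsto' (ha k) fun n => (W n).a_nonneg k
  · exact ge_of_tendsto' (hb k) fun n => (W n).b_nonneg k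
  · exact tendsto_nhds_unique ((ha k).mul (ha (k + 1))) (by simp only [a_mul_a, tendsto_const_nhds])
  · exact tendsto_nhds_unique ((ha k).mul (hb k)) (by simp only [a_mul_b, tendsto_const_nhds])
  · exact tendsto_nhds_unique ((hb k).mul (hb (k + 1))) (by simp only [b_mul_b, tendsto_const_nhds])

lemma a_le_deg (W : Weight) (k : Fin 6) : W.a k ≤ W.deg (k - 1) := by
  have h1 := W.a_nonneg (k - 1 - 1)
  have h2 := W.b_nonneg (k - 1)
  rw [Weight.deg, sub_add_cancel]
  linarith

lemma b_le_deg (W : Weight) (k : Fin 6) : W.b k ≤ W.deg k := by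
  have h1 := W.a_nonneg (k - 1)
  have h2 := W.a_nonneg (k + 1)
  rw [Weight.deg]
  linarith

/-- The inverse of `deg` is continuous; the image of `deg` is closed. -/
theorem exists_convergesTo_of_deg {v : Fin 6 → ℝ}
    (h : ∀ k, Tendsto (fun n => (W n).deg k) 𝒰 (𝓝 (v k))) :
    ∃ W', ConvergesTo 𝒰 W W' ∧ W'.deg = v := by
  obtain ⟨W', hW'⟩ : ∃ W', ConvergesTo 𝒰 W W' := by
    refine exists_convergesTo (C := ∑ k, (|v k| + 1)) ?_
    have h1 : ∀ᶠ n in 𝒰, ∀ k, (W n).deg k < |v k| + 1 := eventually_all.2 fun k =>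
      (h k).eventually_lt_const (by linarith [le_abs_self (v k)])
    have h2 : ∀ k, |v k| + 1 ≤ ∑ k, (|v k| + 1) := fun k =>
      Finset.single_le_sum (f := fun k => |v k| + 1) (fun i _ => by positivity) (Finset.mem_univ k)
    filter_upwards [h1] with n hn k
    exact ⟨((W n).a_le_deg k).trans ((hn _).le.trans (h2 _)),
      ((W n).b_le_deg k).trans ((hn _).le.trans (h2 _))⟩
  exact ⟨W', hW', funext fun k => tendsto_nhds_unique (hW'.deg k) (h k)⟩

theorem convergesTo_of_deg (h : ∀ k, Tendsto (fun n => (W n).deg k) 𝒰 (𝓝 (W'.deg k))) :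
    ConvergesTo 𝒰 W W' := by
  obtain ⟨W'', hW, e⟩ := exists_convergesTo_of_deg h
  rwa [deg_injective e] at hW

theorem exists_convergesTo_of_cross {d : ArcTriple} {x : Fin 3 → ℝ}
    (h0 : ∀ᶠ n in 𝒰, ∀ j, (W n).wt (d.arc j) = 0)
    (h : ∀ j, Tendsto (fun n => (W n).cross (d.arc j)) 𝒰 (𝓝 (x j))) :
    ∃ W', ConvergesTo 𝒰 W W' ∧ (∀ j, W'.wt (d.arc j) = 0) ∧ ∀ j, W'.cross (d.arc j) = x j := by
  obtain ⟨W', hW'⟩ : ∃ W', ConvergesTo 𝒰 W W' := by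
    refine exists_convergesTo (C := ∑ k, (|x k| + 1)) ?_
    have h1 : ∀ᶠ n in 𝒰, ∀ k, (W n).cross (d.arc k) < |x k| + 1 := eventually_all.2 fun k =>
      (h k).eventually_lt_const (by linarith [le_abs_self (x k)])
    have h2 : ∀ k, |x k| + 1 ≤ ∑ k, (|x k| + 1) := fun k =>
      Finset.single_le_sum (f := fun k => |x k| + 1) (fun i _ => by positivity) (Finset.mem_univ k)
    filter_upwards [h1, h0] with n hn hz k
    exact le_of_cross_le hz (fun j => (hn j).le.trans (h2 j)) k
  refine ⟨W', hW', fun j => ?_, fun j => tendsto_nhds_unique (hW'.cross _) (h j)⟩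
  refine tendsto_nhds_unique (hW'.wt _) ((tendsto_congr' ?_).2 tendsto_const_nhds)
  exact h0.mono fun n hn => hn j

end Weight

end


/-! ### Limits of hexagons -/

section
variable {ι : Type*} {𝒰 : Ultrafilter ι}

lemma bounded_or_tendsto_atTop (f : ι → ℝ) : (∃ C, ∀ᶠ n in 𝒰, f n ≤ C) ∨ Tendsto f 𝒰 atTop := by
  by_cases h : ∃ C, ∀ᶠ n in 𝒰, f n ≤ C
  · exact Or.inl h
  · refine Or.inr (tendsto_atTop.2 fun C => ?_)
    rw [not_exists] at h
    exact (Ultrafilter.eventually_not.2 (h C)).mono fun n hn => (not_le.1 hn).le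

lemma IsHex.tendsto_hexLen {l : ι → Fin 6 → ℝ} {v : Fin 6 → ℝ} (hv : IsHex v)
    (h : ∀ k, Tendsto (fun n => l n k) 𝒰 (𝓝 (v k))) (hl : ∀ᶠ n in 𝒰, IsHex (l n))
    (e : ArcClass) : Tendsto (fun n => hexLen (l n) e) 𝒰 (𝓝 (hexLen v e)) := by
  refine tendsto_ev h (fun k => ?_) e
  have h1 : Tendsto (fun n => sinh (l n (k + 1)) * sinh (l n (k + 2))) 𝒰
      (𝓝[Set.Ici 1] (sinh (v (k + 1)) * sinh (v (k + 2)))) :=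
    tendsto_nhdsWithin_iff.2 ⟨((continuous_sinh.tendsto _).comp (h _)).mul
      ((continuous_sinh.tendsto _).comp (h _)), hl.mono fun n hn => (hn.one_lt_long k).le⟩
  exact (continuousOn_arcosh _ (hv.one_lt_long k).le).tendsto.comp h1

/-- The degeneration of hexagons, in terms of arcs. -/
theorem exists_weight_of_tendsto_hexLen {l : ι → Fin 6 → ℝ} {s : ι → ℝ} {v : Fin 6 → ℝ}
    (hl : ∀ᶠ n in 𝒰, IsHex (l n)) (hs : Tendsto s 𝒰 atTop)
    (hv : ∀ k, Tendsto (fun n => l n k / s n) 𝒰 (𝓝 (v k))) :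
    ∃ W : Weight, v = W.deg ∧
      ∀ e, Tendsto (fun n => hexLen (l n) e / s n) 𝒰 (𝓝 (W.cross e)) ∧
        (0 < W.wt e → Tendsto (fun n => hexLen (l n) e) 𝒰 (𝓝 0)) := by
  obtain ⟨W, h1, h2, h3, h4⟩ := exists_weight_of_tendsto hl hs hv
  refine ⟨W, funext h1, fun e => ?_⟩
  rcases e.ev_cases with ⟨k, -, h⟩ | ⟨k, -, h⟩
  · simp only [hexLen, Weight.cross, Weight.wt, h]
    exact ⟨h1 k ▸ hv k, h3 k⟩
  · simp only [hexLen, Weight.cross, Weight.wt, h]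
    exact ⟨h2 k, h4 k⟩

/-- The perimeter. -/
def perim (l : Fin 6 → ℝ) : ℝ := ∑ k, l k

lemma IsHex.perim_pos {l : Fin 6 → ℝ} (h : IsHex l) : 0 < perim l :=
  Finset.sum_pos (fun k _ => h.pos k) Finset.univ_nonempty

lemma IsHex.le_perim {l : Fin 6 → ℝ} (h : IsHex l) (k : Fin 6) : l k ≤ perim l :=
  Finset.single_le_sum (fun i _ => (h.pos i).le) (Finset.mem_univ k)

lemma perim_div (l : Fin 6 → ℝ) (c : ℝ) : perim (fun k => l k / c) = perim l / c :=
  (Finset.sum_div _ _ _).symm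

lemma tendsto_perim {l : ι → Fin 6 → ℝ} {v : Fin 6 → ℝ}
    (h : ∀ k, Tendsto (fun n => l n k) 𝒰 (𝓝 (v k))) :
    Tendsto (fun n => perim (l n)) 𝒰 (𝓝 (perim v)) :=
  tendsto_finsetSum _ fun k _ => h k

/-- The limit weight has perimeter one. As no arc of the triple shrinks, it has no leaf parallel to
the triple; if its crossings with the triple also vanished, it would be zero by `le_of_cross_le`. -/
lemma not_tendsto_hexLen_div_perim {d : ArcTriple} {l : ι → Fin 6 → ℝ}
    (hl : ∀ᶠ n in 𝒰, IsHex (l n)) (hs : Tendsto (fun n => perim (l n)) 𝒰 atTop)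
    (h : ∀ j, ¬ Tendsto (fun n => hexLen (l n) (d.arc j)) 𝒰 (𝓝 0)) :
    ¬ ∀ j, Tendsto (fun n => hexLen (l n) (d.arc j) / perim (l n)) 𝒰 (𝓝 0) := by
  intro h0
  have : ∀ k, ∃ x, Tendsto (fun n => l n k / perim (l n)) 𝒰 (𝓝 x) := fun k => by
    refine exists_tendsto_of_bounds (a := 0) (b := 1) (hl.mono fun n hn => ⟨?_, ?_⟩)
    · exact div_nonneg (hn.pos k).le hn.perim_pos.le
    · exact div_le_one_of_le₀ (hn.le_perim k) hn.perim_pos.le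
  choose v hv using this
  obtain ⟨W, e, hW⟩ := exists_weight_of_tendsto_hexLen hl hs hv
  have hc : ∀ j, W.cross (d.arc j) = 0 := fun j => tendsto_nhds_unique (hW (d.arc j)).1 (h0 j)
  have hw : ∀ j, W.wt (d.arc j) = 0 := fun j => by
    by_contra hne
    exact h j ((hW _).2 ((W.wt_nonneg _).lt_of_ne' hne))
  have hz := Weight.le_of_cross_le hw (fun j => (hc j).le)
  have h1 : perim v = 1 := by
    refine tendsto_nhds_unique (tendsto_perim hv) ((tendsto_congr' ?_).2 tendsto_const_nhds)
    filter_upwards [hl] with n hn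
    rw [perim_div, div_self hn.perim_pos.ne']
  have h2 : perim v = 0 := Finset.sum_eq_zero fun k _ => by
    rw [e]
    refine le_antisymm ?_ (W.deg_nonneg k)
    have := (hz (k + 1)).1
    have := (hz (k - 1)).1
    have := (hz k).2
    rw [Weight.deg]
    linarith
  rw [h1] at h2
  exact one_ne_zero h2

variable {d : ArcTriple}

/-- Hexagons whose lengths on a triple of arcs tend to infinity with limiting proportions. -/
theorem exists_weight_of_tendsto_triple {l : ι → Fin 6 → ℝ} {s : ι → ℝ} {x : Fin 3 → ℝ}
    (hl : ∀ᶠ n in 𝒰, IsHex (l n)) (hs : Tendsto s 𝒰 atTop) (hx : ∀ j, 0 < x j)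
    (h : ∀ j, Tendsto (fun n => hexLen (l n) (d.arc j) / s n) 𝒰 (𝓝 (x j))) :
    ∃ W : Weight, (∀ j, W.wt (d.arc j) = 0) ∧ (∀ j, W.cross (d.arc j) = x j) ∧
      ∀ k, Tendsto (fun n => l n k / s n) 𝒰 (𝓝 (W.deg k)) := by
  have hs0 := hs.eventually_gt_atTop 0
  have hinf : ∀ j, Tendsto (fun n => hexLen (l n) (d.arc j)) 𝒰 atTop := fun j => by
    refine ((h j).pos_mul_atTop (hx j) hs).congr' ?_
    filter_upwards [hs0] with n hn
    rw [div_mul_cancel₀ _ hn.ne']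
  have hne : ∀ j, ¬ Tendsto (fun n => hexLen (l n) (d.arc j)) 𝒰 (𝓝 0) := fun j =>
    not_tendsto_nhds_of_tendsto_atTop (hinf j) 0
  obtain ⟨C, hC⟩ | hinf' := bounded_or_tendsto_atTop (𝒰 := 𝒰) fun n => perim (l n) / s n
  · have : ∀ k, ∃ v, Tendsto (fun n => l n k / s n) 𝒰 (𝓝 v) := fun k => by
      refine exists_tendsto_of_bounds (a := 0) (b := C) ?_
      filter_upwards [hl, hC, hs0] with n h1 h2 h3
      exact ⟨div_nonneg (h1.pos k).le h3.le,
        (div_le_div_of_nonneg_right (h1.le_perim k) h3.le).trans h2⟩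
    choose v hv using this
    obtain ⟨W, rfl, hW⟩ := exists_weight_of_tendsto_hexLen hl hs hv
    refine ⟨W, fun j => ?_, fun j => tendsto_nhds_unique (hW _).1 (h j), hv⟩
    by_contra hw
    exact hne j ((hW _).2 ((W.wt_nonneg _).lt_of_ne' hw))
  · have hp : Tendsto (fun n => perim (l n)) 𝒰 atTop := by
      refine (hinf'.atTop_mul_atTop₀ hs).congr' ?_
      filter_upwards [hs0] with n hn
      rw [div_mul_cancel₀ _ hn.ne']
    -- If the perimeters outgrew `s`, the three lengths would be negligible compared with the
    -- perimeter.
    refine absurd (fun j => ?_) (not_tendsto_hexLen_div_perim hl hp hne)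
    have := (h j).mul hinf'.inv_tendsto_atTop
    rw [mul_zero] at this
    refine this.congr' ?_
    filter_upwards [hs0] with n hn
    rw [Pi.inv_apply, inv_div, div_mul_div_cancel₀ hn.ne']

/-- There are foliations with any given positive intersection numbers with the arcs of a triple. -/
theorem exists_weight_cross (d : ArcTriple) {x : Fin 3 → ℝ} (hx : ∀ j, 0 < x j) :
    ∃ W : Weight, (∀ j, W.wt (d.arc j) = 0) ∧ ∀ j, W.cross (d.arc j) = x j := by
  -- The foliation is the limit of hexagons whose lengths on the triple are large multiples of the
  -- prescribed numbers.
  have : ∀ n : ℕ, ∃ l, IsHex l ∧ ∀ j, hexLen l (d.arc j) = (n + 1 : ℝ) * x j := fun n =>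
    exists_isHex_hexLen d fun j => mul_pos (by positivity) (hx j)
  choose l hl he using this
  have hs : Tendsto (fun n : ℕ => (n + 1 : ℝ)) atTop atTop :=
    tendsto_atTop_add_const_right _ _ tendsto_natCast_atTop_atTop
  obtain ⟨W, h1, h2, -⟩ := exists_weight_of_tendsto_triple (𝒰 := hyperfilter ℕ) (d := d) (x := x)
    (Eventually.of_forall hl) (hs.mono_left (Nat.hyperfilter_le_atTop)) hx (fun j => by
      refine tendsto_const_nhds.congr fun n => ?_
      rw [he, mul_div_cancel_left₀ _ (by positivity : (n + 1 : ℝ) ≠ 0)])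
  exact ⟨W, h1, h2⟩

/-- Hexagons with converging lengths on a triple of arcs converge. -/
theorem exists_isHex_of_tendsto_triple {l : ι → Fin 6 → ℝ} {y : Fin 3 → ℝ}
    (hl : ∀ᶠ n in 𝒰, IsHex (l n)) (hy : ∀ j, 0 < y j)
    (h : ∀ j, Tendsto (fun n => hexLen (l n) (d.arc j)) 𝒰 (𝓝 (y j))) :
    ∃ v, IsHex v ∧ (∀ j, hexLen v (d.arc j) = y j) ∧
      ∀ k, Tendsto (fun n => l n k) 𝒰 (𝓝 (v k)) := by
  have hne : ∀ j, ¬ Tendsto (fun n => hexLen (l n) (d.arc j)) 𝒰 (𝓝 0) := fun j h' =>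
    (hy j).ne' (tendsto_nhds_unique (h j) h')
  obtain ⟨C, hC⟩ | hinf := bounded_or_tendsto_atTop (𝒰 := 𝒰) fun n => perim (l n)
  · have : ∀ k, ∃ v, Tendsto (fun n => l n k) 𝒰 (𝓝 v) := fun k => by
      refine exists_tendsto_of_bounds (a := 0) (b := C) ?_
      filter_upwards [hl, hC] with n h1 h2
      exact ⟨(h1.pos k).le, (h1.le_perim k).trans h2⟩
    choose v hv using this
    have hv' := IsHex.of_tendsto hl hv
    exact ⟨v, hv', fun j => tendsto_nhds_unique (hv'.tendsto_hexLen hv hl _) (h j), hv⟩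
  · exact absurd (fun j => (h j).div_atTop hinf) (not_tendsto_hexLen_div_perim hl hinf hne)

end


/-! ### Normalized coordinates on the projective space -/

lemma IsProj.smul {x : PSpace} {v : Fin 6 → ℝ} (h : IsProj x v) {c : ℝ} (hc : c ≠ 0) :
    IsProj x (c • v) := by
  obtain ⟨hv, rfl⟩ := h
  refine ⟨smul_ne_zero hc hv, ?_⟩
  rw [Projectivization.mk_eq_mk_iff']
  exact ⟨c⁻¹, by rw [smul_smul, inv_mul_cancel₀ hc, one_smul]⟩

lemma IsProj.exists_smul {x : PSpace} {v w : Fin 6 → ℝ} (h : IsProj x v) (h' : IsProj x w) :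
    ∃ c : ℝ, c ≠ 0 ∧ w = c • v := by
  obtain ⟨hv, rfl⟩ := h
  obtain ⟨hw, e⟩ := h'
  rw [eq_comm, Projectivization.mk_eq_mk_iff'] at e
  obtain ⟨c, rfl⟩ := e
  refine ⟨c, ?_, rfl⟩
  rintro rfl
  exact hw (zero_smul _ _)

lemma IsProj.eq {x y : PSpace} {v : Fin 6 → ℝ} (h : IsProj x v) (h' : IsProj y v) : x = y := by
  obtain ⟨hv, rfl⟩ := h
  obtain ⟨hw, rfl⟩ := h'
  rfl

lemma isProj_rep (x : PSpace) : IsProj x x.rep := ⟨x.rep_nonzero, x.mk_rep.symm⟩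

lemma perim_smul (c : ℝ) (v : Fin 6 → ℝ) : perim (c • v) = c * perim v :=
  (Finset.mul_sum _ _ _).symm

lemma continuous_perim : Continuous perim :=
  continuous_finsetSum _ fun k _ => continuous_apply k

/-- The representative whose sum of coordinates is one (or zero, if there is none). -/
def sig (x : PSpace) : Fin 6 → ℝ := (perim x.rep)⁻¹ • x.rep

lemma IsProj.sig_eq {x : PSpace} {v : Fin 6 → ℝ} (h : IsProj x v) : sig x = (perim v)⁻¹ • v := by
  obtain ⟨c, hc, e⟩ := h.exists_smul (isProj_rep x)
  rw [sig, e, perim_smul, smul_smul, mul_inv, mul_right_comm, inv_mul_cancel₀ hc, one_mul]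

lemma IsProj.sig_eq_of_perim {x : PSpace} {v : Fin 6 → ℝ} (h : IsProj x v) (hv : perim v = 1) :
    sig x = v := by
  rw [h.sig_eq, hv, inv_one, one_smul]

lemma isProj_sig {x : PSpace} (h : sig x ≠ 0) : IsProj x (sig x) := by
  refine (isProj_rep x).smul fun h0 => h ?_
  rw [sig, h0, zero_smul]

lemma isProj_mk {v : Fin 6 → ℝ} (hv : v ≠ 0) : IsProj (Projectivization.mk ℝ v hv) v := ⟨hv, rfl⟩

lemma perim_rep_ne_zero {x : PSpace} (h : sig x ≠ 0) : perim x.rep ≠ 0 := fun h0 => h (by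
  rw [sig, h0, inv_zero, zero_smul])

/-- The topology of the projective space in the normalized coordinates. -/
theorem nhds_eq_comap_sig {x : PSpace} (h : sig x ≠ 0) : 𝓝 x = comap sig (𝓝 (sig x)) := by
  apply le_antisymm
  · rw [← map_le_iff_le_comap]
    intro U hU
    obtain ⟨O, hOU, hO, hx⟩ := mem_nhds_iff.1 hU
    have hcont : ContinuousOn (fun v : Fin 6 → ℝ => (perim v)⁻¹ • v) {v | perim v ≠ 0} :=
      (continuous_perim.continuousOn.inv₀ fun v hv => hv).smul continuousOn_id
    have hopen : IsOpen {v : Fin 6 → ℝ | perim v ≠ 0} :=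
      isOpen_ne_fun continuous_perim continuous_const
    have h1 := hcont.isOpen_inter_preimage hopen hO
    -- The chosen representatives are arbitrary, but both conditions are invariant under scaling, so
    -- the preimage in the punctured space is given by a continuous formula.
    refine mem_map.2 (mem_nhds_iff.2 ⟨{y | perim y.rep ≠ 0 ∧ sig y ∈ O},
      fun y hy => hOU hy.2, ?_, perim_rep_ne_zero h, hx⟩)
    change IsOpen (Projectivization.mk' ℝ ⁻¹' {y : PSpace | perim y.rep ≠ 0 ∧ sig y ∈ O})
    convert h1.preimage continuous_subtype_val using 1
    ext v
    have hv : IsProj (Projectivization.mk' ℝ v) v.1 := isProj_mk v.2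
    obtain ⟨c, hc, e⟩ := hv.exists_smul (isProj_rep _)
    have h2 := hv.sig_eq
    simp only [Set.mem_preimage, Set.mem_ofPred_eq, Set.mem_inter_iff]
    rw [h2, e, perim_smul]
    simp [hc]
  · intro U hU
    obtain ⟨O, hOU, hO, hx⟩ := mem_nhds_iff.1 hU
    have hO' : IsOpen (Projectivization.mk' ℝ ⁻¹' O : Set {v : Fin 6 → ℝ // v ≠ 0}) := hO
    obtain ⟨P, hP, e⟩ := isOpen_induced_iff.1 hO'
    -- Conversely, `sig` is a section of the quotient map wherever it is nonzero.
    have key : ∀ {y : PSpace} (hy : sig y ≠ 0), sig y ∈ P ↔ y ∈ O := by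
      intro y hy
      have h1 : Projectivization.mk' ℝ (⟨sig y, hy⟩ : {v : Fin 6 → ℝ // v ≠ 0}) = y :=
        (isProj_mk hy).eq (isProj_sig hy)
      have h2 := Set.ext_iff.1 e ⟨sig y, hy⟩
      rw [Set.mem_preimage, Set.mem_preimage, h1] at h2
      exact h2
    refine ⟨P ∩ {0}ᶜ, inter_mem (hP.mem_nhds ((key h).2 hx)) (isOpen_compl_singleton.mem_nhds h),
      fun y hy => hOU ((key hy.2).1 hy.1)⟩

lemma tendsto_iff_sig {ι : Type*} {l : Filter ι} {f : ι → PSpace} {x : PSpace} (h : sig x ≠ 0) :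
    Tendsto f l (𝓝 x) ↔ ∀ k, Tendsto (fun n => sig (f n) k) l (𝓝 (sig x k)) := by
  rw [nhds_eq_comap_sig h, tendsto_comap_iff, tendsto_pi_nhds]
  rfl

lemma sig_injOn : Set.InjOn sig {x | sig x ≠ 0} := fun x hx y hy e => by
  have h := isProj_sig hx
  rw [e] at h
  exact h.eq (isProj_sig hy)

/-! ### Weights up to scale -/

namespace Weight

/-- The weights multiplied by a constant. -/
def scale (W : Weight) (c : ℝ) (hc : 0 ≤ c) : Weight where
  a k := c * W.a k
  b k := c * W.b k
  b_add_three k := by rw [W.b_add_three]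
  a_nonneg k := mul_nonneg hc (W.a_nonneg k)
  b_nonneg k := mul_nonneg hc (W.b_nonneg k)
  a_mul_a k := by linear_combination c ^ 2 * W.a_mul_a k
  a_mul_b k := by linear_combination c ^ 2 * W.a_mul_b k
  b_mul_b k := by linear_combination c ^ 2 * W.b_mul_b k

variable (W : Weight) {c : ℝ} (hc : 0 ≤ c)

lemma deg_scale : (W.scale c hc).deg = c • W.deg := by
  funext k
  simp only [deg, scale, Pi.smul_apply, smul_eq_mul]
  ring

lemma crossLong_scale (k : Fin 6) : (W.scale c hc).crossLong k = c * W.crossLong k := by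
  simp only [crossLong, scale]
  ring

lemma cross_scale (e : ArcClass) : (W.scale c hc).cross e = c * W.cross e := by
  rcases e.ev_cases with ⟨k, -, h⟩ | ⟨k, -, h⟩
  · simp only [cross, h, deg_scale, Pi.smul_apply, smul_eq_mul]
  · simp only [cross, h, crossLong_scale]

lemma wt_scale (e : ArcClass) : (W.scale c hc).wt e = c * W.wt e := by
  rcases e.ev_cases with ⟨k, -, h⟩ | ⟨k, -, h⟩ <;> simp only [wt, h, scale]

variable {W}

lemma cross_eq_zero_of_deg (h : W.deg = 0) (e : ArcClass) : W.cross e = 0 := by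
  have ha : ∀ k, W.a k = 0 := fun k =>
    le_antisymm ((W.a_le_deg k).trans (by rw [h]; rfl)) (W.a_nonneg k)
  have hb : ∀ k, W.b k = 0 := fun k =>
    le_antisymm ((W.b_le_deg k).trans (by rw [h]; rfl)) (W.b_nonneg k)
  rcases e.ev_cases with ⟨k, -, h'⟩ | ⟨k, -, h'⟩
  · simp only [cross, h', deg, ha, hb, add_zero]
  · simp only [cross, h', crossLong, ha, hb, add_zero]

lemma deg_ne_zero_of_cross {e : ArcClass} (h : 0 < W.cross e) : W.deg ≠ 0 := fun h0 =>
  h.ne' (cross_eq_zero_of_deg h0 e)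

lemma perim_deg_pos (h : W.deg ≠ 0) : 0 < perim W.deg := by
  obtain ⟨k, hk⟩ := Function.ne_iff.1 h
  exact Finset.sum_pos' (fun i _ => W.deg_nonneg i)
    ⟨k, Finset.mem_univ k, (W.deg_nonneg k).lt_of_ne' hk⟩

lemma exists_normalize (h : W.deg ≠ 0) : ∃ c : ℝ, ∃ hc : 0 < c, perim (W.scale c hc.le).deg = 1 := by
  have hp := perim_deg_pos h
  exact ⟨_, inv_pos.2 hp, by rw [deg_scale, perim_smul, inv_mul_cancel₀ hp.ne']⟩

end Weight

lemma goodPosition_iff {d : ArcTriple} {F : MeasuredFoliation} : F.GoodPosition d ↔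
    0 < ∑ j, F.weight.cross (d.arc j) ∧ ∀ j, F.weight.wt (d.arc j) = 0 := by
  simp only [MeasuredFoliation.GoodPosition, F.inter_eq_cross, F.wt_weight,
    MeasuredFoliation.total_eq_zero_iff]
  exact and_congr_right fun _ => forall_comm

lemma mem_teich_iff {x : PSpace} : x ∈ teich ↔ ∃ l, IsHex l ∧ IsProj x l := by
  constructor
  · rintro ⟨h, hx⟩
    exact ⟨_, h.isHex, hx⟩
  · rintro ⟨l, hl, hx⟩
    obtain ⟨H, rfl⟩ := hl.exists_rightHexagon
    exact ⟨H, hx⟩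

lemma mem_teichPatch_iff {d : ArcTriple} {ε : ℝ} {x : PSpace} : x ∈ teichPatch d ε ↔
    ∃ l, IsHex l ∧ (∀ j, ε < hexLen l (d.arc j)) ∧ IsProj x l := by
  constructor
  · rintro ⟨h, h', hx⟩
    exact ⟨_, h.isHex, fun j => by rw [← h.length_eq_hexLen]; exact h' j, hx⟩
  · rintro ⟨l, hl, h', hx⟩
    obtain ⟨H, rfl⟩ := hl.exists_rightHexagon
    exact ⟨H, fun j => by rw [H.length_eq_hexLen]; exact h' j, hx⟩

/-- The normalized weights of a class of foliations. -/
structure Represents (W : Weight) (x : PSpace) : Prop where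
  perim_eq : perim W.deg = 1
  isProj : IsProj x W.deg

lemma Represents.sig_eq {W : Weight} {x : PSpace} (h : Represents W x) : sig x = W.deg :=
  h.isProj.sig_eq_of_perim h.perim_eq

lemma exists_represents {W : Weight} {x : PSpace} (h : IsProj x W.deg) :
    ∃ c : ℝ, ∃ hc : 0 < c, Represents (W.scale c hc.le) x := by
  obtain ⟨c, hc, e⟩ := Weight.exists_normalize h.1
  refine ⟨c, hc, e, ?_⟩
  rw [Weight.deg_scale]
  exact h.smul hc.ne'

lemma mem_PMF_iff {x : PSpace} : x ∈ PMF ↔ ∃ W, Represents W x := by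
  constructor
  · rintro ⟨F, hx⟩
    rw [F.interVec_eq] at hx
    obtain ⟨c, hc, h⟩ := exists_represents hx
    exact ⟨_, h⟩
  · rintro ⟨W, h⟩
    obtain ⟨F, rfl⟩ := W.exists_foliation h.isProj.1
    exact ⟨F, by rw [F.interVec_eq]; exact h.isProj⟩

lemma mem_PMFpatch_iff {d : ArcTriple} {x : PSpace} : x ∈ PMFpatch d ↔
    ∃ W, Represents W x ∧ 0 < ∑ j, W.cross (d.arc j) ∧ ∀ j, W.wt (d.arc j) = 0 := by
  constructor
  · rintro ⟨F, hF, hx⟩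
    rw [F.interVec_eq] at hx
    rw [goodPosition_iff] at hF
    obtain ⟨c, hc, h⟩ := exists_represents hx
    refine ⟨_, h, ?_, fun j => ?_⟩
    · simp only [Weight.cross_scale, ← Finset.mul_sum]
      exact mul_pos hc hF.1
    · rw [Weight.wt_scale, hF.2, mul_zero]
  · rintro ⟨W, h, h'⟩
    obtain ⟨F, rfl⟩ := W.exists_foliation h.isProj.1
    exact ⟨F, goodPosition_iff.2 h', by rw [F.interVec_eq]; exact h.isProj⟩


/-! ### The interior of the set of foliations in good position -/

lemma Represents.unique {W W' : Weight} {x : PSpace} (h : Represents W x) (h' : Represents W' x) :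
    W = W' := Weight.deg_injective (h.sig_eq.symm.trans h'.sig_eq)

lemma Represents.sig_ne_zero {W : Weight} {x : PSpace} (h : Represents W x) : sig x ≠ 0 := by
  rw [h.sig_eq]; exact h.isProj.1

lemma Represents.tendsto {ι : Type*} {𝒰 : Ultrafilter ι} {f : ι → PSpace} {x : PSpace}
    {W : ι → Weight} {W' : Weight} (h : ∀ᶠ n in 𝒰, Represents (W n) (f n)) (h' : Represents W' x)
    (hf : Tendsto f 𝒰 (𝓝 x)) : Weight.ConvergesTo 𝒰 W W' := by
  rw [tendsto_iff_sig h'.sig_ne_zero, h'.sig_eq] at hf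
  refine Weight.convergesTo_of_deg fun k => (hf k).congr' ?_
  filter_upwards [h] with n hn
  rw [hn.sig_eq]

namespace Weight

variable (W : Weight) {δ : ℝ} {k : Fin 6}

/-- All classes crossing the arc parallel to `k` have weight zero, so a band of that class can be
added freely. -/
lemma exists_add_side (hδ : 0 ≤ δ) (ha : W.a k = 0) (h : W.deg k = 0) : ∃ W' : Weight, W'.a k = δ ∧
    ∀ i, W'.deg i = W.deg i + δ * ((if i + 1 = k then 1 else 0) + (if i - 1 = k then 1 else 0)) := by
  have h1 := W.a_nonneg (k + 1)
  have h2 := W.a_nonneg (k - 1)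
  have h3 := W.b_nonneg k
  rw [deg] at h
  have z1 : W.a (k + 1) = 0 := by linarith
  have z2 : W.a (k - 1) = 0 := by linarith
  have z3 : W.b k = 0 := by linarith
  refine ⟨⟨fun i => W.a i + δ * if i = k then 1 else 0, W.b, W.b_add_three, fun i => ?_,
    W.b_nonneg, fun i => ?_, fun i => ?_, W.b_mul_b⟩, ?_, fun i => ?_⟩
  · have := W.a_nonneg i
    split_ifs <;> linarith
  · by_cases hi : i = k
    · subst hi
      simp [z1]
    · by_cases hj : i + 1 = k
      · subst hj
        rw [add_sub_cancel_right] at z2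
        simp [z2]
      · simp [hi, hj, W.a_mul_a]
  · by_cases hi : i = k
    · subst hi
      simp [z3]
    · simp [hi, W.a_mul_b]
  · simp [ha]
  · simp only [deg]
    ring

lemma exists_add_long (hδ : 0 ≤ δ) (hb : W.b k = 0) (h : W.crossLong k = 0) : ∃ W' : Weight, W'.b k = δ ∧
    ∀ i, W'.deg i = W.deg i + δ * (if i = k ∨ i = k + 3 then 1 else 0) := by
  have h1 := W.a_nonneg k
  have h2 := W.a_nonneg (k + 3)
  have h3 := W.b_nonneg (k + 1)
  have h4 := W.b_nonneg (k + 2)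
  rw [crossLong] at h
  have z1 : W.a k = 0 := by linarith
  have z2 : W.a (k + 3) = 0 := by linarith
  have z3 : W.b (k + 1) = 0 := by linarith
  have z4 : W.b (k + 2) = 0 := by linarith
  have z3' : W.b (k + 3 + 1) = 0 := by rw [add_right_comm, W.b_add_three, z3]
  have z4' : W.b (k + 5) = 0 := by
    rw [show k + 5 = k + 2 + 3 by rw [add_assoc]; rfl, W.b_add_three, z4]
  have e3 : ∀ i k : Fin 6, (i + 3 = k ∨ i + 3 = k + 3) ↔ (i = k ∨ i = k + 3) := by decide
  have e1 : ∀ i k : Fin 6, (i = k ∨ i = k + 3) → ¬ (i + 1 = k ∨ i + 1 = k + 3) := by decide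
  have e2 : ∀ i k : Fin 6, (i + 1 = k ∨ i + 1 = k + 3) → i = k + 5 ∨ i = k + 2 := by decide
  refine ⟨⟨W.a, fun i => W.b i + δ * if i = k ∨ i = k + 3 then 1 else 0, fun i => ?_, W.a_nonneg,
    fun i => ?_, W.a_mul_a, fun i => ?_, fun i => ?_⟩, ?_, fun i => ?_⟩
  · simp only [e3, W.b_add_three]
  · have := W.b_nonneg i
    split_ifs <;> linarith
  · by_cases hi : i = k ∨ i = k + 3
    · have : W.a i = 0 := by rcases hi with rfl | rfl <;> assumption
      rw [this, zero_mul]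
    · simp only [if_neg hi, mul_zero, add_zero, W.a_mul_b]
  · by_cases hi : i = k ∨ i = k + 3
    · have : W.b (i + 1) = 0 := by rcases hi with rfl | rfl <;> assumption
      simp only [if_neg (e1 i k hi), this, mul_zero, add_zero]
    · by_cases hj : i + 1 = k ∨ i + 1 = k + 3
      · have : W.b i = 0 := by rcases e2 i k hj with rfl | rfl <;> assumption
        simp only [if_neg hi, this, mul_zero, add_zero, zero_mul]
      · simp only [if_neg hi, if_neg hj, mul_zero, add_zero, W.b_mul_b]
  · simp [hb]
  · simp only [deg]
    ring

/-- A foliation may be enlarged by leaves parallel to an arc which it does not meet. -/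
lemma exists_add {e : ArcClass} (hw : W.wt e = 0) (hc : W.cross e = 0) :
    ∃ E : Fin 6 → ℝ, ∀ δ, 0 ≤ δ → ∃ W' : Weight, W'.wt e = δ ∧ W'.deg = W.deg + δ • E := by
  rcases e.ev_cases with ⟨k, -, h⟩ | ⟨k, -, h⟩
  · simp only [wt, cross, h] at hw hc ⊢
    refine ⟨fun i => (if i + 1 = k then 1 else 0) + (if i - 1 = k then 1 else 0), fun δ hδ => ?_⟩
    obtain ⟨W', h1, h2⟩ := W.exists_add_side hδ hw hc
    exact ⟨W', h1, funext h2⟩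
  · simp only [wt, cross, h] at hw hc ⊢
    refine ⟨fun i => if i = k ∨ i = k + 3 then 1 else 0, fun δ hδ => ?_⟩
    obtain ⟨W', h1, h2⟩ := W.exists_add_long hδ hw hc
    exact ⟨W', h1, funext h2⟩

end Weight

/-- The foliations meeting all the arcs of the triple are those in the interior. -/
theorem mem_PMFint_iff {d : ArcTriple} {x : PSpace} : x ∈ PMFint d ↔
    ∃ W, Represents W x ∧ (∀ j, W.wt (d.arc j) = 0) ∧ ∀ j, 0 < W.cross (d.arc j) := by
  constructor
  · rintro ⟨y, hy, rfl⟩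
    have hy' : y ∈ Subtype.val ⁻¹' PMFpatch d := interior_subset hy
    obtain ⟨W, hW, -, hw⟩ := mem_PMFpatch_iff.1 hy'
    refine ⟨W, hW, hw, fun j => (W.cross_nonneg _).lt_of_ne' fun hc => ?_⟩
    -- If some arc of the triple is not met, thin bands parallel to it are added. The resulting
    -- foliations leave the patch but converge to the given one, so it is not interior.
    obtain ⟨E, hE⟩ := W.exists_add (hw j) hc
    choose W' hwt hdeg using fun n : ℕ => hE (1 / ((n : ℝ) + 1)) (by positivity)
    have hlim : Tendsto (fun n => (W' n).deg) atTop (𝓝 W.deg) := by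
      have := (tendsto_one_div_add_atTop_nhds_zero_nat (𝕜 := ℝ)).smul_const E
      have := this.const_add W.deg
      rw [zero_smul, add_zero] at this
      exact this.congr fun n => (hdeg n).symm
    have hne : ∀ᶠ n in atTop, (W' n).deg ≠ 0 := hlim.eventually_ne hW.isProj.1
    have hx : ∀ n, ∃ z : PMF, (W' n).deg ≠ 0 → IsProj z (W' n).deg := by
      intro n
      by_cases h : (W' n).deg = 0
      · exact ⟨y, fun h' => absurd h h'⟩
      · obtain ⟨c, hc, h'⟩ := exists_represents (isProj_mk h)
        exact ⟨⟨_, mem_PMF_iff.2 ⟨_, h'⟩⟩, fun _ => isProj_mk h⟩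
    choose z hz using hx
    have hzlim : Tendsto z atTop (𝓝 y) := by
      rw [tendsto_subtype_rng, nhds_eq_comap_sig hW.sig_ne_zero, tendsto_comap_iff, hW.sig_eq]
      have h1 := ((continuous_perim.tendsto _).comp hlim).inv₀ (by rw [hW.perim_eq]; exact one_ne_zero)
      have h2 := h1.smul hlim
      rw [hW.perim_eq, inv_one, one_smul] at h2
      refine h2.congr' ?_
      filter_upwards [hne] with n hn
      exact (hz n hn).sig_eq.symm
    obtain ⟨n, hn, hn'⟩ := ((hzlim.eventually (mem_interior_iff_mem_nhds.1 hy)).and hne).exists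
    obtain ⟨W'', hW'', -, hw''⟩ := mem_PMFpatch_iff.1 (hn : (z n : PSpace) ∈ PMFpatch d)
    obtain ⟨c, hc, hW'⟩ := exists_represents (hz n hn')
    have h0 := hw'' j
    rw [hW''.unique hW', Weight.wt_scale, hwt] at h0
    exact absurd h0 (by positivity)
  · rintro ⟨W, hW, hw, hc⟩
    refine ⟨⟨x, mem_PMF_iff.2 ⟨W, hW⟩⟩, ?_, rfl⟩
    rw [mem_interior_iff_mem_nhds, mem_iff_ultrafilter]
    intro 𝒰 h𝒰
    have ht : Tendsto (Subtype.val : PMF → PSpace) 𝒰 (𝓝 x) :=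
      (continuous_subtype_val.tendsto _).mono_left h𝒰
    choose W' hW' using fun y : PMF => mem_PMF_iff.1 y.2
    -- Conversely, positive intersection numbers persist nearby, and they exclude leaves parallel to
    -- the arcs.
    have hconv := Represents.tendsto (Eventually.of_forall hW') hW ht
    have hpos : ∀ᶠ n in 𝒰, ∀ j, 0 < (W' n).cross (d.arc j) := eventually_all.2 fun j =>
      (hconv.cross _).eventually_const_lt (hc j)
    filter_upwards [hpos] with n hn
    refine mem_PMFpatch_iff.2 ⟨W' n, hW' n, Finset.sum_pos (fun j _ => hn j) Finset.univ_nonempty,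
      fun j => ?_⟩
    exact (mul_eq_zero.1 ((W' n).wt_mul_cross (d.arc j))).resolve_right (hn j).ne'


/-! ### Coordinates given by the arcs of a triple -/

/-- This separates foliations from hexagons, whose coordinates are all positive. -/
lemma Weight.not_forall_deg_pos (W : Weight) : ¬ ∀ k, 0 < W.deg k := fun h => by
  obtain ⟨k, hk, -⟩ := W.exists_deg_eq_zero
  exact (h k).ne' hk

lemma IsHex.ne_zero {l : Fin 6 → ℝ} (h : IsHex l) : l ≠ 0 := fun h0 => (h.pos 0).ne' (by rw [h0]; rfl)

lemma IsHex.sig_pos {l : Fin 6 → ℝ} {x : PSpace} (h : IsHex l) (hx : IsProj x l) (k : Fin 6) :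
    0 < sig x k := by
  rw [hx.sig_eq]
  exact mul_pos (inv_pos.2 h.perim_pos) (h.pos k)

lemma IsHex.sig_ne_zero {l : Fin 6 → ℝ} {x : PSpace} (h : IsHex l) (hx : IsProj x l) :
    sig x ≠ 0 := fun h0 => (h.sig_pos hx 0).ne' (by rw [h0]; rfl)

lemma IsHex.not_represents {l : Fin 6 → ℝ} {x : PSpace} {W : Weight} (h : IsHex l)
    (hx : IsProj x l) (hW : Represents W x) : False :=
  W.not_forall_deg_pos fun k => by rw [← hW.sig_eq]; exact h.sig_pos hx k

lemma IsHex.unique {l l' : Fin 6 → ℝ} {x : PSpace} (h : IsHex l) (hx : IsProj x l)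
    (h' : IsHex l') (hx' : IsProj x l') : l = l' := by
  obtain ⟨c, -, rfl⟩ := hx.exists_smul hx'
  rw [h.eq_one_of_smul h', one_smul]

section
variable {ι : Type*} {𝒰 : Ultrafilter ι} {f : ι → PSpace} {x : PSpace} {l : ι → Fin 6 → ℝ}

lemma tendsto_of_isProj {u : ι → Fin 6 → ℝ} {v : Fin 6 → ℝ} (hu : ∀ᶠ n in 𝒰, IsProj (f n) (u n))
    (hv : IsProj x v) (hp : perim v ≠ 0) (h : ∀ k, Tendsto (fun n => u n k) 𝒰 (𝓝 (v k))) :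
    Tendsto f 𝒰 (𝓝 x) := by
  have hs : sig x ≠ 0 := by
    rw [hv.sig_eq]
    exact smul_ne_zero (inv_ne_zero hp) hv.1
  rw [tendsto_iff_sig hs, hv.sig_eq]
  intro k
  refine (((tendsto_perim h).inv₀ hp).mul (h k)).congr' ?_
  filter_upwards [hu] with n hn
  rw [hn.sig_eq, Pi.smul_apply, smul_eq_mul]

lemma tendsto_div_perim (hl : ∀ᶠ n in 𝒰, IsProj (f n) (l n)) (hs : sig x ≠ 0)
    (hf : Tendsto f 𝒰 (𝓝 x)) (k : Fin 6) :
    Tendsto (fun n => l n k / perim (l n)) 𝒰 (𝓝 (sig x k)) := by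
  refine ((tendsto_iff_sig hs).1 hf k).congr' ?_
  filter_upwards [hl] with n hn
  rw [hn.sig_eq, Pi.smul_apply, smul_eq_mul, inv_mul_eq_div]

/-- Here `r` is the limit of the perimeters. With bounded perimeters, a projective limit of hexagons
lifts to a genuine limit, which is again a hexagon. -/
lemma exists_smul_isHex {C : ℝ} (hl : ∀ᶠ n in 𝒰, IsHex (l n) ∧ IsProj (f n) (l n))
    (hs : sig x ≠ 0) (hf : Tendsto f 𝒰 (𝓝 x)) (hC : ∀ᶠ n in 𝒰, perim (l n) ≤ C) :
    ∃ r : ℝ, IsHex (r • sig x) ∧ ∀ k, Tendsto (fun n => l n k) 𝒰 (𝓝 ((r • sig x) k)) := by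
  obtain ⟨r, hr⟩ := exists_tendsto_of_bounds (a := 0)
    ((hl.and hC).mono fun n hn => ⟨hn.1.1.perim_pos.le, hn.2⟩)
  have hlim : ∀ k, Tendsto (fun n => l n k) 𝒰 (𝓝 ((r • sig x) k)) := fun k => by
    refine (hr.mul (tendsto_div_perim (hl.mono fun n hn => hn.2) hs hf k)).congr' ?_
    filter_upwards [hl] with n hn
    rw [mul_div_cancel₀ _ hn.1.perim_pos.ne']
  exact ⟨r, IsHex.of_tendsto (hl.mono fun n hn => hn.1) hlim, hlim⟩

/-- Convergence of hexagons to a hexagon. -/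
lemma IsHex.tendsto_of_tendsto {v : Fin 6 → ℝ}
    (hl : ∀ᶠ n in 𝒰, IsHex (l n) ∧ IsProj (f n) (l n)) (hv : IsHex v) (hx : IsProj x v)
    (hf : Tendsto f 𝒰 (𝓝 x)) (k : Fin 6) : Tendsto (fun n => l n k) 𝒰 (𝓝 (v k)) := by
  have hs := hv.sig_ne_zero hx
  obtain ⟨C, hC⟩ | hinf := bounded_or_tendsto_atTop (𝒰 := 𝒰) fun n => perim (l n)
  · obtain ⟨r, hr, hlim⟩ := exists_smul_isHex hl hs hf hC
    have hr0 : r ≠ 0 := by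
      rintro rfl
      exact hr.ne_zero (zero_smul _ _)
    rw [hv.unique hx hr ((isProj_sig hs).smul hr0)]
    exact hlim k
  -- With infinite perimeters the projective limit would be a foliation.
  · obtain ⟨W, hW, -⟩ := exists_weight_of_tendsto_hexLen (hl.mono fun n hn => hn.1) hinf
      (tendsto_div_perim (hl.mono fun n hn => hn.2) hs hf)
    exact absurd (fun k => by rw [← hW]; exact hv.sig_pos hx k) W.not_forall_deg_pos

/-- Foliations do not converge to a hexagon. -/
lemma IsHex.not_tendsto {v : Fin 6 → ℝ} {W : ι → Weight} (hW : ∀ᶠ n in 𝒰, Represents (W n) (f n))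
    (hv : IsHex v) (hx : IsProj x v) : ¬ Tendsto f 𝒰 (𝓝 x) := fun hf => by
  have h : ∀ k, Tendsto (fun n => (W n).deg k) 𝒰 (𝓝 (sig x k)) := fun k => by
    refine ((tendsto_iff_sig (hv.sig_ne_zero hx)).1 hf k).congr' ?_
    filter_upwards [hW] with n hn
    rw [hn.sig_eq]
  obtain ⟨W', -, e⟩ := Weight.exists_convergesTo_of_deg h
  exact W'.not_forall_deg_pos fun k => by rw [e]; exact hv.sig_pos hx k

/-- Convergence of hexagons to a foliation. -/
lemma Represents.tendsto_hexLen {W : Weight}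
    (hl : ∀ᶠ n in 𝒰, IsHex (l n) ∧ IsProj (f n) (l n)) (hW : Represents W x)
    (hf : Tendsto f 𝒰 (𝓝 x)) : Tendsto (fun n => perim (l n)) 𝒰 atTop ∧
      ∀ e, Tendsto (fun n => hexLen (l n) e / perim (l n)) 𝒰 (𝓝 (W.cross e)) := by
  have hs := hW.sig_ne_zero
  obtain ⟨C, hC⟩ | hinf := bounded_or_tendsto_atTop (𝒰 := 𝒰) fun n => perim (l n)
  · obtain ⟨r, hr, -⟩ := exists_smul_isHex hl hs hf hC
    have hr0 : r ≠ 0 := by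
      rintro rfl
      exact hr.ne_zero (zero_smul _ _)
    exact (hr.not_represents ((isProj_sig hs).smul hr0) hW).elim
  · obtain ⟨W', e, h⟩ := exists_weight_of_tendsto_hexLen (hl.mono fun n hn => hn.1) hinf
      (tendsto_div_perim (hl.mono fun n hn => hn.2) hs hf)
    rw [hW.sig_eq] at e
    rw [Weight.deg_injective e]
    exact ⟨hinf, fun e => (h e).1⟩

end

/-- The sum of the lengths of the arcs of a triple. -/
def hexSum (d : ArcTriple) (l : Fin 6 → ℝ) : ℝ := ∑ j, hexLen l (d.arc j)

/-- The sum of the intersection numbers with the arcs of a triple. -/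
def crossSum (d : ArcTriple) (W : Weight) : ℝ := ∑ j, W.cross (d.arc j)

lemma IsHex.hexSum_pos {l : Fin 6 → ℝ} (h : IsHex l) (d : ArcTriple) : 0 < hexSum d l :=
  Finset.sum_pos (fun _ _ => h.hexLen_pos _) Finset.univ_nonempty

lemma crossSum_pos {d : ArcTriple} {W : Weight} (h : ∀ j, 0 < W.cross (d.arc j)) :
    0 < crossSum d W :=
  Finset.sum_pos (fun j _ => h j) Finset.univ_nonempty

/-- The coordinates of a hexagon or a foliation: the proportions of the lengths of the three arcs,
and the exponential of minus their sum. -/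
inductive Coord (d : ArcTriple) (x : PSpace) (ρ : Fin 3 → ℝ) (t : ℝ) : Prop
  | hex (l : Fin 6 → ℝ) (hl : IsHex l) (hx : IsProj x l)
      (hρ : ∀ j, ρ j = hexLen l (d.arc j) / hexSum d l) (ht : t = exp (-hexSum d l))
  | fol (W : Weight) (hx : Represents W x) (hw : ∀ j, W.wt (d.arc j) = 0)
      (hc : ∀ j, 0 < W.cross (d.arc j)) (hρ : ∀ j, ρ j = W.cross (d.arc j) / crossSum d W)
      (ht : t = 0)

section
variable {ι : Type*} {𝒰 : Ultrafilter ι} {f : ι → PSpace} {x : PSpace} {d : ArcTriple}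
  {ρ : ι → Fin 3 → ℝ} {t : ι → ℝ} {ρ' : Fin 3 → ℝ} {t' : ℝ}

lemma exists_unit {W : Weight} (hx : Represents W x) (hw : ∀ j, W.wt (d.arc j) = 0)
    (hc : ∀ j, 0 < W.cross (d.arc j)) : ∃ W' : Weight, IsProj x W'.deg ∧
      (∀ j, W'.wt (d.arc j) = 0) ∧ ∀ j, W'.cross (d.arc j) = W.cross (d.arc j) / crossSum d W := by
  have hp := inv_pos.2 (crossSum_pos hc)
  refine ⟨W.scale _ hp.le, ?_, fun j => ?_, fun j => ?_⟩
  · rw [Weight.deg_scale]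
    exact hx.isProj.smul hp.ne'
  · rw [Weight.wt_scale, hw, mul_zero]
  · rw [Weight.cross_scale, inv_mul_eq_div]

/-- The coordinates describe the topology. -/
theorem tendsto_iff_coord (h : ∀ᶠ n in 𝒰, Coord d (f n) (ρ n) (t n)) (h' : Coord d x ρ' t') :
    Tendsto f 𝒰 (𝓝 x) ↔
      (∀ j, Tendsto (fun n => ρ n j) 𝒰 (𝓝 (ρ' j))) ∧ Tendsto t 𝒰 (𝓝 t') := by
  -- An ultrafilter lives entirely on hexagons or entirely on foliations.
  have hcases : (∀ᶠ n in 𝒰, ∃ l, IsHex l ∧ IsProj (f n) l ∧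
      (∀ j, ρ n j = hexLen l (d.arc j) / hexSum d l) ∧ t n = exp (-hexSum d l)) ∨
      (∀ᶠ n in 𝒰, ∃ W, Represents W (f n) ∧ (∀ j, W.wt (d.arc j) = 0) ∧
        (∀ j, 0 < W.cross (d.arc j)) ∧ (∀ j, ρ n j = W.cross (d.arc j) / crossSum d W) ∧
        t n = 0) := by
    rw [← Ultrafilter.eventually_or]
    filter_upwards [h] with n hn
    cases hn with
    | hex l hl hx hρ ht => exact Or.inl ⟨l, hl, hx, hρ, ht⟩
    | fol W hx hw hc hρ ht => exact Or.inr ⟨W, hx, hw, hc, hρ, ht⟩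
  rcases hcases with hn | hn
  · obtain ⟨l, hl⟩ := hn.choice
    have hex : ∀ᶠ n in 𝒰, IsHex (l n) := hl.mono fun n h => h.1
    have hex' : ∀ᶠ n in 𝒰, IsHex (l n) ∧ IsProj (f n) (l n) := hl.mono fun n h => ⟨h.1, h.2.1⟩
    cases h' with
    | hex v hv hx hρ ht =>
      constructor
      · intro hf
        have h1 := fun e => hv.tendsto_hexLen (IsHex.tendsto_of_tendsto hex' hv hx hf) hex e
        have h2 : Tendsto (fun n => hexSum d (l n)) 𝒰 (𝓝 (hexSum d v)) :=
          tendsto_finsetSum _ fun j _ => h1 (d.arc j)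
        refine ⟨fun j => ?_, ?_⟩
        · rw [hρ]
          refine ((h1 (d.arc j)).div h2 (hv.hexSum_pos d).ne').congr' ?_
          filter_upwards [hl] with n hn
          exact (hn.2.2.1 j).symm
        · rw [ht]
          refine ((continuous_exp.tendsto _).comp h2.neg).congr' ?_
          filter_upwards [hl] with n hn
          exact hn.2.2.2.symm
      · rintro ⟨h1, h2⟩
        have h3 : Tendsto (fun n => hexSum d (l n)) 𝒰 (𝓝 (hexSum d v)) := by
          have := (h2.log (by rw [ht]; exact (exp_pos _).ne')).neg
          rw [ht, log_exp, neg_neg] at this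
          refine this.congr' ?_
          filter_upwards [hl] with n hn
          rw [hn.2.2.2, log_exp, neg_neg]
        have h4 : ∀ j, Tendsto (fun n => hexLen (l n) (d.arc j)) 𝒰 (𝓝 (hexLen v (d.arc j))) := by
          intro j
          have := (h1 j).mul h3
          rw [hρ, div_mul_cancel₀ _ (hv.hexSum_pos d).ne'] at this
          refine this.congr' ?_
          filter_upwards [hl] with n hn
          rw [hn.2.2.1, div_mul_cancel₀ _ (hn.1.hexSum_pos d).ne']
        -- The three lengths converge, hence so do the hexagons, and the limit is identified by its
        -- lengths on the triple.
        obtain ⟨v', hv', e, hlim⟩ :=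
          exists_isHex_of_tendsto_triple hex (fun j => hv.hexLen_pos _) h4
        rw [hv'.eq_of_hexLen_eq hv e] at hlim
        exact tendsto_of_isProj (hl.mono fun n h => h.2.1) hx hv.perim_pos.ne' hlim
    | fol W hx hw hc hρ ht =>
      constructor
      · intro hf
        obtain ⟨hinf, h1⟩ := hx.tendsto_hexLen hex' hf
        have h2 : Tendsto (fun n => hexSum d (l n) / perim (l n)) 𝒰 (𝓝 (crossSum d W)) := by
          refine (tendsto_finsetSum Finset.univ fun j _ => h1 (d.arc j)).congr fun n => ?_
          rw [hexSum, Finset.sum_div]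
        refine ⟨fun j => ?_, ?_⟩
        · rw [hρ]
          refine ((h1 (d.arc j)).div h2 (crossSum_pos hc).ne').congr' ?_
          filter_upwards [hl] with n hn
          rw [hn.2.2.1 j]
          exact div_div_div_cancel_right₀ hn.1.perim_pos.ne' _ _
        · have h3 : Tendsto (fun n => hexSum d (l n)) 𝒰 atTop := by
            refine (h2.pos_mul_atTop (crossSum_pos hc) hinf).congr' ?_
            filter_upwards [hl] with n hn
            rw [div_mul_cancel₀ _ hn.1.perim_pos.ne']
          rw [ht]
          refine (tendsto_exp_neg_atTop_nhds_zero.comp h3).congr' ?_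
          filter_upwards [hl] with n hn
          exact hn.2.2.2.symm
      · rintro ⟨h1, h2⟩
        have h3 : Tendsto (fun n => hexSum d (l n)) 𝒰 atTop := by
          rw [← tendsto_neg_atBot_iff, ← tendsto_exp_comp_nhds_zero, ← ht]
          refine h2.congr' ?_
          filter_upwards [hl] with n hn
          exact hn.2.2.2
        have hpos : ∀ j, 0 < ρ' j := fun j => by rw [hρ]; exact div_pos (hc j) (crossSum_pos hc)
        -- Rescaled by the sum of their lengths on the triple, the hexagons converge to a foliation,
        -- which is identified by its intersection numbers with the triple.
        obtain ⟨W', hw', hc', hlim⟩ := exists_weight_of_tendsto_triple (d := d) hex h3 hpos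
          (fun j => (h1 j).congr' (hl.mono fun n hn => hn.2.2.1 j))
        obtain ⟨W'', hx'', hw'', hc''⟩ := exists_unit hx hw hc
        have e : W' = W'' := Weight.eq_of_cross_eq hw' hw'' fun j => by rw [hc', hc'', hρ]
        subst e
        refine tendsto_of_isProj (u := fun n => (hexSum d (l n))⁻¹ • l n) ?_ hx''
          (Weight.perim_deg_pos hx''.1).ne' (fun k => (hlim k).congr fun n => ?_)
        · filter_upwards [hl] with n hn
          exact hn.2.1.smul (inv_ne_zero (hn.1.hexSum_pos d).ne')
        · rw [Pi.smul_apply, smul_eq_mul, inv_mul_eq_div]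
  · obtain ⟨W, hW⟩ := hn.choice
    have hrep : ∀ᶠ n in 𝒰, Represents (W n) (f n) := hW.mono fun n h => h.1
    cases h' with
    | hex v hv hx hρ ht =>
      refine iff_of_false (hv.not_tendsto hrep hx) ?_
      -- Foliations have last coordinate zero, while for a hexagon it is a positive exponential.
      rintro ⟨-, h2⟩
      have h3 : Tendsto t 𝒰 (𝓝 0) :=
        tendsto_const_nhds.congr' (hW.mono fun n hn => hn.2.2.2.2.symm)
      have h4 := tendsto_nhds_unique h2 h3
      rw [ht] at h4
      exact (exp_pos _).ne' h4
    | fol V hx hw hc hρ ht =>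
      constructor
      · intro hf
        have h1 := Represents.tendsto hrep hx hf
        have h2 : Tendsto (fun n => crossSum d (W n)) 𝒰 (𝓝 (crossSum d V)) :=
          tendsto_finsetSum _ fun j _ => h1.cross (d.arc j)
        refine ⟨fun j => ?_, ?_⟩
        · rw [hρ]
          refine ((h1.cross (d.arc j)).div h2 (crossSum_pos hc).ne').congr' ?_
          filter_upwards [hW] with n hn
          exact (hn.2.2.2.1 j).symm
        · rw [ht]
          exact tendsto_const_nhds.congr' (hW.mono fun n hn => hn.2.2.2.2.symm)
      · rintro ⟨h1, -⟩
        obtain ⟨U, hU⟩ := (hW.mono fun n hn => exists_unit hn.1 hn.2.1 hn.2.2.1).choice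
        obtain ⟨W', hW', hw', hc'⟩ := Weight.exists_convergesTo_of_cross
          (hU.mono fun n hn => hn.2.1) (fun j => (h1 j).congr' ((hU.and hW).mono fun n hn => by
            exact (hn.2.2.2.2.1 j).trans (hn.1.2.2 j).symm))
        obtain ⟨W'', hx'', hw'', hc''⟩ := exists_unit hx hw hc
        have e : W' = W'' := Weight.eq_of_cross_eq hw' hw'' fun j => by rw [hc', hc'', hρ]
        subst e
        exact tendsto_of_isProj (hU.mono fun n hn => hn.1) hx''
          (Weight.perim_deg_pos hx''.1).ne' hW'.deg

end


/-! ### The boundary charts -/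

lemma isInducing_of_ultrafilter {X Y : Type*} [TopologicalSpace X] [TopologicalSpace Y] {f : X → Y}
    (h : ∀ (𝒰 : Ultrafilter X) (x : X), ↑𝒰 ≤ 𝓝 x ↔ Tendsto f 𝒰 (𝓝 (f x))) :
    Topology.IsInducing f := by
  rw [Topology.isInducing_iff_nhds]
  intro x
  refine le_antisymm ?_ ?_ <;> rw [le_iff_ultrafilter] <;> intro 𝒰 h𝒰
  · rw [← tendsto_iff_comap]
    exact (h 𝒰 x).1 h𝒰
  · rw [← tendsto_iff_comap] at h𝒰
    exact (h 𝒰 x).2 h𝒰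

/-- The proportions of the intersection numbers of a foliation with the arcs of a triple. -/
def ratio (d : ArcTriple) (z : PSpace) (j : Fin 3) : ℝ :=
  open Classical in
  if h : ∃ W, Represents W z then h.choose.cross (d.arc j) / crossSum d h.choose else 0

lemma ratio_eq (d : ArcTriple) {z : PSpace} {W : Weight} (h : IsProj z W.deg) (j : Fin 3) :
    ratio d z j = W.cross (d.arc j) / crossSum d W := by
  obtain ⟨c, hc, hW⟩ := exists_represents h
  have h' : ∃ W, Represents W z := ⟨_, hW⟩
  rw [ratio, dif_pos h', h'.choose_spec.unique hW]
  simp only [crossSum, Weight.cross_scale, ← Finset.mul_sum]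
  rw [mul_div_mul_left _ _ hc.ne']

variable {d : ArcTriple} {ε : ℝ}

lemma coord_of_mem_PMFint {z : PSpace} (hz : z ∈ PMFint d) : Coord d z (ratio d z) 0 := by
  obtain ⟨W, hW, hw, hc⟩ := mem_PMFint_iff.1 hz
  exact Coord.fol W hW hw hc (ratio_eq d hW.isProj) rfl

lemma ratio_pos {z : PSpace} (hz : z ∈ PMFint d) (j : Fin 3) : 0 < ratio d z j := by
  obtain ⟨W, hW, hw, hc⟩ := mem_PMFint_iff.1 hz
  rw [ratio_eq d hW.isProj]
  exact div_pos (hc j) (crossSum_pos hc)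

lemma isInducing_ratio : Topology.IsInducing fun z : PMFint d => ratio d z := by
  refine isInducing_of_ultrafilter fun 𝒰 z => ?_
  have h1 : ↑𝒰 ≤ 𝓝 z ↔ Tendsto (fun y : PMFint d => (y : PSpace)) 𝒰 (𝓝 (z : PSpace)) :=
    tendsto_subtype_rng (f := fun y : PMFint d => y)
  rw [h1, tendsto_iff_coord (Eventually.of_forall fun y : PMFint d => coord_of_mem_PMFint y.2)
    (coord_of_mem_PMFint z.2), tendsto_pi_nhds]
  exact and_iff_left tendsto_const_nhds

/-- The positivity required by good position is automatic, since the prescribed lengths are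
positive. -/
lemma isFoliationOf_iff {h : RightHexagon} {F : MeasuredFoliation} : IsFoliationOf d h F ↔
    (∀ j, F.weight.wt (d.arc j) = 0) ∧
      ∀ j, F.weight.cross (d.arc j) = hexLen h.lengthVec (d.arc j) := by
  rw [IsFoliationOf, goodPosition_iff]
  simp only [F.inter_eq_cross, h.length_eq_hexLen]
  constructor
  · rintro ⟨⟨-, h1⟩, h2⟩
    exact ⟨h1, h2⟩
  · rintro ⟨h1, h2⟩
    refine ⟨⟨?_, h1⟩, h2⟩
    simp only [h2]
    exact h.isHex.hexSum_pos d

lemma exists_isFoliationOf (d : ArcTriple) (h : RightHexagon) : ∃ F, IsFoliationOf d h F := by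
  obtain ⟨W, hw, hc⟩ := exists_weight_cross d fun j => h.isHex.hexLen_pos (d.arc j)
  obtain ⟨F, rfl⟩ := W.exists_foliation (Weight.deg_ne_zero_of_cross (e := d.arc 0)
    (by rw [hc]; exact h.isHex.hexLen_pos _))
  exact ⟨F, isFoliationOf_iff.2 ⟨hw, hc⟩⟩

lemma IsFoliationOf.weight_eq {h h' : RightHexagon} {F G : MeasuredFoliation}
    (hF : IsFoliationOf d h F) (hG : IsFoliationOf d h' G) (e : h.lengthVec = h'.lengthVec) :
    F.weight = G.weight := by
  rw [isFoliationOf_iff] at hF hG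
  exact Weight.eq_of_cross_eq hF.1 hG.1 fun j => by rw [hF.2, hG.2, e]

lemma IsFoliationOf.mem_PMFint {h : RightHexagon} {F : MeasuredFoliation}
    (hF : IsFoliationOf d h F) {z : PSpace} (hz : IsProj z F.interVec) : z ∈ PMFint d := by
  rw [isFoliationOf_iff] at hF
  rw [F.interVec_eq] at hz
  obtain ⟨c, hc, hW⟩ := exists_represents hz
  refine mem_PMFint_iff.2 ⟨_, hW, fun j => ?_, fun j => ?_⟩
  · rw [Weight.wt_scale, hF.1, mul_zero]
  · rw [Weight.cross_scale, hF.2]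
    exact mul_pos hc (h.isHex.hexLen_pos _)

lemma IsFoliationOf.interVec_ne_zero {h : RightHexagon} {F : MeasuredFoliation}
    (hF : IsFoliationOf d h F) : F.interVec ≠ 0 := by
  rw [isFoliationOf_iff] at hF
  rw [F.interVec_eq]
  exact Weight.deg_ne_zero_of_cross (e := d.arc 0) (by rw [hF.2]; exact h.isHex.hexLen_pos _)

lemma not_mem_PMFint {h : RightHexagon} {x : PSpace} (hx : IsProj x h.lengthVec) :
    x ∉ PMFint d := fun hz => by
  obtain ⟨W, hW, -⟩ := mem_PMFint_iff.1 hz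
  exact h.isHex.not_represents hx hW

lemma exp_neg_sum_length (d : ArcTriple) (h : RightHexagon) :
    exp (-∑ j, h.length (d.arc j)) = exp (-hexSum d h.lengthVec) := by
  simp only [hexSum, h.length_eq_hexLen]

lemma exp_neg_hexSum_mem (d : ArcTriple) (h : RightHexagon) :
    exp (-hexSum d h.lengthVec) ∈ Set.Ico (0 : ℝ) 1 :=
  ⟨(exp_pos _).le, (exp_lt_exp.2 (neg_lt_zero.2 (h.isHex.hexSum_pos d))).trans_eq exp_zero⟩

lemma exists_isChartMap (d : ArcTriple) (ε : ℝ) : ∃ φ, IsChartMap d ε φ := by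
  have key : ∀ x : chartDomain d ε, ∃ y : PMFint d × Set.Ico (0 : ℝ) 1,
      ((x : PSpace) ∈ PMFint d → (y.1 : PSpace) = x ∧ (y.2 : ℝ) = 0) ∧
      ∀ h : RightHexagon, h.InPatch d ε → IsProj x h.lengthVec →
        (y.2 : ℝ) = exp (-∑ j, h.length (d.arc j)) ∧
        ∀ F : MeasuredFoliation, IsFoliationOf d h F → IsProj y.1 F.interVec := by
    rintro ⟨x, hx | hx⟩
    · obtain ⟨h, -, hx⟩ := hx
      obtain ⟨F, hF⟩ := exists_isFoliationOf d h
      have hz := isProj_mk hF.interVec_ne_zero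
      refine ⟨⟨⟨_, hF.mem_PMFint hz⟩, _, exp_neg_hexSum_mem d h⟩,
        fun h' => absurd h' (not_mem_PMFint hx), fun h' _ hx' => ?_⟩
      -- The hexagon behind a projective class is unique up to its side lengths, so the value does
      -- not depend on the choice of `h`.
      have e := h.isHex.unique hx h'.isHex hx'
      refine ⟨(congrArg (fun l => exp (-hexSum d l)) e).trans (exp_neg_sum_length d h').symm,
        fun G hG => ?_⟩
      rw [G.interVec_eq, ← hF.weight_eq hG e, ← F.interVec_eq]
      exact hz
    · exact ⟨⟨⟨x, hx⟩, 0, le_rfl, one_pos⟩, fun _ => ⟨rfl, rfl⟩,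
        fun h _ hx' => absurd hx (not_mem_PMFint hx')⟩
  choose φ h1 h2 using key
  exact ⟨φ, h1, h2⟩

lemma IsChartMap.unique {φ φ' : chartDomain d ε → PMFint d × Set.Ico (0 : ℝ) 1}
    (hφ : IsChartMap d ε φ) (hφ' : IsChartMap d ε φ') : φ = φ' := by
  funext x
  rcases x.2 with ⟨h, hp, hx⟩ | hx
  · obtain ⟨F, hF⟩ := exists_isFoliationOf d h
    have a := hφ.2 x h hp hx
    have b := hφ'.2 x h hp hx
    exact Prod.ext (Subtype.ext ((a.2 F hF).eq (b.2 F hF))) (Subtype.ext (a.1.trans b.1.symm))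
  · have a := hφ.1 x hx
    have b := hφ'.1 x hx
    exact Prod.ext (Subtype.ext (a.1.trans b.1.symm)) (Subtype.ext (a.2.trans b.2.symm))

namespace IsChartMap

variable {φ : chartDomain d ε → PMFint d × Set.Ico (0 : ℝ) 1}

lemma coord (hφ : IsChartMap d ε φ) (x : chartDomain d ε) :
    Coord d x (ratio d (φ x).1) (φ x).2 := by
  rcases x.2 with ⟨h, hp, hx⟩ | hx
  · obtain ⟨F, hF⟩ := exists_isFoliationOf d h
    have a := hφ.2 x h hp hx
    have b := a.2 F hF
    rw [F.interVec_eq] at b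
    rw [isFoliationOf_iff] at hF
    refine Coord.hex _ h.isHex hx (fun j => ?_) (a.1.trans (exp_neg_sum_length d h))
    rw [ratio_eq d b, crossSum, hexSum]
    simp only [hF.2]
  · have a := hφ.1 x hx
    rw [a.1, a.2]
    exact coord_of_mem_PMFint hx

/-- The target is itself embedded by the proportions and the last coordinate, and
`tendsto_iff_coord` says that the composite induces the topology of the domain. -/
lemma isInducing (hφ : IsChartMap d ε φ) : Topology.IsInducing φ := by
  have h1 : Topology.IsInducing (Prod.map (fun z : PMFint d => ratio d z)
      (Subtype.val : Set.Ico (0 : ℝ) 1 → ℝ)) :=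
    isInducing_ratio.prodMap Topology.IsInducing.subtypeVal
  refine h1.of_comp_iff.1 (isInducing_of_ultrafilter fun 𝒰 x => ?_)
  have h2 : ↑𝒰 ≤ 𝓝 x ↔ Tendsto (fun y : chartDomain d ε => (y : PSpace)) 𝒰 (𝓝 (x : PSpace)) :=
    tendsto_subtype_rng (f := fun y : chartDomain d ε => y)
  rw [h2, tendsto_iff_coord (Eventually.of_forall hφ.coord) (hφ.coord x), ← tendsto_pi_nhds]
  exact (Prod.tendsto_iff (Prod.map (fun z : PMFint d => ratio d z) Subtype.val ∘ φ)
    (ratio d (φ x).1, ((φ x).2 : ℝ))).symm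

lemma injective (hφ : IsChartMap d ε φ) : Function.Injective φ := by
  have hs : ∀ x : chartDomain d ε, sig x ≠ 0 := by
    rintro ⟨x, ⟨h, hp, hx⟩ | hx⟩
    · exact h.isHex.sig_ne_zero hx
    · obtain ⟨W, hW, -⟩ := mem_PMFint_iff.1 hx
      exact hW.sig_ne_zero
  have hc : Continuous fun x : chartDomain d ε => sig x := by
    rw [continuous_iff_continuousAt]
    intro x
    have : Tendsto sig (𝓝 (x : PSpace)) (𝓝 (sig x)) := by
      rw [nhds_eq_comap_sig (hs x)]
      exact tendsto_comap
    exact this.comp continuous_subtype_val.continuousAt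
  have hi : Function.Injective fun x : chartDomain d ε => sig x := fun x y e =>
    Subtype.ext (sig_injOn (hs x) (hs y) e)
  -- An inducing map on a T0 space is injective, so no separate uniqueness argument is needed.
  have : T0Space (chartDomain d ε) := t0Space_of_injective_of_continuous hi hc
  exact hφ.isInducing.injective

lemma range_eq (hφ : IsChartMap d ε φ) (hε : 0 ≤ ε) : Set.range φ = chartImage d ε := by
  ext y
  constructor
  · rintro ⟨x, rfl⟩
    rcases x.2 with ⟨h, hp, hx⟩ | hx
    · obtain ⟨F, hF⟩ := exists_isFoliationOf d h
      have a := hφ.2 x h hp hx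
      refine Or.inr ⟨by rw [a.1]; exact exp_pos _, F, hF.1, a.2 F hF, ?_, fun j => ?_⟩
      · rw [a.1, log_exp, neg_neg]
        exact Finset.sum_congr rfl fun j _ => hF.2 j
      · rw [hF.2]
        exact hp j
    · exact Or.inl (hφ.1 x hx).2
  · rintro (h0 | ⟨h0, F, hF, hy, hsum, hj⟩)
    · have a := hφ.1 ⟨y.1, Or.inr y.1.2⟩ y.1.2
      exact ⟨_, Prod.ext (Subtype.ext a.1) (Subtype.ext (a.2.trans h0.symm))⟩
    -- The preimage is the hexagon whose lengths on the triple are the intersection numbers of `F`.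
    · obtain ⟨l, hl, hlen⟩ := exists_isHex_hexLen d fun j => hε.trans_lt (hj j)
      obtain ⟨H, rfl⟩ := hl.exists_rightHexagon
      have e : ∀ j, H.length (d.arc j) = F.inter (d.arc j) := fun j => by
        rw [H.length_eq_hexLen, hlen]
      have hp : H.InPatch d ε := fun j => by rw [e]; exact hj j
      have hx := isProj_mk hl.ne_zero
      have a := hφ.2 ⟨_, Or.inl ⟨H, hp, hx⟩⟩ H hp hx
      refine ⟨_, Prod.ext (Subtype.ext ((a.2 F ⟨hF, fun j => (e j).symm⟩).eq hy))
        (Subtype.ext (a.1.trans ?_))⟩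
      simp only [e]
      rw [hsum, neg_neg, exp_log h0]

end IsChartMap

/-- For the representative of total measure `-log t`, each intersection number is `-log t` times its
proportion. This form is continuous in the pair. -/
lemma mem_chartImage_iff {y : PMFint d × Set.Ico (0 : ℝ) 1} : y ∈ chartImage d ε ↔
    (y.2 : ℝ) = 0 ∨ (0 < (y.2 : ℝ) ∧ ∀ j, ε < -log y.2 * ratio d y.1 j) := by
  refine or_congr_right (and_congr_right fun h0 => ⟨?_, fun hj => ?_⟩)
  · rintro ⟨F, hF, hy, hsum, hj⟩ j
    rw [F.interVec_eq] at hy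
    simp only [F.inter_eq_cross] at hsum hj
    rw [goodPosition_iff] at hF
    rw [ratio_eq d hy, ← hsum, crossSum, mul_div_cancel₀ _ hF.1.ne']
    exact hj j
  · obtain ⟨W, hW, hw, hc⟩ := mem_PMFint_iff.1 y.1.2
    have hs := crossSum_pos hc
    have hlog : 0 < -log (y.2 : ℝ) := neg_pos.2 (log_neg h0 y.2.2.2)
    have hp : 0 < -log (y.2 : ℝ) / crossSum d W := div_pos hlog hs
    have hproj : IsProj y.1 (W.scale _ hp.le).deg := by
      rw [Weight.deg_scale]
      exact hW.isProj.smul hp.ne'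
    obtain ⟨F, hF⟩ := (W.scale _ hp.le).exists_foliation hproj.1
    have hin : ∀ j, F.inter (d.arc j) = -log (y.2 : ℝ) / crossSum d W * W.cross (d.arc j) :=
      fun j => by rw [F.inter_eq_cross, hF, Weight.cross_scale]
    have hsum : ∑ j, F.inter (d.arc j) = -log (y.2 : ℝ) := by
      simp only [hin, ← Finset.mul_sum]
      exact div_mul_cancel₀ _ hs.ne'
    refine ⟨F, ⟨by rw [hsum]; exact hlog, (goodPosition_iff.2 ⟨?_, fun j => ?_⟩).2⟩, ?_, hsum,
      fun j => ?_⟩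
    · rw [hF]
      simp only [Weight.cross_scale, ← Finset.mul_sum]
      exact mul_pos hp hs
    · rw [hF, Weight.wt_scale, hw, mul_zero]
    · rw [F.interVec_eq, hF]
      exact hproj
    · have := hj j
      rw [ratio_eq d hW.isProj] at this
      rw [hin, div_mul_eq_mul_div, mul_div_assoc]
      exact this

lemma isOpen_chartImage (hε : 0 ≤ ε) : IsOpen (chartImage d ε) := by
  rw [isOpen_iff_mem_nhds]
  intro y hy
  have hρ : ∀ j, Tendsto (fun p : PMFint d × Set.Ico (0 : ℝ) 1 => ratio d p.1 j) (𝓝 y)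
      (𝓝 (ratio d y.1 j)) := fun j =>
    (tendsto_pi_nhds.1 (isInducing_ratio.continuous.tendsto y.1) j).comp continuous_fst.continuousAt
  have ht : Tendsto (fun p : PMFint d × Set.Ico (0 : ℝ) 1 => (p.2 : ℝ)) (𝓝 y) (𝓝 (y.2 : ℝ)) :=
    (continuous_subtype_val.comp continuous_snd).continuousAt
  rcases mem_chartImage_iff.1 hy with h0 | ⟨h0, hj⟩
  -- Near a boundary point the proportions stay above half their values, and for small `t` the
  -- factor `-log t` exceeds `ε` divided by these halves.
  · have h1 : ∀ᶠ p in 𝓝 y, ∀ j, ratio d y.1 j / 2 < ratio d p.1 j := eventually_all.2 fun j =>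
      (hρ j).eventually_const_lt (half_lt_self (ratio_pos y.1.2 j))
    have h2 : ∀ᶠ p in 𝓝 y, ∀ j, (p.2 : ℝ) < exp (-(ε / (ratio d y.1 j / 2))) :=
      eventually_all.2 fun j => ht.eventually_lt_const (by rw [h0]; exact exp_pos _)
    filter_upwards [h1, h2] with p hp1 hp2
    rw [mem_chartImage_iff]
    rcases p.2.2.1.eq_or_lt with hp | hp
    · exact Or.inl hp.symm
    · refine Or.inr ⟨hp, fun j => ?_⟩
      have hm := half_pos (ratio_pos y.1.2 j)
      have h3 : ε / (ratio d y.1 j / 2) < -log (p.2 : ℝ) := by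
        have := (log_lt_iff_lt_exp hp).2 (hp2 j)
        linarith
      calc ε = ε / (ratio d y.1 j / 2) * (ratio d y.1 j / 2) := (div_mul_cancel₀ _ hm.ne').symm
        _ ≤ ε / (ratio d y.1 j / 2) * ratio d p.1 j :=
          mul_le_mul_of_nonneg_left (hp1 j).le (div_nonneg hε hm.le)
        _ < -log (p.2 : ℝ) * ratio d p.1 j := mul_lt_mul_of_pos_right h3 (hm.trans (hp1 j))
  · have h1 : ∀ᶠ p in 𝓝 y, 0 < (p.2 : ℝ) := ht.eventually_const_lt h0
    have h2 : ∀ᶠ p in 𝓝 y, ∀ j, ε < -log (p.2 : ℝ) * ratio d p.1 j := eventually_all.2 fun j =>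
      (((ht.log h0.ne').neg).mul (hρ j)).eventually_const_lt (hj j)
    filter_upwards [h1, h2] with p hp1 hp2
    exact mem_chartImage_iff.2 (Or.inr ⟨hp1, hp2⟩)

lemma chartImage_zero (d : ArcTriple) : chartImage d 0 = Set.univ := by
  refine Set.eq_univ_of_forall fun y => mem_chartImage_iff.2 ?_
  rcases y.2.2.1.eq_or_lt with h | h
  · exact Or.inl h.symm
  · exact Or.inr ⟨h, fun j => mul_pos (neg_pos.2 (log_neg h y.2.2.2)) (ratio_pos y.1.2 j)⟩

lemma chartDomain_subset (d : ArcTriple) (ε : ℝ) : chartDomain d ε ⊆ teichBar := by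
  rintro x (⟨h, -, hx⟩ | ⟨y, -, rfl⟩)
  · exact Or.inl ⟨h, hx⟩
  · exact Or.inr y.2

theorem isOpen_chartDomain (d : ArcTriple) (ε : ℝ) :
    IsOpen ((Subtype.val : teichBar → PSpace) ⁻¹' chartDomain d ε) := by
  rw [isOpen_iff_ultrafilter]
  intro x hx 𝒰 h𝒰
  have hf : Tendsto (fun y : teichBar => (y : PSpace)) 𝒰 (𝓝 (x : PSpace)) :=
    (continuous_subtype_val.tendsto _).mono_left h𝒰
  -- Openness is tested on hexagons and on foliations separately, and foliations cannot converge to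
  -- a hexagon.
  have hcases : (∀ᶠ y : teichBar in 𝒰, (y : PSpace) ∈ teich) ∨
      ∀ᶠ y : teichBar in 𝒰, (y : PSpace) ∈ PMF :=
    Ultrafilter.eventually_or.1 (Eventually.of_forall fun y => y.2)
  rcases hcases with h | h
  · obtain ⟨l, hl⟩ := (h.mono fun y hy => mem_teich_iff.1 hy).choice
    suffices hlen : ∀ᶠ y in 𝒰, ∀ j, ε < hexLen (l y) (d.arc j) by
      filter_upwards [hl, hlen] with y h1 h2
      exact Or.inl (mem_teichPatch_iff.2 ⟨l y, h1.1, h2, h1.2⟩)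
    refine eventually_all.2 fun j => ?_
    rcases hx with hx | hx
    · obtain ⟨v, hv, hvε, hx⟩ := mem_teichPatch_iff.1 hx
      exact (hv.tendsto_hexLen (IsHex.tendsto_of_tendsto hl hv hx hf)
        (hl.mono fun y hy => hy.1) _).eventually_const_lt (hvε j)
    · obtain ⟨W, hW, -, hc⟩ := mem_PMFint_iff.1 hx
      obtain ⟨h1, h2⟩ := hW.tendsto_hexLen hl hf
      -- The lengths grow like the perimeter times positive intersection numbers, so they eventually
      -- exceed any `ε`.
      have h3 := (h2 (d.arc j)).pos_mul_atTop (hc j) h1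
      filter_upwards [h3.eventually_gt_atTop ε, hl] with y hy hy'
      rwa [div_mul_cancel₀ _ hy'.1.perim_pos.ne'] at hy
  · obtain ⟨W, hW⟩ := (h.mono fun y hy => mem_PMF_iff.1 hy).choice
    rcases hx with hx | hx
    · obtain ⟨v, hv, -, hx⟩ := mem_teichPatch_iff.1 hx
      exact absurd hf (hv.not_tendsto hW hx)
    · obtain ⟨V, hV, -, hc⟩ := mem_PMFint_iff.1 hx
      have hconv := Represents.tendsto hW hV hf
      have hpos : ∀ᶠ y in 𝒰, ∀ j, 0 < (W y).cross (d.arc j) := eventually_all.2 fun j =>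
        (hconv.cross _).eventually_const_lt (hc j)
      filter_upwards [hW, hpos] with y h1 h2
      exact Or.inr (mem_PMFint_iff.2 ⟨W y, h1, fun j =>
        (mul_eq_zero.1 ((W y).wt_mul_cross (d.arc j))).resolve_right (h2 j).ne', h2⟩)

end Hexagon
end

theorem mainTheorem6 (d : Hexagon.ArcTriple) (ε : ℝ) (hε : 0 ≤ ε) :
    (∀ h : Hexagon.RightHexagon, h.InPatch d ε →
      (∃ F, Hexagon.IsFoliationOf d h F) ∧
      ∀ F G, Hexagon.IsFoliationOf d h F → Hexagon.IsFoliationOf d h G →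
        ∀ e, F.inter e = G.inter e) ∧
    (∃! φ, Hexagon.IsChartMap d ε φ) ∧
    (∀ φ, Hexagon.IsChartMap d ε φ →
      Topology.IsOpenEmbedding φ ∧ Set.range φ = Hexagon.chartImage d ε ∧
      (ε = 0 → IsHomeomorph φ)) ∧
    (∃ V : Set Hexagon.PSpace, IsOpen V ∧
      Hexagon.chartDomain d ε = V ∩ Hexagon.teichBar) := by
  refine ⟨fun h _ => ⟨Hexagon.exists_isFoliationOf d h, fun F G hF hG e => ?_⟩, ?_, fun φ hφ => ?_,
    ?_⟩
  · rw [F.inter_eq_cross, G.inter_eq_cross, hF.weight_eq hG rfl]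
  · obtain ⟨φ, hφ⟩ := Hexagon.exists_isChartMap d ε
    exact ⟨φ, hφ, fun φ' hφ' => hφ'.unique hφ⟩
  · have hemb : Topology.IsEmbedding φ := ⟨hφ.isInducing, hφ.injective⟩
    have hrange := hφ.range_eq hε
    refine ⟨⟨hemb, by rw [hrange]; exact Hexagon.isOpen_chartImage hε⟩, hrange, fun h0 => ?_⟩
    rw [isHomeomorph_iff_isEmbedding_surjective]
    refine ⟨hemb, Set.range_eq_univ.1 ?_⟩
    rw [hrange, h0, Hexagon.chartImage_zero]
  · obtain ⟨V, hV, e⟩ := isOpen_induced_iff.1 (Hexagon.isOpen_chartDomain d ε)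
    refine ⟨V, hV, Set.ext fun x => ⟨fun hx => ?_, fun hx => ?_⟩⟩
    · have hx' := Hexagon.chartDomain_subset d ε hx
      exact ⟨(Set.ext_iff.1 e ⟨x, hx'⟩).2 hx, hx'⟩
    · exact (Set.ext_iff.1 e ⟨x, hx.2⟩).1 hx.1
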